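/- Let $m(p)=1$ for $1<p<2$ and $m(p)=2$ for $p\ge 2$. Let $p>p_S(5)=\frac{3+\sqrt{17}}{4}$, and let $f\in C_0^{2+m(p)}(\mathbb{R}^3)$ and $g\in C_0^{1+m(p)}(\mathbb{R}^3)$ be real-valued functions with compact support (no radial symmetry is assumed). For $\varepsilon>0$ let $$u^0(x,t)=\varepsilon\frac{t}{4\pi}\int_{|\xi|=1}\{f(x+t\xi)+g(x+t\xi)\}\,d\omega_\xi+\varepsilon\frac{\partial}{\partial t}\Big\{\frac{t}{4\pi}\int_{|\xi|=1}f(x+t\xi)\,d\omega_\xi\Big\},$$ and, for $w\in C(\mathbb{R}^3\times[0,\infty))$, $$L[w](x,t)=\frac{1}{4\pi}\int_0^t(t-s)\int_{|\eta|=1}(1+s)^{-(p-1)}\,w(x+(t-s)\eta,s)\,d\omega_\eta\,ds .$$ Consider the integral equation $$u(x,t)=u^0(x,t)+L[|u|^p](x,t),\qquad (x,t)\in\mathbb{R}^3\times[0,\infty).\qquad(*)$$ (1) For every $\varepsilon>0$, $u^0$ is a $C^2$ solution on $\mathbb{R}^3\times[0,\infty)$ of the linear wave equation $u^0_{tt}-\Delta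 u^0=0$ with $u^0(x,0)=\varepsilon f(x)$ and $u^0_t(x,0)=\varepsilon\{f(x)+g(x)\}$. (2) If $p\ge2$, then for every $\varepsilon>0$ a function $u\in C^2(\mathbb{R}^3\times[0,\infty))$ satisfies $(*)$ if and only if $v(x,t)=u(x,t)/(1+t)$ is a classical $C^2$ solution on $\mathbb{R}^3\times[0,\infty)$ of the damped wave equation $v_{tt}-\Delta v+\frac{2}{1+t}v_t=|v|^p$ with $v(x,0)=\varepsilon f(x)$ and $v_t(x,0)=\varepsilon g(x)$. (3) There is $\varepsilon_0>0$, depending on $p,f,g$, such that for every $0<\varepsilon\le\varepsilon_0$ the equation $(*)$ has a unique global solution $u\in C^{m(p)}(\mathbb{R}^3\times[0,\infty))$. -/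

import Mathlib

open MeasureTheory

noncomputable section

/-- Three-dimensional Euclidean space. -/
abbrev E3 : Type := EuclideanSpace ℝ (Fin 3)

/-- The closed half space `ℝ³ × [0, ∞)`, a point being `(x, t)`. -/
def halfSpace : Set (E3 × ℝ) := Set.univ ×ˢ Set.Ici (0 : ℝ)

/-- The order of regularity: `m(p) = 1` for `p < 2` and `m(p) = 2` for `p ≥ 2`. -/
def regularity (p : ℝ) : ℕ := if p < 2 then 1 else 2

/-- The integral of `h` over the unit sphere of `ℝ³` with respect to the surface measure
(of total mass `4π`). -/
def sphereIntegral (h : E3 → ℝ) : ℝ :=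
  ∫ ω : Metric.sphere (0 : E3) 1, h ω ∂((volume : Measure E3).toSphere)

/-- Kirchhoff's formula for the solution `u⁰` of the free wave equation with initial position
`ε f` and initial velocity `ε (f + g)`. -/
def freeWave (ε : ℝ) (f g : E3 → ℝ) (z : E3 × ℝ) : ℝ :=
  ε * (z.2 / (4 * Real.pi)) * sphereIntegral (fun ξ => f (z.1 + z.2 • ξ) + g (z.1 + z.2 • ξ)) +
    ε * deriv (fun t : ℝ => t / (4 * Real.pi) * sphereIntegral (fun ξ => f (z.1 + t • ξ))) z.2

/-- The weighted Duhamel operator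
`L[w](x,t) = (4π)⁻¹ ∫₀ᵗ (t-s) ∫_{|η|=1} (1+s)^{-(p-1)} w(x+(t-s)η, s) dω ds`. -/
def duhamel (p : ℝ) (w : E3 × ℝ → ℝ) (z : E3 × ℝ) : ℝ :=
  1 / (4 * Real.pi) * ∫ s in (0 : ℝ)..z.2, (z.2 - s) *
    sphereIntegral (fun η => (1 + s) ^ (-(p - 1)) * w (z.1 + (z.2 - s) • η, s))

/-- `u` satisfies `u = u⁰ + L[|u|^p]` on `ℝ³ × [0, ∞)`. -/
def SolvesIntegralEq (p ε : ℝ) (f g : E3 → ℝ) (u : E3 × ℝ → ℝ) : Prop :=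
  ∀ x : E3, ∀ t : ℝ, 0 ≤ t →
    u (x, t) = freeWave ε f g (x, t) + duhamel p (fun z => |u z| ^ p) (x, t)

/-- The first time derivative on `[0, ∞)`, one-sided at `t = 0`. -/
def timeDeriv (u : E3 × ℝ → ℝ) (x : E3) (t : ℝ) : ℝ :=
  derivWithin (fun s => u (x, s)) (Set.Ici 0) t

/-- The second time derivative on `[0, ∞)`, one-sided at `t = 0`. -/
def timeDeriv2 (u : E3 × ℝ → ℝ) (x : E3) (t : ℝ) : ℝ :=
  derivWithin (fun s => timeDeriv u x s) (Set.Ici 0) t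

/-- The Laplacian in the space variable. -/
def spaceLaplacian (u : E3 × ℝ → ℝ) (x : E3) (t : ℝ) : ℝ :=
  Laplacian.laplacian (fun y : E3 => u (y, t)) x

/-- `w` is a `C²` solution on `ℝ³ × [0, ∞)` of the linear wave equation `w_tt - Δw = 0` with
`w(x,0) = φ(x)` and `w_t(x,0) = ψ(x)`. -/
def IsLinearWave (φ ψ : E3 → ℝ) (w : E3 × ℝ → ℝ) : Prop :=
  ContDiffOn ℝ 2 w halfSpace ∧
  (∀ x : E3, ∀ t : ℝ, 0 ≤ t → timeDeriv2 w x t - spaceLaplacian w x t = 0) ∧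
  (∀ x : E3, w (x, 0) = φ x) ∧ (∀ x : E3, timeDeriv w x 0 = ψ x)

/-- `v` is a `C²` solution on `ℝ³ × [0, ∞)` of the semilinear damped wave equation
`v_tt - Δv + μ (1+t)^{-β} v_t = |v|^p` with `v(x,0) = φ(x)` and `v_t(x,0) = ψ(x)`. -/
def IsDampedWave (μ β p : ℝ) (φ ψ : E3 → ℝ) (v : E3 × ℝ → ℝ) : Prop :=
  ContDiffOn ℝ 2 v halfSpace ∧
  (∀ x : E3, ∀ t : ℝ, 0 ≤ t →
    timeDeriv2 v x t - spaceLaplacian v x t + μ / (1 + t) ^ β * timeDeriv v x t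
      = |v (x, t)| ^ p) ∧
  (∀ x : E3, v (x, 0) = φ x) ∧ (∀ x : E3, timeDeriv v x 0 = ψ x)

end

/-! Everything rests on spherical means. Invariance of the surface measure under isometries gives
integration by parts along rotation fields (`sphereIntegral_rotation_eq_zero`). Applied twice in
each coordinate plane and summed, this is the Darboux identity (`sphereIntegral_darboux`), which
says that `t` times the spherical mean of `h` solves the wave equation. Part (1) follows by
differentiating Kirchhoff's formula.

For part (2), put `u = (1 + t) v`. The damped operator applied to `v`, multiplied by `1 + t`, is the
undamped wave operator applied to `u`, and the source becomes `(1 + t)^{-(p-1)} |u|^p`. The integral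
equation yields the differential equation by differentiating Duhamel's integral, whose source is
`C²` because `p ≥ 2`. Conversely `kirchhoff_representation` recovers a `C²` function from its data
and its wave operator. A `C²` extension across `t = 0` lets both arguments use ordinary derivatives.

Part (3) is a Picard iteration in the weighted space `|u| ≤ const · w`, where `w = (1 + t + r)⁻¹ (1
+ |t - r|)^{-a}` on `r ≤ t + k`, with `r = |x|` and `a = 2p - 3`. Only the weight has to be radial:
a radial majorant of the source reduces Duhamel's integral, by John's identity
(`lintegral_sphere_radial`), to a double integral in time `s` and radius `l`. On the support `1 + s`
is comparable to `1 + s + l`, so with `α = s + l` the integrand is at most a constant times `(1 +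
α)^{-(a+1)} (1 + |s - l|)^{-ap}`. The transverse integral converges because `ap > 1`, that is `p (2p
- 3) > 1`, which for positive `p` is `p > p_S(5)`. What remains, divided by `r`, is again bounded by
a multiple of `w` (`integral_strip_le`). Hence Duhamel's operator maps sources bounded by `(1 +
s)^{-(p-1)} w^p` to functions bounded by `w`, and small data give a contraction.

The fixed point is so far only continuous. Its regularity comes from the implicit function theorem:
translation and dilation carry every backward light cone to one compact cone, and the equation
becomes a family of equations in a fixed space of continuous functions, depending differentiably on
the apex. The linearization is the identity minus a Volterra operator, which is always invertible
since the iterates decay factorially (`isUnit_one_sub_volterraOp`). The same factorial gain proves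
uniqueness without any decay hypothesis. -/

section Development

open MeasureTheory Set Filter Topology
open scoped Pointwise RealInnerProductSpace

noncomputable section

/-! ### Superposition operators on spaces of continuous functions over a compact space. -/

section Superposition

variable {K : Type} [TopologicalSpace K] [CompactSpace K]
  {E : Type} [NormedAddCommGroup E] [NormedSpace ℝ E]
  {H : Type} [NormedAddCommGroup H] [NormedSpace ℝ H]
  {F : Type} [NormedAddCommGroup F] [NormedSpace ℝ F]
  {P : Type} [NormedAddCommGroup P] [NormedSpace ℝ P]
  {Y : Type} [NormedAddCommGroup Y] [NormedSpace ℝ Y]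

/-- Pointwise application of a continuous bilinear map to two continuous fields. -/
def pointwiseApply (B : E →L[ℝ] H →L[ℝ] F) : C(K, E) →L[ℝ] C(K, H) →L[ℝ] C(K, F) :=
  LinearMap.mkContinuous₂
    (LinearMap.mk₂ ℝ
      (fun (A : C(K, E)) (W : C(K, H)) =>
        (⟨fun k => B (A k) (W k),
          (B.continuous.comp A.continuous).clm_apply W.continuous⟩ : C(K, F)))
      (fun A B W => by ext k; simp)
      (fun c A W => by ext k; simp)
      (fun A V W => by ext k; simp)
      (fun c A W => by ext k; simp)) ‖B‖
    (fun A W => by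
      refine (ContinuousMap.norm_le _ (by positivity)).2 fun k => ?_
      exact (B (A k)).le_of_opNorm_le_of_le
        (B.le_of_opNorm_le_of_le le_rfl (A.norm_coe_le_norm k)) (W.norm_coe_le_norm k))

/-- The mean value inequality on the segment from `V k` to `V k + W k` bounds the remainder by the
oscillation of `Ψ'`. That oscillation is small uniformly in `k` because postcomposition with `Ψ'` is
continuous for the sup norm. -/
lemma hasFDerivAt_postcomp (B : E →L[ℝ] H →L[ℝ] F) (Ψ : C(H, F)) (Ψ' : C(H, E))
    (h : ∀ x, HasFDerivAt Ψ (B (Ψ' x)) x) (V : C(K, H)) :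
    HasFDerivAt (fun V : C(K, H) => Ψ.comp V) (pointwiseApply B (Ψ'.comp V)) V := by
  rw [hasFDerivAt_iff_isLittleO_nhds_zero, Asymptotics.isLittleO_iff]
  intro c hc
  have hcont : Continuous fun V : C(K, H) => Ψ'.comp V := ContinuousMap.continuous_postcomp Ψ'
  have hc' : 0 < c / (‖B‖ + 1) := by positivity
  obtain ⟨δ, hδ, hball⟩ := Metric.mem_nhds_iff.1
    (hcont.continuousAt.preimage_mem_nhds (Metric.ball_mem_nhds (Ψ'.comp V) hc'))
  filter_upwards [Metric.ball_mem_nhds (0 : C(K, H)) hδ] with W hW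
  rw [mem_ball_zero_iff] at hW
  refine (ContinuousMap.norm_le _ (by positivity)).2 fun k => ?_
  have key := (convex_segment (V k) (V k + W k)).norm_image_sub_le_of_norm_hasFDerivWithin_le'
    (f := Ψ) (f' := fun x => B (Ψ' x)) (φ := B (Ψ' (V k))) (C := c) (𝕜 := ℝ)
    (fun x _ => (h x).hasFDerivWithinAt)
    (fun x hx => ?_) (left_mem_segment ℝ _ _) (right_mem_segment ℝ _ _)
  · rw [add_sub_cancel_left] at key
    refine le_trans ?_ (key.trans (mul_le_mul_of_nonneg_left (W.norm_coe_le_norm k) hc.le))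
    exact le_of_eq rfl
  · rw [segment_eq_image'] at hx
    obtain ⟨θ, hθ, rfl⟩ := hx
    have hd : dist (V + θ • W) V < δ := by
      rw [dist_eq_norm, add_sub_cancel_left, norm_smul, Real.norm_eq_abs, abs_of_nonneg hθ.1]
      exact lt_of_le_of_lt (mul_le_of_le_one_left (norm_nonneg _) hθ.2) hW
    have h2 := (ContinuousMap.dist_apply_le_dist k).trans (le_of_lt (hball hd))
    rw [dist_eq_norm] at h2
    have h3 : ‖B‖ * (c / (‖B‖ + 1)) ≤ c := by
      rw [mul_div_assoc', div_le_iff₀ (by positivity)]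
      nlinarith [norm_nonneg B]
    rw [← map_sub]
    refine (B.le_of_opNorm_le_of_le le_rfl ?_).trans h3
    simpa using h2

/-- The superposition operator of a `C^n` function is `C^n` for the uniform norm. -/
lemma contDiff_postcomp (n : ℕ) (Ψ : C(H, F)) (h : ContDiff ℝ n Ψ) :
    ContDiff ℝ n (fun V : C(K, H) => Ψ.comp V) := by
  induction n generalizing F with
  | zero =>
    rw [Nat.cast_zero, contDiff_zero]
    exact ContinuousMap.continuous_postcomp Ψ
  | succ n ih =>
    rw [Nat.cast_succ] at h ⊢
    obtain ⟨Ψ', hΨ', hd⟩ := contDiff_succ_iff_hasFDerivAt.1 h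
    rw [contDiff_succ_iff_hasFDerivAt]
    have h1 := ih (F := H →L[ℝ] F) ⟨Ψ', hΨ'.continuous⟩ hΨ'
    exact ⟨_, (pointwiseApply (ContinuousLinearMap.id ℝ (H →L[ℝ] F))).contDiff.comp h1,
      hasFDerivAt_postcomp _ Ψ _ hd⟩

/-- The constant-function embedding. -/
def constEmbedding : P →L[ℝ] C(K, P) :=
  LinearMap.mkContinuous
    { toFun := fun p => ContinuousMap.const K p
      map_add' := fun _ _ => rfl
      map_smul' := fun _ _ => rfl } 1
    (fun p => by
      rw [one_mul]
      exact (ContinuousMap.norm_le _ (norm_nonneg _)).2 fun k => le_rfl)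

/-- The embedding `V ↦ (V, 0)` at the level of continuous maps. -/
def inlField : C(K, P) →L[ℝ] C(K, P × Y) :=
  ContinuousLinearMap.compLeftContinuous ℝ K (ContinuousLinearMap.inl ℝ P Y)

/-- Mixed superposition: a field `V` and a fixed continuous field `κ`. -/
lemma contDiff_superposition (n : ℕ) (Ψ : P × Y → F) (h : ContDiff ℝ n Ψ) (κ : C(K, Y)) :
    ContDiff ℝ n (fun V : C(K, P) =>
      (⟨fun k => Ψ (V k, κ k), h.continuous.comp (V.continuous.prodMk κ.continuous)⟩ :
        C(K, F))) := by
  have h1 := contDiff_postcomp (K := K) n (⟨Ψ, h.continuous⟩ : C(P × Y, F)) h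
  have h2 : ContDiff ℝ n (fun V : C(K, P) => inlField V + (ContinuousMap.const K 0).prodMk κ) :=
    (inlField (K := K) (P := P) (Y := Y)).contDiff.add contDiff_const
  convert h1.comp h2 using 1
  ext V k
  simp [inlField]

/-- A jointly `C^n` family of functions depends in a `C^n` way on the parameter, uniformly on
compact sets. -/
lemma contDiff_family (n : ℕ) (Ψ : P × Y → F) (h : ContDiff ℝ n Ψ) (κ : C(K, Y)) :
    ContDiff ℝ n (fun p : P =>
      (⟨fun k => Ψ (p, κ k), h.continuous.comp (continuous_const.prodMk κ.continuous)⟩ :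
        C(K, F))) :=
  (contDiff_superposition n Ψ h κ).comp (constEmbedding (K := K)).contDiff

/-- Integration of continuous functions on a compact space. -/
def integralCLM [MeasurableSpace K] [OpensMeasurableSpace K] (μ : Measure K)
    [IsFiniteMeasure μ] : C(K, ℝ) →L[ℝ] ℝ :=
  LinearMap.mkContinuous
    { toFun := fun h => ∫ k, h k ∂μ
      map_add' := fun a b => integral_add
        (a.continuous.integrable_of_hasCompactSupport (HasCompactSupport.of_compactSpace _))
        (b.continuous.integrable_of_hasCompactSupport (HasCompactSupport.of_compactSpace _))
      map_smul' := fun c a => integral_const_mul _ _ } (μ.real univ)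
    (fun h => by
      refine (norm_integral_le_of_norm_le_const
        (Eventually.of_forall fun k => h.norm_coe_le_norm k)).trans (le_of_eq (mul_comm _ _)))

@[simp] lemma integralCLM_apply [MeasurableSpace K] [OpensMeasurableSpace K] (μ : Measure K)
    [IsFiniteMeasure μ] (h : C(K, ℝ)) : integralCLM μ h = ∫ k, h k ∂μ := rfl

end Superposition

/-! ### Differentiation under the integral sign over a compact space. -/

section ParametricIntegral

variable {K : Type} [TopologicalSpace K] [CompactSpace K] [MeasurableSpace K]
  [OpensMeasurableSpace K] (μ : Measure K) [IsFiniteMeasure μ]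
  {P : Type} [NormedAddCommGroup P] [NormedSpace ℝ P]
  {Y : Type} [NormedAddCommGroup Y] [NormedSpace ℝ Y]

lemma contDiff_parametric_integral (n : ℕ) (Ψ : P × Y → ℝ) (h : ContDiff ℝ n Ψ) (κ : C(K, Y)) :
    ContDiff ℝ n (fun p : P => ∫ k, Ψ (p, κ k) ∂μ) :=
  (integralCLM μ).contDiff.comp (contDiff_family n Ψ h κ)

/-- The family is differentiated as a curve in `C(K, ℝ)`, on which the integral is a continuous
linear functional. Evaluation at `k` identifies the derivative of the curve pointwise, so no
dominating function has to be produced. -/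
lemma hasDerivAt_parametric_integral (Ψ : ℝ × Y → ℝ) (h : ContDiff ℝ 1 Ψ) (κ : C(K, Y)) (t : ℝ) :
    HasDerivAt (fun s : ℝ => ∫ k, Ψ (s, κ k) ∂μ)
      (∫ k, deriv (fun s => Ψ (s, κ k)) t ∂μ) t := by
  have hF := contDiff_family 1 Ψ (by exact_mod_cast h) κ
  have hd : HasDerivAt _ _ t :=
    ((hF.differentiable (by simp)).differentiableAt (x := t)).hasDerivAt
  have h1 := (integralCLM μ).hasFDerivAt.comp_hasDerivAt t hd
  refine h1.congr_deriv ?_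
  rw [integralCLM_apply]
  refine integral_congr_ae (Eventually.of_forall fun k => ?_)
  have h2 := (ContinuousMap.evalCLM ℝ k : C(K, ℝ) →L[ℝ] ℝ).hasFDerivAt.comp_hasDerivAt t hd
  exact h2.deriv.symm

lemma laplacian_parametric_integral (Ψ : E3 × Y → ℝ) (h : ContDiff ℝ 2 Ψ) (κ : C(K, Y))
    (x : E3) :
    Laplacian.laplacian (fun y : E3 => ∫ k, Ψ (y, κ k) ∂μ) x
      = ∫ k, Laplacian.laplacian (fun y => Ψ (y, κ k)) x ∂μ := by
  have hF := (contDiff_family 2 Ψ (by exact_mod_cast h) κ).contDiffAt (x := x)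
  have h1 := hF.laplacian_CLM_comp_left (l := integralCLM μ)
  refine h1.trans ?_
  rw [Function.comp_apply, integralCLM_apply]
  refine integral_congr_ae (Eventually.of_forall fun k => ?_)
  exact (hF.laplacian_CLM_comp_left (l := (ContinuousMap.evalCLM ℝ k : C(K, ℝ) →L[ℝ] ℝ))).symm

end ParametricIntegral

/-! ### The unit sphere: rotations, Archimedes' theorem and John's identity. -/

section SphereMeasure

/-- The surface measure on the unit sphere. -/
abbrev sphereMeasure : Measure (Metric.sphere (0 : E3) 1) := (volume : Measure E3).toSphere

/-- The inclusion of the unit sphere. -/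
def sphereIncl : C(Metric.sphere (0 : E3) 1, E3) := ⟨Subtype.val, continuous_subtype_val⟩

lemma integrable_sphere {h : E3 → ℝ} (hc : Continuous h) :
    Integrable (fun ω : Metric.sphere (0 : E3) 1 => h ω) sphereMeasure :=
  (hc.comp continuous_subtype_val).integrable_of_hasCompactSupport
    (HasCompactSupport.of_compactSpace _)

lemma sphereIntegral_add {h k : E3 → ℝ} (hc : Continuous h) (kc : Continuous k) :
    sphereIntegral (fun x => h x + k x) = sphereIntegral h + sphereIntegral k :=
  integral_add (integrable_sphere hc) (integrable_sphere kc)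

lemma sphereIntegral_sub {h k : E3 → ℝ} (hc : Continuous h) (kc : Continuous k) :
    sphereIntegral (fun x => h x - k x) = sphereIntegral h - sphereIntegral k :=
  integral_sub (integrable_sphere hc) (integrable_sphere kc)

lemma sphereIntegral_const_mul (c : ℝ) (h : E3 → ℝ) :
    sphereIntegral (fun x => c * h x) = c * sphereIntegral h :=
  integral_const_mul _ _

lemma sphereIntegral_congr {h k : E3 → ℝ} (hk : ∀ ξ : E3, ‖ξ‖ = 1 → h ξ = k ξ) :
    sphereIntegral h = sphereIntegral k :=
  integral_congr_ae (Eventually.of_forall fun ω => hk ω (by simp))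

lemma sphereMeasure_real_univ : sphereMeasure.real univ = 4 * Real.pi := by
  rw [Measure.toSphere_real_apply_univ, measureReal_def, EuclideanSpace.volume_ball_fin_three]
  have : (0 : ℝ) ≤ Real.pi * 4 / 3 := by positivity
  simp [ENNReal.toReal_ofReal this]
  ring

lemma sphereIntegral_const (c : ℝ) : sphereIntegral (fun _ => c) = 4 * Real.pi * c := by
  rw [sphereIntegral, integral_const, sphereMeasure_real_univ, smul_eq_mul]

/-- The action of a linear isometry on the unit sphere. -/
def sphereMap (R : E3 ≃ₗᵢ[ℝ] E3) (ω : Metric.sphere (0 : E3) 1) : Metric.sphere (0 : E3) 1 :=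
  ⟨R ω, by simp⟩

lemma continuous_sphereMap (R : E3 ≃ₗᵢ[ℝ] E3) : Continuous (sphereMap R) :=
  (R.continuous.comp continuous_subtype_val).subtype_mk _

lemma sphereMap_injective (R : E3 ≃ₗᵢ[ℝ] E3) : Function.Injective (sphereMap R) := by
  intro a b hab
  exact Subtype.ext (R.injective (congrArg Subtype.val hab))

/-- `Measure.toSphere` measures a set by the volume of the cone over it, and a linear isometry
preserves volume and commutes with forming the cone. -/
lemma measurePreserving_sphereMap (R : E3 ≃ₗᵢ[ℝ] E3) :
    MeasurePreserving (sphereMap R) sphereMeasure sphereMeasure := by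
  refine ⟨(continuous_sphereMap R).measurable, ?_⟩
  ext s hs
  rw [Measure.map_apply (continuous_sphereMap R).measurable hs,
    Measure.toSphere_apply' _ hs,
    Measure.toSphere_apply' _ ((continuous_sphereMap R).measurable hs)]
  congr 1
  rw [← R.measurePreserving.measure_preimage_emb R.toHomeomorph.measurableEmbedding
    (Ioo (0 : ℝ) 1 • (Subtype.val '' s))]
  congr 1
  ext x
  simp only [Set.mem_smul, mem_preimage, mem_image, Subtype.exists, exists_and_right,
    exists_eq_right]
  constructor
  · rintro ⟨c, hc, y, ⟨hy, hys⟩, rfl⟩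
    exact ⟨c, hc, R y, ⟨by simpa using hy, hys⟩, by simp⟩
  · rintro ⟨c, hc, y, ⟨hy, hys⟩, hx⟩
    refine ⟨c, hc, R.symm y, ⟨by simpa using hy, ?_⟩, ?_⟩
    · have h1 : sphereMap R ⟨R.symm y, by simpa using hy⟩ = ⟨y, hy⟩ :=
        Subtype.ext (R.apply_symm_apply y)
      rw [h1]
      exact hys
    · rw [← map_smul, hx, R.symm_apply_apply]

lemma sphereIntegral_comp_isometry (R : E3 ≃ₗᵢ[ℝ] E3) (h : E3 → ℝ) :
    sphereIntegral (fun ξ => h (R ξ)) = sphereIntegral h :=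
  (measurePreserving_sphereMap R).integral_comp
    ((continuous_sphereMap R).isClosedEmbedding (sphereMap_injective R)).measurableEmbedding
    (fun ω : Metric.sphere (0 : E3) 1 => h ω)

open scoped RealInnerProductSpace

/-- Integration by parts on the unit sphere for the infinitesimal rotations. -/
lemma sphereIntegral_rotation_eq_zero {G : E3 → ℝ} (hG : ContDiff ℝ 1 G) {a : E3} (ha : ‖a‖ = 1)
    (b : E3) :
    sphereIntegral (fun ξ => fderiv ℝ G ξ (⟪a, ξ⟫ • b - ⟪b, ξ⟫ • a)) = 0 := by
  -- The component of `b` orthogonal to `a`. The rotation field of the pair `(a, b)` is the same for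
  -- `(a, c)`.
  set c : E3 := b - ⟪a, b⟫ • a with hc
  have haa : ⟪a, a⟫ = 1 := by rw [real_inner_self_eq_norm_sq, ha]; norm_num
  have hac : ⟪a, c⟫ = 0 := by rw [hc, inner_sub_right, inner_smul_right, haa]; ring
  have hv : ∀ θ : ℝ, ‖a + θ • c‖ ^ 2 = 1 + θ ^ 2 * ‖c‖ ^ 2 := fun θ => by
    rw [norm_add_sq_real, inner_smul_right, hac, ha, norm_smul, mul_pow, Real.norm_eq_abs, sq_abs]
    ring
  -- The half-turn about the line spanned by `a + θ c` is an explicit rational family of isometries.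
  -- Its derivative at `θ = 0` is twice the rotation field evaluated at the half-turn of `ξ` about
  -- `a`, and that fixed half-turn is then removed by isometry invariance.
  let ρ : ℝ × E3 → E3 := fun q =>
    (2 * (⟪a + q.1 • c, q.2⟫ / (1 + q.1 ^ 2 * ‖c‖ ^ 2))) • (a + q.1 • c) - q.2
  have hρ : ContDiff ℝ 1 ρ := by
    have hpos : ∀ q : ℝ × E3, (1 + q.1 ^ 2 * ‖c‖ ^ 2) ≠ 0 := fun q => by positivity
    refine ((contDiff_const.mul (ContDiff.div (ContDiff.inner ℝ ?_ ?_) ?_ hpos)).smul ?_).sub ?_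
    all_goals fun_prop
  have hR : ∀ θ : ℝ, ∀ ξ : E3, (ℝ ∙ (a + θ • c)).reflection ξ = ρ (θ, ξ) := fun θ ξ => by
    rw [Submodule.reflection_singleton_apply]
    simp only [RCLike.ofReal_real_eq_id, id_eq, hv, ρ, mul_smul, two_smul]
  have hconst : ∀ θ : ℝ, sphereIntegral (fun ξ => G (ρ (θ, ξ))) = sphereIntegral G := fun θ => by
    rw [← sphereIntegral_comp_isometry ((ℝ ∙ (a + θ • c)).reflection) G]
    simp only [hR]
  have hd := hasDerivAt_parametric_integral sphereMeasure (fun q => G (ρ q)) (hG.comp hρ)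
    sphereIncl 0
  have hd0 : ∫ ω, deriv (fun s => G (ρ (s, sphereIncl ω))) 0 ∂sphereMeasure = 0 := by
    refine hd.unique ?_
    have : (fun s : ℝ => ∫ ω, G (ρ (s, sphereIncl ω)) ∂sphereMeasure) =
      fun _ => sphereIntegral G := funext hconst
    rw [this]
    exact hasDerivAt_const _ _
  have hderiv : ∀ ξ : E3, deriv (fun s => G (ρ (s, ξ))) 0
      = 2 * fderiv ℝ G ((ℝ ∙ a).reflection ξ) (⟪a, (ℝ ∙ a).reflection ξ⟫ • b
        - ⟪b, (ℝ ∙ a).reflection ξ⟫ • a) := fun ξ => by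
    have hρ0 : (ℝ ∙ a).reflection ξ = ρ (0, ξ) := by simpa using hR 0 ξ
    have hρ0' : ρ (0, ξ) = (2 * ⟪a, ξ⟫) • a - ξ := by simp [ρ]
    have h1 : HasDerivAt (fun s => ρ (s, ξ)) ((2 * ⟪c, ξ⟫) • a + (2 * ⟪a, ξ⟫) • c) 0 := by
      have hnum : HasDerivAt (fun s : ℝ => ⟪a + s • c, ξ⟫) ⟪c, ξ⟫ 0 := by
        simp only [inner_add_left, inner_smul_left, conj_trivial]
        simpa using ((hasDerivAt_id (0 : ℝ)).mul_const ⟪c, ξ⟫).const_add ⟪a, ξ⟫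
      have hden : HasDerivAt (fun s : ℝ => 1 + s ^ 2 * ‖c‖ ^ 2) 0 0 := by
        simpa using (((hasDerivAt_id (0 : ℝ)).pow 2).mul_const (‖c‖ ^ 2)).const_add 1
      have hvec : HasDerivAt (fun s : ℝ => a + s • c) c 0 := by
        simpa using ((hasDerivAt_id (0 : ℝ)).smul_const c).const_add a
      have h := ((((hnum.div hden (by norm_num)).const_mul 2).smul hvec).sub_const ξ)
      refine h.congr_deriv ?_
      simp
      abel
    rw [hρ0]
    have h2 := ((hG.differentiable (by simp)) (ρ (0, ξ))).hasFDerivAt.comp_hasDerivAt (0 : ℝ) h1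
    refine h2.deriv.trans ?_
    rw [← smul_eq_mul (2 : ℝ) (fderiv ℝ G (ρ (0, ξ)) _), ← map_smul]
    congr 1
    rw [hρ0', hc]
    simp only [inner_sub_right, inner_sub_left, inner_smul_right, inner_smul_left, haa,
      real_inner_comm b a, conj_trivial]
    module
  have h3 : sphereIntegral (fun ξ => deriv (fun s => G (ρ (s, ξ))) 0) = 0 := hd0
  simp only [hderiv] at h3
  rw [sphereIntegral_comp_isometry ((ℝ ∙ a).reflection) (fun η => 2 * fderiv ℝ G η
    (⟪a, η⟫ • b - ⟪b, η⟫ • a)), sphereIntegral_const_mul] at h3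
  linarith

/-- The rotation identities for `ξ_j ψ(⟪e, ξ⟫)` in the planes of `e` and the basis vectors, summed
over `j`, amount to the divergence theorem on the sphere for `ψ(z) ∇z` with `z = ⟪e, ξ⟫`. There
`|∇z|² = 1 - z²` and `Δz = -2z`. -/
lemma sphereIntegral_archimedes {e : E3} (he : ‖e‖ = 1) {ψ : ℝ → ℝ} (hψ : ContDiff ℝ 1 ψ) :
    sphereIntegral (fun ξ => 2 * ⟪e, ξ⟫ * ψ ⟪e, ξ⟫ - (1 - ⟪e, ξ⟫ ^ 2) * deriv ψ ⟪e, ξ⟫) = 0 := by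
  let u : Fin 3 → E3 := fun j => EuclideanSpace.single j 1
  have hG : ∀ j, ContDiff ℝ 1 (fun ξ : E3 => ξ j * ψ ⟪e, ξ⟫) := fun j => by
    have h1 : ContDiff ℝ 1 (fun ξ : E3 => ξ j) := by fun_prop
    have h2 : ContDiff ℝ 1 (fun ξ : E3 => ⟪e, ξ⟫) := (innerSL ℝ e).contDiff
    exact h1.mul (hψ.comp h2)
  have hI := fun j => sphereIntegral_rotation_eq_zero (hG j) he (u j)
  have hfd : ∀ j (ξ v : E3), fderiv ℝ (fun ξ : E3 => ξ j * ψ ⟪e, ξ⟫) ξ v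
      = v j * ψ ⟪e, ξ⟫ + ξ j * (deriv ψ ⟪e, ξ⟫ * ⟪e, v⟫) := fun j ξ v => by
    have h1 : HasFDerivAt (fun ξ : E3 => ξ j) (EuclideanSpace.proj j : E3 →L[ℝ] ℝ) ξ :=
      (EuclideanSpace.proj j : E3 →L[ℝ] ℝ).hasFDerivAt
    have h2 : HasFDerivAt (fun ξ : E3 => ⟪e, ξ⟫) (innerSL ℝ e) ξ := (innerSL ℝ e).hasFDerivAt
    have h3 := ((hψ.differentiable (by simp)) ⟪e, ξ⟫).hasDerivAt.comp_hasFDerivAt ξ h2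
    have h4 : HasFDerivAt (fun ξ : E3 => ξ j * ψ ⟪e, ξ⟫) _ ξ := h1.mul h3
    rw [h4.fderiv]
    simp
    ring
  have hint : ∀ j, Continuous (fun ξ : E3 =>
      fderiv ℝ (fun ξ : E3 => ξ j * ψ ⟪e, ξ⟫) ξ (⟪e, ξ⟫ • u j - ⟪u j, ξ⟫ • e)) := fun j => by
    refine ((hG j).continuous_fderiv (by simp)).clm_apply ?_
    fun_prop
  have hsum := (integral_finsetSum (μ := sphereMeasure) Finset.univ
    (fun j _ => integrable_sphere (hint j))).trans (Finset.sum_eq_zero fun j _ => hI j)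
  rw [← hsum]
  refine integral_congr_ae (Eventually.of_forall fun ω => ?_)
  have hξ : ‖(ω : E3)‖ = 1 := norm_eq_of_mem_sphere ω
  beta_reduce
  generalize (ω : E3) = ξ at hξ ⊢
  simp only [hfd]
  have hn : ξ 0 ^ 2 + ξ 1 ^ 2 + ξ 2 ^ 2 = 1 := by
    have := EuclideanSpace.real_norm_sq_eq ξ
    rw [hξ, Fin.sum_univ_three] at this
    linarith
  have he' : ⟪e, ξ⟫ = ξ 0 * e 0 + ξ 1 * e 1 + ξ 2 * e 2 := by
    simp [PiLp.inner_apply, Fin.sum_univ_three]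
  have hee : ⟪e, e⟫ = 1 := by rw [real_inner_self_eq_norm_sq, he]; norm_num
  have hu : ∀ j, ⟪u j, ξ⟫ = ξ j := fun j => by
    simp [u, EuclideanSpace.inner_single_left]
  have hu' : ∀ j, ⟪e, u j⟫ = e j := fun j => by
    simp [u, EuclideanSpace.inner_single_right]
  simp only [inner_sub_right, inner_smul_right, hee, hu, hu', Fin.sum_univ_three]
  simp [u]
  linear_combination (⟪e, ξ⟫ * deriv ψ ⟪e, ξ⟫ - ψ ⟪e, ξ⟫) * he' + deriv ψ ⟪e, ξ⟫ * hn

/-- Archimedes: a coordinate on the unit sphere is uniformly distributed (moments). -/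
lemma sphereIntegral_inner_pow {e : E3} (he : ‖e‖ = 1) (n : ℕ) :
    sphereIntegral (fun ξ => ⟪e, ξ⟫ ^ n) = 2 * Real.pi * ∫ s in (-1 : ℝ)..1, s ^ n := by
  rw [integral_pow]
  induction n using Nat.twoStepInduction with
  | zero =>
    simp [sphereIntegral_const]
    ring
  | one =>
    have h := sphereIntegral_archimedes he (ψ := fun _ => 1) contDiff_const
    simp only [deriv_const, mul_zero, sub_zero, mul_one] at h
    rw [sphereIntegral_const_mul] at h
    simp only [pow_one]
    norm_num
    linarith
  | more n ih _ =>
    -- This choice gives the recursion `(n + 3) I_{n+2} = (n + 1) I_n` for the moments, which the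
    -- integrals of powers over `[-1, 1]` also satisfy.
    have h := sphereIntegral_archimedes he (ψ := fun s => s ^ (n + 1)) (by fun_prop)
    have hc : ∀ m : ℕ, Continuous fun ξ : E3 => ⟪e, ξ⟫ ^ m := fun m => by fun_prop
    have h2 : (fun ξ : E3 => 2 * ⟪e, ξ⟫ * ⟪e, ξ⟫ ^ (n + 1) -
        (1 - ⟪e, ξ⟫ ^ 2) * deriv (fun s : ℝ => s ^ (n + 1)) ⟪e, ξ⟫)
        = fun ξ => (n + 3) * ⟪e, ξ⟫ ^ (n + 2) - (n + 1) * ⟪e, ξ⟫ ^ n := by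
      funext ξ
      simp
      ring
    rw [h2, sphereIntegral_sub ((hc _).const_mul _) ((hc _).const_mul _),
      sphereIntegral_const_mul, sphereIntegral_const_mul, ih] at h
    have h4 : ((n : ℝ) + 1) ≠ 0 := by positivity
    have h3 : ((n : ℝ) + 3) ≠ 0 := by positivity
    have h5 : ((n + 2 : ℕ) : ℝ) + 1 ≠ 0 := by positivity
    field_simp at h
    rw [← mul_div_assoc, eq_div_iff h5]
    push_cast
    have h6 : (-1 : ℝ) ^ (n + 2 + 1) = (-1) ^ (n + 1) := by ring
    rw [h6]
    simp only [one_pow] at h ⊢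
    linarith

/-- Archimedes' theorem: the image of the surface measure under a coordinate. -/
lemma map_inner_sphereMeasure {e : E3} (he : ‖e‖ = 1) :
    sphereMeasure.map (fun ω : Metric.sphere (0 : E3) 1 => ⟪e, (ω : E3)⟫)
      = ENNReal.ofReal (2 * Real.pi) • volume.restrict (Icc (-1 : ℝ) 1) := by
  have hm : Continuous (fun ω : Metric.sphere (0 : E3) 1 => ⟪e, (ω : E3)⟫) := by fun_prop
  have : IsFiniteMeasure (ENNReal.ofReal (2 * Real.pi) • volume.restrict (Icc (-1 : ℝ) 1)) :=
    Measure.smul_finite _ ENNReal.ofReal_ne_top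
  have := Measure.isFiniteMeasure_map sphereMeasure
    (fun ω : Metric.sphere (0 : E3) 1 => ⟪e, (ω : E3)⟫)
  refine ext_of_forall_integral_eq_of_IsFiniteMeasure fun φ => ?_
  rw [integral_map hm.aemeasurable φ.continuous.aestronglyMeasurable, integral_smul_measure,
    ENNReal.toReal_ofReal (by positivity), smul_eq_mul, integral_Icc_eq_integral_Ioc,
    ← intervalIntegral.integral_of_le (by norm_num)]
  have hpoly : ∀ q : Polynomial ℝ, sphereIntegral (fun ξ => q.eval ⟪e, ξ⟫)
      = 2 * Real.pi * ∫ s in (-1 : ℝ)..1, q.eval s := fun q => by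
    induction q using Polynomial.induction_on' with
    | add q r hq hr =>
      simp only [Polynomial.eval_add]
      rw [sphereIntegral_add (by fun_prop) (by fun_prop), hq, hr,
        intervalIntegral.integral_add (Continuous.intervalIntegrable (by fun_prop) _ _)
          (Continuous.intervalIntegrable (by fun_prop) _ _)]
      ring
    | monomial n c =>
      simp only [Polynomial.eval_monomial]
      rw [sphereIntegral_const_mul, sphereIntegral_inner_pow he,
        intervalIntegral.integral_const_mul]
      ring
  refine eq_of_forall_dist_le fun ε hε => ?_
  have hpi := Real.pi_pos
  -- Weierstrass approximation reduces to moments. Since the two measures have the same total mass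
  -- `4π`, a tolerance of `ε / (8π)` costs `ε / 2` on each side.
  obtain ⟨q, hq⟩ := exists_polynomial_near_of_continuousOn (-1) 1 φ φ.continuous.continuousOn
    (ε / (8 * Real.pi)) (by positivity)
  have hmem : ∀ ω : Metric.sphere (0 : E3) 1, ⟪e, (ω : E3)⟫ ∈ Icc (-1 : ℝ) 1 := fun ω => by
    have := abs_real_inner_le_norm e (ω : E3)
    rw [he, norm_eq_of_mem_sphere, one_mul] at this
    exact abs_le.1 this
  have h1 : |sphereIntegral (fun ξ => q.eval ⟪e, ξ⟫) - sphereIntegral (fun ξ => φ ⟪e, ξ⟫)|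
      ≤ ε / 2 := by
    rw [← sphereIntegral_sub (by fun_prop) (by fun_prop)]
    refine (norm_integral_le_of_norm_le_const (μ := sphereMeasure) (C := ε / (8 * Real.pi))
      (f := fun ω : Metric.sphere (0 : E3) 1 => q.eval ⟪e, (ω : E3)⟫ - φ ⟪e, (ω : E3)⟫)
      (Eventually.of_forall fun ω => (hq _ (hmem ω)).le)).trans (le_of_eq ?_)
    rw [sphereMeasure_real_univ]
    field_simp
    norm_num
  have h2 : |(∫ s in (-1 : ℝ)..1, q.eval s) - ∫ s in (-1 : ℝ)..1, φ s| ≤ ε / (8 * Real.pi) * 2 := by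
    rw [← intervalIntegral.integral_sub (Continuous.intervalIntegrable (by fun_prop) _ _)
      (Continuous.intervalIntegrable (by fun_prop) _ _)]
    have h := intervalIntegral.norm_integral_le_of_norm_le_const (a := -1) (b := 1)
      (f := fun s => q.eval s - φ s) (C := ε / (8 * Real.pi)) fun s hs => by
        rw [uIoc_of_le (by norm_num)] at hs
        exact (hq s ⟨hs.1.le, hs.2⟩).le
    rwa [show |(1 : ℝ) - -1| = 2 by norm_num] at h
  have h3 : 2 * Real.pi * (ε / (8 * Real.pi) * 2) = ε / 2 := by field_simp; norm_num
  have h4 : |2 * Real.pi * (∫ s in (-1 : ℝ)..1, q.eval s) - 2 * Real.pi * ∫ s in (-1 : ℝ)..1, φ s|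
      ≤ ε / 2 := by
    rw [← mul_sub, abs_mul, abs_of_pos (by positivity : (0 : ℝ) < 2 * Real.pi), ← h3]
    gcongr
  rw [hpoly] at h1
  rw [Real.dist_eq]
  change |sphereIntegral (fun ξ => φ ⟪e, ξ⟫) - _| ≤ ε
  rw [abs_le] at h1 h4 ⊢
  constructor <;> linarith [h1.1, h1.2, h4.1, h4.2]

/-- John's identity for spherical means of radial functions. -/
lemma lintegral_sphere_radial {x : E3} (hx : x ≠ 0) {ρ : ℝ} (hρ : 0 < ρ)
    {b : ℝ → ENNReal} (hb : Measurable b) :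
    ∫⁻ ω : Metric.sphere (0 : E3) 1, b ‖x + ρ • (ω : E3)‖ ∂sphereMeasure
      = ENNReal.ofReal (2 * Real.pi / (‖x‖ * ρ)) *
        ∫⁻ l in Icc |‖x‖ - ρ| (‖x‖ + ρ), ENNReal.ofReal l * b l := by
  set r := ‖x‖ with hr
  have hr0 : 0 < r := norm_pos_iff.2 hx
  set e : E3 := r⁻¹ • x with he
  have hen : ‖e‖ = 1 := by rw [he, norm_smul, norm_inv, norm_norm, ← hr, inv_mul_cancel₀ hr0.ne']
  have hxe : x = r • e := by rw [he, smul_smul, mul_inv_cancel₀ hr0.ne', one_smul]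
  have hnorm : ∀ ω : Metric.sphere (0 : E3) 1,
      ‖x + ρ • (ω : E3)‖ = √(r ^ 2 + ρ ^ 2 + 2 * r * ρ * ⟪e, (ω : E3)⟫) := fun ω => by
    have hω : ‖(ω : E3)‖ = 1 := norm_eq_of_mem_sphere ω
    rw [← Real.sqrt_sq (norm_nonneg (x + ρ • (ω : E3))), norm_add_sq_real, norm_smul, hω,
      inner_smul_right, Real.norm_eq_abs, mul_one, sq_abs, ← hr]
    congr 1
    rw [hxe, inner_smul_left, conj_trivial]
    ring
  have hm : Continuous (fun ω : Metric.sphere (0 : E3) 1 => ⟪e, (ω : E3)⟫) := by fun_prop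
  have hmb : Measurable fun s : ℝ => b √(r ^ 2 + ρ ^ 2 + 2 * r * ρ * s) :=
    hb.comp (by fun_prop)
  simp only [hnorm]
  rw [← lintegral_map hmb hm.measurable, map_inner_sphereMeasure hen, lintegral_smul_measure]
  -- The law of cosines solved for the coordinate in terms of `l = ‖x + ρ ω‖`. Its derivative `l /
  -- (r ρ)` produces both the weight `l` and the factor `1 / (‖x‖ ρ)`.
  let g : ℝ → ℝ := fun l => (l ^ 2 - r ^ 2 - ρ ^ 2) / (2 * r * ρ)
  have himg : g '' Icc |r - ρ| (r + ρ) = Icc (-1) 1 := by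
    ext s
    constructor
    · rintro ⟨l, ⟨h1, h2⟩, rfl⟩
      have h3 : (r - ρ) ^ 2 ≤ l ^ 2 := sq_le_sq' (by linarith [neg_abs_le (r - ρ)])
        ((le_abs_self _).trans h1)
      have h4 : l ^ 2 ≤ (r + ρ) ^ 2 := by
        have : 0 ≤ l := (abs_nonneg _).trans h1
        gcongr
      simp only [g]
      constructor
      · rw [le_div_iff₀ (by positivity)]
        nlinarith
      · rw [div_le_iff₀ (by positivity)]
        nlinarith
    · rintro ⟨h1, h2⟩
      have h0 : 0 < r * ρ := by positivity
      have h3 : (r - ρ) ^ 2 ≤ r ^ 2 + ρ ^ 2 + 2 * r * ρ * s := by nlinarith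
      refine ⟨√(r ^ 2 + ρ ^ 2 + 2 * r * ρ * s), ⟨?_, ?_⟩, ?_⟩
      · rw [← Real.sqrt_sq_eq_abs]
        exact Real.sqrt_le_sqrt h3
      · rw [Real.sqrt_le_left (by positivity)]
        nlinarith
      · simp only [g]
        rw [Real.sq_sqrt (by nlinarith [sq_nonneg (r - ρ)])]
        field_simp
        ring
  have hg : ∀ l ∈ Icc |r - ρ| (r + ρ), HasDerivWithinAt g (l / (r * ρ)) (Icc |r - ρ| (r + ρ)) l := by
    intro l _
    have h := ((((hasDerivAt_id l).pow 2).sub_const (r ^ 2)).sub_const (ρ ^ 2)).div_const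
      (2 * r * ρ)
    refine (h.congr_deriv ?_).hasDerivWithinAt
    simp
    field_simp
  have hinj : InjOn g (Icc |r - ρ| (r + ρ)) := by
    intro l hl m hm' h
    simp only [g] at h
    rw [div_left_inj' (by positivity)] at h
    exact (pow_left_inj₀ ((abs_nonneg _).trans hl.1) ((abs_nonneg _).trans hm'.1) two_ne_zero).1
      (by linarith)
  rw [← himg, lintegral_image_eq_lintegral_abs_deriv_mul measurableSet_Icc hg hinj,
    smul_eq_mul]
  have hpt : ∀ l ∈ Icc |r - ρ| (r + ρ), ENNReal.ofReal |l / (r * ρ)| *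
      b √(r ^ 2 + ρ ^ 2 + 2 * r * ρ * g l)
      = ENNReal.ofReal (1 / (r * ρ)) * (ENNReal.ofReal l * b l) := by
    intro l hl
    have hl0 : 0 ≤ l := (abs_nonneg _).trans hl.1
    have h1 : r ^ 2 + ρ ^ 2 + 2 * r * ρ * g l = l ^ 2 := by
      simp only [g]
      field_simp
      ring
    rw [h1, Real.sqrt_sq hl0, abs_of_nonneg (by positivity), ← mul_assoc,
      ← ENNReal.ofReal_mul (by positivity)]
    congr 2
    ring
  rw [setLIntegral_congr_fun measurableSet_Icc hpt, lintegral_const_mul, ← mul_assoc,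
    ← ENNReal.ofReal_mul (by positivity)]
  · congr 2
    field_simp
  · exact (ENNReal.measurable_ofReal.comp measurable_id).mul hb

end SphereMeasure

/-! ### The Darboux identity and Kirchhoff's representation formula. -/

section Kirchhoff

variable {P : Type} [NormedAddCommGroup P] [NormedSpace ℝ P]

lemma contDiff_sphereIntegral (n : ℕ) {Φ : P × E3 → ℝ} (h : ContDiff ℝ n Φ) :
    ContDiff ℝ n (fun p => sphereIntegral fun ξ => Φ (p, ξ)) :=
  contDiff_parametric_integral sphereMeasure n Φ h sphereIncl

lemma continuous_sphereIntegral {Φ : P × E3 → ℝ} (h : Continuous Φ) :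
    Continuous (fun p => sphereIntegral fun ξ => Φ (p, ξ)) :=
  contDiff_zero.1 (contDiff_sphereIntegral 0 (contDiff_zero.2 h))

lemma hasDerivAt_sphereIntegral {Φ : ℝ × E3 → ℝ} (h : ContDiff ℝ 1 Φ) {Φ' : ℝ → E3 → ℝ}
    (hd : ∀ s ξ, HasDerivAt (fun s => Φ (s, ξ)) (Φ' s ξ) s) (t : ℝ) :
    HasDerivAt (fun s => sphereIntegral fun ξ => Φ (s, ξ)) (sphereIntegral (Φ' t)) t :=
  (hasDerivAt_parametric_integral sphereMeasure Φ h sphereIncl t).congr_deriv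
    (sphereIntegral_congr fun ξ _ => (hd t ξ).deriv)

/-- The standard basis vectors of `ℝ³`. -/
def basisVec (i : Fin 3) : E3 := EuclideanSpace.single i 1

lemma laplacian_eq_sum (h : E3 → ℝ) (x : E3) :
    Laplacian.laplacian h x = ∑ i, fderiv ℝ (fderiv ℝ h) x (basisVec i) (basisVec i) := by
  rw [InnerProductSpace.laplacian_eq_iteratedFDeriv_orthonormalBasis h
    (EuclideanSpace.basisFun (Fin 3) ℝ)]
  simp [iteratedFDeriv_two_apply, basisVec]

lemma eq_sum_basisVec (y : E3) : y = y 0 • basisVec 0 + y 1 • basisVec 1 + y 2 • basisVec 2 := by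
  ext i
  fin_cases i <;> simp [basisVec]

lemma continuous_laplacian {h : E3 → ℝ} (hh : ContDiff ℝ 2 h) :
    Continuous (Laplacian.laplacian h) := by
  have h1 : Continuous (fderiv ℝ (fderiv ℝ h)) :=
    (hh.fderiv_right (m := 1) (by norm_num)).continuous_fderiv (by simp)
  rw [funext (laplacian_eq_sum h)]
  exact continuous_finsetSum _ fun i _ => (h1.clm_apply continuous_const).clm_apply
    continuous_const

/-- The function `ξ_i ∂_j h - ξ_j ∂_i h` at `x + r ξ` is already, up to the factor `r`, a rotational
derivative of `h(x + r ξ)`. Applying the rotation identity to it integrates the square of the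
rotation generator in the `(i, j)` plane. -/
lemma sphereIntegral_rotation_pair {h : E3 → ℝ} (hh : ContDiff ℝ 2 h) (x : E3) (r : ℝ)
    {i j : Fin 3} (hij : i ≠ j) :
    sphereIntegral (fun ξ =>
      r * (ξ i ^ 2 * fderiv ℝ (fderiv ℝ h) (x + r • ξ) (basisVec j) (basisVec j)
        - ξ i * ξ j * (fderiv ℝ (fderiv ℝ h) (x + r • ξ) (basisVec j) (basisVec i)
          + fderiv ℝ (fderiv ℝ h) (x + r • ξ) (basisVec i) (basisVec j))
        + ξ j ^ 2 * fderiv ℝ (fderiv ℝ h) (x + r • ξ) (basisVec i) (basisVec i))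
      - ξ i * fderiv ℝ h (x + r • ξ) (basisVec i)
      - ξ j * fderiv ℝ h (x + r • ξ) (basisVec j)) = 0 := by
  have hh' : ContDiff ℝ 1 (fderiv ℝ h) := hh.fderiv_right (by norm_num)
  have hz : ContDiff ℝ 1 (fun ξ : E3 => x + r • ξ) := by fun_prop
  have hp : ∀ k, ContDiff ℝ 1 (fun ξ : E3 => ξ k) := fun k => by fun_prop
  have hG : ContDiff ℝ 1 (fun ξ : E3 => ξ i * fderiv ℝ h (x + r • ξ) (basisVec j)
      - ξ j * fderiv ℝ h (x + r • ξ) (basisVec i)) :=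
    ((hp i).mul ((hh'.comp hz).clm_apply contDiff_const)).sub
      ((hp j).mul ((hh'.comp hz).clm_apply contDiff_const))
  have ha : ‖basisVec i‖ = 1 := by simp [basisVec]
  rw [← sphereIntegral_rotation_eq_zero hG ha (basisVec j)]
  refine sphereIntegral_congr fun ξ _ => ?_
  have h1 : ∀ k, HasFDerivAt (fun ξ : E3 => ξ k) (EuclideanSpace.proj k : E3 →L[ℝ] ℝ) ξ :=
    fun k => (EuclideanSpace.proj k : E3 →L[ℝ] ℝ).hasFDerivAt
  have hz' : HasFDerivAt (fun ξ : E3 => x + r • ξ) (r • ContinuousLinearMap.id ℝ E3) ξ :=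
    ((hasFDerivAt_id ξ).const_smul r).const_add x
  have h2 := ((hh'.differentiable (by simp)) (x + r • ξ)).hasFDerivAt.comp ξ hz'
  have h3 : ∀ k, HasFDerivAt (fun ξ : E3 => fderiv ℝ h (x + r • ξ) (basisVec k)) _ ξ :=
    fun k => h2.clm_apply (hasFDerivAt_const (basisVec k) ξ)
  have h4 : HasFDerivAt (fun ξ : E3 => ξ i * fderiv ℝ h (x + r • ξ) (basisVec j)
      - ξ j * fderiv ℝ h (x + r • ξ) (basisVec i)) _ ξ :=
    ((h1 i).mul (h3 j)).sub ((h1 j).mul (h3 i))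
  rw [h4.fderiv]
  have hu : ∀ k, ⟪basisVec k, ξ⟫ = ξ k := fun k => by
    simp [basisVec, EuclideanSpace.inner_single_left]
  have hii : ∀ k, (basisVec k) k = 1 := fun k => by simp [basisVec]
  have hij1 : (basisVec i) j = 0 := by simp [basisVec, hij.symm]
  have hij2 : (basisVec j) i = 0 := by simp [basisVec, hij]
  simp [hu, hii, hij1, hij2]
  ring

/-- The Darboux identity in integrated form. -/
lemma sphereIntegral_darboux {h : E3 → ℝ} (hh : ContDiff ℝ 2 h) (x : E3) (r : ℝ) :
    sphereIntegral (fun ξ => 2 * fderiv ℝ h (x + r • ξ) ξ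
        + r * fderiv ℝ (fderiv ℝ h) (x + r • ξ) ξ ξ)
      = sphereIntegral (fun ξ => r * Laplacian.laplacian h (x + r • ξ)) := by
  have hh' : ContDiff ℝ 1 (fderiv ℝ h) := hh.fderiv_right (by norm_num)
  have c0 : Continuous (fun ξ : E3 => x + r • ξ) := by fun_prop
  have c1 : Continuous (fun ξ : E3 => fderiv ℝ h (x + r • ξ)) := hh'.continuous.comp c0
  have c2 : Continuous (fun ξ : E3 => fderiv ℝ (fderiv ℝ h) (x + r • ξ)) :=
    (hh'.continuous_fderiv (by simp)).comp c0
  have cl : Continuous (fun ξ : E3 => r * Laplacian.laplacian h (x + r • ξ)) :=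
    ((continuous_laplacian hh).comp c0).const_mul r
  have cd : Continuous (fun ξ : E3 => 2 * fderiv ℝ h (x + r • ξ) ξ
        + r * fderiv ℝ (fderiv ℝ h) (x + r • ξ) ξ ξ) :=
    ((c1.clm_apply continuous_id).const_mul 2).add
      (((c2.clm_apply continuous_id).clm_apply continuous_id).const_mul r)
  rw [← sub_eq_zero, ← sphereIntegral_sub cd cl]
  let A : Fin 3 → Fin 3 → E3 → ℝ := fun i j ξ =>
      r * (ξ i ^ 2 * fderiv ℝ (fderiv ℝ h) (x + r • ξ) (basisVec j) (basisVec j)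
        - ξ i * ξ j * (fderiv ℝ (fderiv ℝ h) (x + r • ξ) (basisVec j) (basisVec i)
          + fderiv ℝ (fderiv ℝ h) (x + r • ξ) (basisVec i) (basisVec j))
        + ξ j ^ 2 * fderiv ℝ (fderiv ℝ h) (x + r • ξ) (basisVec i) (basisVec i))
      - ξ i * fderiv ℝ h (x + r • ξ) (basisVec i)
      - ξ j * fderiv ℝ h (x + r • ξ) (basisVec j)
  have c : ∀ i j : Fin 3, Continuous (A i j) := fun i j => by
    have d1 : ∀ k, Continuous (fun ξ : E3 => fderiv ℝ h (x + r • ξ) (basisVec k)) :=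
      fun k => c1.clm_apply continuous_const
    have d2 : ∀ k l, Continuous (fun ξ : E3 =>
        fderiv ℝ (fderiv ℝ h) (x + r • ξ) (basisVec k) (basisVec l)) :=
      fun k l => (c2.clm_apply continuous_const).clm_apply continuous_const
    fun_prop
  have e : ∀ {i j : Fin 3}, i ≠ j → sphereIntegral (A i j) = 0 :=
    fun hij => sphereIntegral_rotation_pair hh x r hij
  -- The three squared generators add up to the spherical Laplacian: on `‖ξ‖ = 1` the sum is `r (Δh
  -- - D²h(ξ, ξ)) - 2 Dh(ξ)`, the negative of the difference to be integrated.
  have hs : sphereIntegral (fun ξ => A 0 1 ξ + A 0 2 ξ + A 1 2 ξ) = 0 := by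
    have c3 : Continuous fun ξ => A 0 1 ξ + A 0 2 ξ := (c 0 1).add (c 0 2)
    rw [sphereIntegral_add c3 (c 1 2), sphereIntegral_add (c 0 1) (c 0 2),
      e (by decide), e (by decide), e (by decide), add_zero, add_zero]
  have hneg : sphereIntegral (fun ξ => -1 * (A 0 1 ξ + A 0 2 ξ + A 1 2 ξ)) = 0 := by
    rw [sphereIntegral_const_mul, hs, mul_zero]
  rw [← hneg]
  refine sphereIntegral_congr fun ξ hξ => ?_
  have hn : ξ 0 ^ 2 + ξ 1 ^ 2 + ξ 2 ^ 2 = 1 := by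
    have := EuclideanSpace.real_norm_sq_eq ξ
    rw [hξ, Fin.sum_univ_three] at this
    linarith
  simp only [A]
  rw [laplacian_eq_sum, Fin.sum_univ_three]
  have e1 : fderiv ℝ h (x + r • ξ) ξ = fderiv ℝ h (x + r • ξ)
      (ξ 0 • basisVec 0 + ξ 1 • basisVec 1 + ξ 2 • basisVec 2) := by
    rw [← eq_sum_basisVec]
  have e2 : fderiv ℝ (fderiv ℝ h) (x + r • ξ) ξ ξ = fderiv ℝ (fderiv ℝ h) (x + r • ξ)
      (ξ 0 • basisVec 0 + ξ 1 • basisVec 1 + ξ 2 • basisVec 2)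
      (ξ 0 • basisVec 0 + ξ 1 • basisVec 1 + ξ 2 • basisVec 2) := by
    rw [← eq_sum_basisVec]
  rw [e1, e2]
  simp only [map_add, map_smul, add_apply, smul_apply,
    smul_eq_mul]
  generalize fderiv ℝ (fderiv ℝ h) (x + r • ξ) = B
  linear_combination (r * (B (basisVec 0) (basisVec 0) + B (basisVec 1) (basisVec 1)
    + B (basisVec 2) (basisVec 2))) * hn

/-- `t` times the spherical mean of `h` over the sphere of radius `t` about `x`. -/
def kirchhoff (h : E3 → ℝ) (x : E3) (t : ℝ) : ℝ :=
  t / (4 * Real.pi) * sphereIntegral (fun ξ => h (x + t • ξ))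

/-- The radial derivative of `kirchhoff`. -/
def kirchhoffDeriv (h : E3 → ℝ) (x : E3) (t : ℝ) : ℝ :=
  1 / (4 * Real.pi) * sphereIntegral (fun ξ => h (x + t • ξ) + t * fderiv ℝ h (x + t • ξ) ξ)

lemma hasDerivAt_comp_ray {F : Type} [NormedAddCommGroup F] [NormedSpace ℝ F] {h : E3 → F}
    (hh : ContDiff ℝ 1 h) (x ξ : E3) (t : ℝ) :
    HasDerivAt (fun t : ℝ => h (x + t • ξ)) (fderiv ℝ h (x + t • ξ) ξ) t := by
  have h1 : HasDerivAt (fun t : ℝ => x + t • ξ) ξ t := by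
    simpa using ((hasDerivAt_id t).smul_const ξ).const_add x
  exact ((hh.differentiable (by simp)) _).hasFDerivAt.comp_hasDerivAt t h1

lemma hasDerivAt_kirchhoff {h : E3 → ℝ} (hh : ContDiff ℝ 1 h) (x : E3) (t : ℝ) :
    HasDerivAt (kirchhoff h x) (kirchhoffDeriv h x t) t := by
  have h1 : HasDerivAt (fun t : ℝ => sphereIntegral fun ξ => h (x + t • ξ)) _ t :=
    hasDerivAt_sphereIntegral (Φ := fun q : ℝ × E3 => h (x + q.1 • q.2))
      (hh.comp (by fun_prop)) (fun s ξ => hasDerivAt_comp_ray hh x ξ s) t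
  have h2 := ((hasDerivAt_id t).div_const (4 * Real.pi)).mul h1
  refine h2.congr_deriv ?_
  have c0 : Continuous (fun ξ : E3 => x + t • ξ) := by fun_prop
  have c1 : Continuous (fun ξ : E3 => fderiv ℝ h (x + t • ξ) ξ) :=
    ((hh.continuous_fderiv (by simp)).comp c0).clm_apply continuous_id
  have c2 : Continuous (fun ξ : E3 => h (x + t • ξ)) := hh.continuous.comp c0
  rw [kirchhoffDeriv, sphereIntegral_add c2 (c1.const_mul t),
    sphereIntegral_const_mul]
  simp
  ring

/-- Differentiating under the integral produces exactly the left side of the Darboux identity. Thus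
`kirchhoff h` has its Laplacian as second time derivative. -/
lemma hasDerivAt_kirchhoffDeriv {h : E3 → ℝ} (hh : ContDiff ℝ 2 h) (x : E3) (t : ℝ) :
    HasDerivAt (kirchhoffDeriv h x) (kirchhoff (Laplacian.laplacian h) x t) t := by
  have hh' : ContDiff ℝ 1 (fderiv ℝ h) := hh.fderiv_right (by norm_num)
  have hray : ContDiff ℝ 1 (fun q : ℝ × E3 => x + q.1 • q.2) := by fun_prop
  have h1 : HasDerivAt (fun t : ℝ => sphereIntegral fun ξ =>
      h (x + t • ξ) + t * fderiv ℝ h (x + t • ξ) ξ) _ t :=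
    hasDerivAt_sphereIntegral
      (Φ := fun q : ℝ × E3 => h (x + q.1 • q.2) + q.1 * fderiv ℝ h (x + q.1 • q.2) q.2)
      (Φ' := fun t ξ => 2 * fderiv ℝ h (x + t • ξ) ξ
        + t * fderiv ℝ (fderiv ℝ h) (x + t • ξ) ξ ξ)
      (((hh.of_le (by norm_num)).comp hray).add
        (contDiff_fst.mul ((hh'.comp hray).clm_apply contDiff_snd)))
      (fun s ξ => by
        have a1 := hasDerivAt_comp_ray (hh.of_le (by norm_num)) x ξ s
        have a2 := (hasDerivAt_comp_ray hh' x ξ s).clm_apply (hasDerivAt_const s ξ)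
        refine (a1.add ((hasDerivAt_id s).mul a2)).congr_deriv ?_
        simp
        ring) t
  refine (h1.const_mul (1 / (4 * Real.pi))).congr_deriv ?_
  rw [sphereIntegral_darboux hh, sphereIntegral_const_mul, kirchhoff]
  ring

lemma laplacian_comp_add (h : E3 → ℝ) (c x : E3) :
    Laplacian.laplacian (fun y => h (y + c)) x = Laplacian.laplacian h (x + c) := by
  rw [laplacian_eq_sum, laplacian_eq_sum]
  have h1 : fderiv ℝ (fun y => h (y + c)) = fun y => fderiv ℝ h (y + c) :=
    funext fun y => fderiv_comp_add_right c
  rw [h1, fderiv_comp_add_right]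

lemma laplacian_const_mul {h : E3 → ℝ} (c : ℝ) {x : E3} (hh : ContDiffAt ℝ 2 h x) :
    Laplacian.laplacian (fun y => c * h y) x = c * Laplacian.laplacian h x :=
  InnerProductSpace.laplacian_smul c hh

lemma laplacian_kirchhoff {h : E3 → ℝ} (hh : ContDiff ℝ 2 h) (x : E3) (t : ℝ) :
    Laplacian.laplacian (fun y => kirchhoff h y t) x
      = kirchhoff (Laplacian.laplacian h) x t := by
  have hΦ : ContDiff ℝ 2 (fun q : E3 × E3 => h (q.1 + t • q.2)) := hh.comp (by fun_prop)
  have h1 := laplacian_parametric_integral sphereMeasure (fun q => h (q.1 + t • q.2)) hΦ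
    sphereIncl x
  have h2 : ContDiff ℝ 2 (fun y : E3 => sphereIntegral fun ξ => h (y + t • ξ)) := by
    exact contDiff_sphereIntegral 2 hΦ
  unfold kirchhoff
  rw [laplacian_const_mul _ h2.contDiffAt]
  congr 1
  refine h1.trans (integral_congr_ae (Eventually.of_forall fun ω => ?_))
  exact laplacian_comp_add h (t • (ω : E3)) x

/-- The wave operator applied to a function on space-time. -/
def waveOp (U : E3 × ℝ → ℝ) (z : E3 × ℝ) : ℝ :=
  fderiv ℝ (fderiv ℝ U) z (0, 1) (0, 1)
    - ∑ i, fderiv ℝ (fderiv ℝ U) z (basisVec i, 0) (basisVec i, 0)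

lemma continuous_waveOp {U : E3 × ℝ → ℝ} (hU : ContDiff ℝ 2 U) : Continuous (waveOp U) := by
  have h1 : Continuous (fderiv ℝ (fderiv ℝ U)) :=
    (hU.fderiv_right (m := 1) (by norm_num)).continuous_fderiv (by simp)
  exact ((h1.clm_apply continuous_const).clm_apply continuous_const).sub
    (continuous_finsetSum _ fun i _ => (h1.clm_apply continuous_const).clm_apply
      continuous_const)

lemma fderiv_slice {F : Type} [NormedAddCommGroup F] [NormedSpace ℝ F] {U : E3 × ℝ → F} {t : ℝ}
    {y : E3} (hU : DifferentiableAt ℝ U (y, t)) :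
    fderiv ℝ (fun y => U (y, t)) y
      = (fderiv ℝ U (y, t)).comp (ContinuousLinearMap.inl ℝ E3 ℝ) :=
  (hU.hasFDerivAt.comp (f := fun y => (y, t)) y (hasFDerivAt_prodMk_left y t)).fderiv

lemma fderiv_fderiv_slice {U : E3 × ℝ → ℝ} (hU : ContDiff ℝ 2 U) (y : E3) (t : ℝ) (v w : E3) :
    fderiv ℝ (fderiv ℝ (fun y => U (y, t))) y v w
      = fderiv ℝ (fderiv ℝ U) (y, t) (v, 0) (w, 0) := by
  have hd := hU.differentiable (by simp)
  have hd' : Differentiable ℝ (fderiv ℝ U) :=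
    (hU.fderiv_right (m := 1) (by norm_num)).differentiable (by simp)
  have h1 : fderiv ℝ (fun y => U (y, t))
      = fun y => (fderiv ℝ U (y, t)).comp (ContinuousLinearMap.inl ℝ E3 ℝ) :=
    funext fun y => fderiv_slice (hd _)
  have h2 := (hd' (y, t)).hasFDerivAt.comp (f := fun y => (y, t)) y (hasFDerivAt_prodMk_left y t)
  have h3 : HasFDerivAt (fun y => (fderiv ℝ U (y, t)).comp (ContinuousLinearMap.inl ℝ E3 ℝ)) _ y :=
    h2.clm_comp (hasFDerivAt_const (ContinuousLinearMap.inl ℝ E3 ℝ) y)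
  rw [h1, h3.fderiv]
  simp

lemma laplacian_slice {U : E3 × ℝ → ℝ} (hU : ContDiff ℝ 2 U) (y : E3) (t : ℝ) :
    Laplacian.laplacian (fun y => U (y, t)) y
      = ∑ i, fderiv ℝ (fderiv ℝ U) (y, t) (basisVec i, 0) (basisVec i, 0) := by
  rw [laplacian_eq_sum]
  simp only [fderiv_fderiv_slice hU]

/-- Kirchhoff's formula with Duhamel's term: a `C²` function is recovered from its Cauchy data and
from its image under the wave operator. -/
theorem kirchhoff_representation {U : E3 × ℝ → ℝ} (hU : ContDiff ℝ 2 U) (x : E3) (t : ℝ) :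
    U (x, t) = kirchhoffDeriv (fun y => U (y, 0)) x t
      + kirchhoff (fun y => fderiv ℝ U (y, 0) (0, 1)) x t
      + 1 / (4 * Real.pi) * ∫ s in (0 : ℝ)..t,
          (t - s) * sphereIntegral (fun η => waveOp U (x + (t - s) • η, s)) := by
  have hU1 : ContDiff ℝ 1 U := hU.of_le (by norm_num)
  have hU' : ContDiff ℝ 1 (fderiv ℝ U) := hU.fderiv_right (by norm_num)
  let ζ : ℝ × E3 → E3 × ℝ := fun q => (x + (t - q.1) • q.2, q.1)
  have hζ : ContDiff ℝ 1 ζ := by fun_prop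
  -- The spherical integral of `Φ` over the slice at time `s` of the backward light cone equals `4π
  -- U(x, t)` at the apex `s = t` and the data terms (times `4π`) at `s = 0`. By Darboux its
  -- `s`-derivative contains only the wave operator, so the formula is the fundamental theorem of
  -- calculus.
  let Φ : ℝ × E3 → ℝ := fun q => U (ζ q) + (t - q.1) * fderiv ℝ U (ζ q) (q.2, 1)
  have hΦ : ContDiff ℝ 1 Φ := by
    refine (hU1.comp hζ).add ((contDiff_const.sub contDiff_fst).mul
      ((hU'.comp hζ).clm_apply (contDiff_snd.prodMk contDiff_const)))
  have hΦd : ∀ s ξ, HasDerivAt (fun s => Φ (s, ξ))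
      ((t - s) * (fderiv ℝ (fderiv ℝ U) (ζ (s, ξ)) (0, 1) (0, 1))
        - (2 * fderiv ℝ U (ζ (s, ξ)) (ξ, 0)
          + (t - s) * fderiv ℝ (fderiv ℝ U) (ζ (s, ξ)) (ξ, 0) (ξ, 0))) s := fun s ξ => by
    have hz : HasDerivAt (fun s => ζ (s, ξ)) (-ξ, 1) s := by
      have h1 : HasDerivAt (fun s : ℝ => x + (t - s) • ξ) (-ξ) s := by
        simpa using (((hasDerivAt_id s).const_sub t).smul_const ξ).const_add x
      exact h1.prodMk (hasDerivAt_id s)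
    have h1 := ((hU1.differentiable (by simp)) (ζ (s, ξ))).hasFDerivAt.comp_hasDerivAt
      (f := fun s => ζ (s, ξ)) s hz
    have h2 := ((hU'.differentiable (by simp)) (ζ (s, ξ))).hasFDerivAt.comp_hasDerivAt
      (f := fun s => ζ (s, ξ)) s hz
    have h3 := h2.clm_apply (hasDerivAt_const s ((ξ, 1) : E3 × ℝ))
    have h4 : HasDerivAt (fun s => Φ (s, ξ)) _ s :=
      h1.add (((hasDerivAt_id s).const_sub t).mul h3)
    refine h4.congr_deriv ?_
    -- Symmetry of the second derivative cancels the mixed space-time terms.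
    have hsymm : IsSymmSndFDerivAt ℝ U (ζ (s, ξ)) :=
      hU.contDiffAt.isSymmSndFDerivAt (by simp)
    have hs := hsymm (ξ, 0) (0, 1)
    have ea : ((-ξ, 1) : E3 × ℝ) = (0, 1) - (ξ, 0) := by simp
    have eb : ((ξ, 1) : E3 × ℝ) = (0, 1) + (ξ, 0) := by simp
    simp only [Function.comp_apply, ea, eb, map_sub, map_add, sub_apply, id, map_zero, add_zero]
    linear_combination (-(t - s)) * hs
  have hg : ∀ s, HasDerivAt (fun s => 1 / (4 * Real.pi) * sphereIntegral fun ξ => Φ (s, ξ))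
      (1 / (4 * Real.pi) *
        ((t - s) * sphereIntegral (fun η => waveOp U (x + (t - s) • η, s)))) s := fun s => by
    refine ((hasDerivAt_sphereIntegral hΦ hΦd s).congr_deriv ?_).const_mul _
    have c0 : Continuous (fun ξ : E3 => ζ (s, ξ)) := by fun_prop
    have c1 : Continuous (fun ξ : E3 => fderiv ℝ U (ζ (s, ξ))) := hU'.continuous.comp c0
    have c2 : Continuous (fun ξ : E3 => fderiv ℝ (fderiv ℝ U) (ζ (s, ξ))) :=
      (hU'.continuous_fderiv (by simp)).comp c0
    have d := sphereIntegral_darboux (h := fun y => U (y, s)) (hU.comp (by fun_prop)) x (t - s)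
    simp only [fderiv_fderiv_slice hU, laplacian_slice hU,
      fderiv_slice (hU1.differentiable (by simp) _)] at d
    simp only [ContinuousLinearMap.comp_apply, ContinuousLinearMap.inl_apply] at d
    rw [sphereIntegral_sub, ← sphereIntegral_const_mul]
    · simp only [ζ]
      rw [d, ← sphereIntegral_sub]
      · simp only [waveOp, mul_sub]
      · exact ((c2.clm_apply continuous_const).clm_apply continuous_const).const_mul _
      · exact (continuous_finsetSum _ fun i _ => (c2.clm_apply continuous_const).clm_apply
          continuous_const).const_mul _
    · exact ((c2.clm_apply continuous_const).clm_apply continuous_const).const_mul _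
    · have c3 : Continuous fun ξ : E3 => ((ξ, 0) : E3 × ℝ) := by fun_prop
      exact ((c1.clm_apply c3).const_mul 2).add (((c2.clm_apply c3).clm_apply c3).const_mul _)
  have hcont : Continuous fun s : ℝ => 1 / (4 * Real.pi) *
        ((t - s) * sphereIntegral (fun η => waveOp U (x + (t - s) • η, s))) := by
    have := continuous_sphereIntegral (Φ := fun q : ℝ × E3 => waveOp U (ζ q))
      ((continuous_waveOp hU).comp hζ.continuous)
    exact ((continuous_const.sub continuous_id).mul this).const_mul _
  have hftc := intervalIntegral.integral_eq_sub_of_hasDerivAt (a := 0) (b := t)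
    (fun s _ => hg s) (hcont.intervalIntegrable _ _)
  rw [intervalIntegral.integral_const_mul] at hftc
  rw [hftc]
  have e1 : sphereIntegral (fun ξ => Φ (t, ξ)) = 4 * Real.pi * U (x, t) := by
    rw [← sphereIntegral_const]
    exact sphereIntegral_congr fun ξ _ => by simp [Φ, ζ]
  have c0 : Continuous (fun ξ : E3 => x + t • ξ) := by fun_prop
  have c1 : Continuous (fun ξ : E3 => fderiv ℝ U (x + t • ξ, 0)) :=
    hU'.continuous.comp (c0.prodMk continuous_const)
  have e2 : 1 / (4 * Real.pi) * sphereIntegral (fun ξ => Φ (0, ξ))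
      = kirchhoffDeriv (fun y => U (y, 0)) x t
        + kirchhoff (fun y => fderiv ℝ U (y, 0) (0, 1)) x t := by
    have e3 : kirchhoff (fun y => fderiv ℝ U (y, 0) (0, 1)) x t = 1 / (4 * Real.pi) *
        sphereIntegral fun ξ => t * fderiv ℝ U (x + t • ξ, 0) (0, 1) := by
      rw [kirchhoff, sphereIntegral_const_mul]
      ring
    rw [e3, kirchhoffDeriv, ← mul_add, ← sphereIntegral_add]
    · congr 1
      refine sphereIntegral_congr fun ξ _ => ?_
      rw [fderiv_slice (hU1.differentiable (by simp) _)]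
      have eb : ((ξ, 1) : E3 × ℝ) = (ξ, 0) + (0, 1) := by simp
      simp [Φ, ζ, eb, -Prod.mk_add_mk]
      ring
    · have c2 : Continuous fun ξ : E3 => fderiv ℝ (fun y => U (y, 0)) (x + t • ξ) :=
        (((hU1.comp (by fun_prop : ContDiff ℝ 1 fun y : E3 => (y, (0 : ℝ)))).continuous_fderiv
          (by simp))).comp c0
      have c3 : Continuous fun ξ : E3 => U (x + t • ξ, 0) :=
        hU.continuous.comp (c0.prodMk continuous_const)
      exact c3.add ((c2.clm_apply continuous_id).const_mul t)
    · exact (c1.clm_apply continuous_const).const_mul t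
  rw [e1, e2]
  field_simp
  ring

end Kirchhoff

/-! ### The free wave as a `C²` solution of the linear Cauchy problem. -/

section LinearWave

lemma timeDeriv_eq {u : E3 × ℝ → ℝ} {x : E3} {t u' : ℝ} (ht : 0 ≤ t)
    (h : HasDerivWithinAt (fun s => u (x, s)) u' (Ici 0) t) : timeDeriv u x t = u' :=
  h.derivWithin (uniqueDiffOn_Ici 0 t ht)

lemma timeDeriv2_eq {u : E3 × ℝ → ℝ} {x : E3} {t u'' : ℝ} {u' : ℝ → ℝ} (ht : 0 ≤ t)
    (h : ∀ s, 0 ≤ s → HasDerivWithinAt (fun s => u (x, s)) (u' s) (Ici 0) s)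
    (h' : HasDerivWithinAt u' u'' (Ici 0) t) : timeDeriv2 u x t = u'' := by
  refine (HasDerivWithinAt.congr h' (fun s hs => ?_) ?_).derivWithin (uniqueDiffOn_Ici 0 t ht)
  · exact timeDeriv_eq hs (h s hs)
  · exact timeDeriv_eq ht (h t ht)

/-- Radius and time slice are independent parameters, because Duhamel's integral uses the radius `t
- s` on the slice `s`. -/
lemma contDiff_kirchhoff_family (n : ℕ) {W : E3 × ℝ → ℝ} (hW : ContDiff ℝ n W) :
    ContDiff ℝ n (fun q : E3 × ℝ × ℝ => kirchhoff (fun y => W (y, q.2.2)) q.1 q.2.1) := by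
  have h := contDiff_sphereIntegral n (P := E3 × ℝ × ℝ)
    (Φ := fun q => W (q.1.1 + q.1.2.1 • q.2, q.1.2.2)) (hW.comp (by fun_prop))
  exact ((contDiff_fst.comp contDiff_snd).div_const _).mul h

lemma contDiff_kirchhoffDeriv_family (n : ℕ) {W : E3 × ℝ → ℝ}
    (hW : ContDiff ℝ ((n + 1 : ℕ) : WithTop ℕ∞) W) :
    ContDiff ℝ n (fun q : E3 × ℝ × ℝ => kirchhoffDeriv (fun y => W (y, q.2.2)) q.1 q.2.1) := by
  have hd : Differentiable ℝ W := hW.differentiable (by simp)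
  have hW' : ContDiff ℝ n (fderiv ℝ W) := hW.fderiv_right (by norm_cast)
  have hζ : ContDiff ℝ n (fun q : (E3 × ℝ × ℝ) × E3 => (q.1.1 + q.1.2.1 • q.2, q.1.2.2)) := by
    fun_prop
  have h := contDiff_sphereIntegral n (P := E3 × ℝ × ℝ)
    (Φ := fun q => W (q.1.1 + q.1.2.1 • q.2, q.1.2.2)
      + q.1.2.1 * fderiv ℝ W (q.1.1 + q.1.2.1 • q.2, q.1.2.2) (q.2, 0))
    (((hW.of_le (by norm_cast; omega)).comp hζ).add
      ((by fun_prop : ContDiff ℝ n (fun q : (E3 × ℝ × ℝ) × E3 => q.1.2.1)).mul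
        ((hW'.comp hζ).clm_apply (contDiff_snd.prodMk contDiff_const))))
  refine (contDiff_const (c := 1 / (4 * Real.pi))).mul ?_
  have e : (fun q : E3 × ℝ × ℝ => sphereIntegral fun ξ => W (q.1 + q.2.1 • ξ, q.2.2)
      + q.2.1 * fderiv ℝ (fun y => W (y, q.2.2)) (q.1 + q.2.1 • ξ) ξ)
      = fun q => sphereIntegral fun ξ => W (q.1 + q.2.1 • ξ, q.2.2)
        + q.2.1 * fderiv ℝ W (q.1 + q.2.1 • ξ, q.2.2) (ξ, 0) := by
    funext q
    refine sphereIntegral_congr fun ξ _ => ?_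
    rw [fderiv_slice (hd _)]
    simp
  rw [e]
  exact h

lemma contDiff_kirchhoff (n : ℕ) {h : E3 → ℝ} (hh : ContDiff ℝ n h) :
    ContDiff ℝ n (fun z : E3 × ℝ => kirchhoff h z.1 z.2) :=
  (contDiff_kirchhoff_family n (W := fun z => h z.1) (hh.comp contDiff_fst)).comp
    (by fun_prop : ContDiff ℝ n fun z : E3 × ℝ => (z.1, z.2, (0 : ℝ)))

lemma contDiff_kirchhoffDeriv (n : ℕ) {h : E3 → ℝ}
    (hh : ContDiff ℝ ((n + 1 : ℕ) : WithTop ℕ∞) h) :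
    ContDiff ℝ n (fun z : E3 × ℝ => kirchhoffDeriv h z.1 z.2) :=
  (contDiff_kirchhoffDeriv_family n (W := fun z => h z.1) (hh.comp contDiff_fst)).comp
    (by fun_prop : ContDiff ℝ n fun z : E3 × ℝ => (z.1, z.2, (0 : ℝ)))

/-- The third derivative is symmetric in its first two slots, as the second derivative of `fderiv ℝ
h`, and in its last two, by differentiating the symmetry of the Hessian. These two transpositions
move `ξ` past the trace. -/
lemma laplacian_fderiv {h : E3 → ℝ} (hh : ContDiff ℝ 3 h) (ξ x : E3) :
    Laplacian.laplacian (fun y => fderiv ℝ h y ξ) x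
      = fderiv ℝ (Laplacian.laplacian h) x ξ := by
  have h1 : ContDiff ℝ 2 (fderiv ℝ h) := hh.fderiv_right (by norm_num)
  have h2 : ContDiff ℝ 1 (fderiv ℝ (fderiv ℝ h)) := h1.fderiv_right (by norm_num)
  have d1 : Differentiable ℝ (fderiv ℝ h) := h1.differentiable (by simp)
  have d2 : Differentiable ℝ (fderiv ℝ (fderiv ℝ h)) := h2.differentiable (by simp)
  set T := fderiv ℝ (fderiv ℝ (fderiv ℝ h)) x with hT
  have s1 : ∀ a b c : E3, T a b c = T b a c := fun a b c => by
    have : IsSymmSndFDerivAt ℝ (fderiv ℝ h) x := h1.contDiffAt.isSymmSndFDerivAt (by simp)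
    rw [hT, this a b]
  have hap : ∀ b c y : E3, HasFDerivAt (fun y => fderiv ℝ (fderiv ℝ h) y b c)
      (((fderiv ℝ (fderiv ℝ (fderiv ℝ h)) y).flip b).flip c) y := fun b c y => by
    have := ((d2 y).hasFDerivAt.clm_apply (hasFDerivAt_const b y)).clm_apply
      (hasFDerivAt_const c y)
    refine this.congr_fderiv ?_
    ext v
    simp
  have s2 : ∀ a b c : E3, T a b c = T a c b := fun a b c => by
    have e : (fun y => fderiv ℝ (fderiv ℝ h) y b c) = fun y => fderiv ℝ (fderiv ℝ h) y c b := by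
      funext y
      exact (hh.contDiffAt.of_le (by norm_num)).isSymmSndFDerivAt (n := 2) (by simp) b c
    have := (hap b c x).unique (e ▸ hap c b x)
    exact congrArg (fun L : E3 →L[ℝ] ℝ => L a) this
  have e1 : fderiv ℝ (fun y => fderiv ℝ h y ξ) = fun y => (fderiv ℝ (fderiv ℝ h) y).flip ξ := by
    funext y
    have := (d1 y).hasFDerivAt.clm_apply (hasFDerivAt_const ξ y)
    rw [this.fderiv]
    ext v
    simp
  have e2 : ∀ v w : E3, fderiv ℝ (fderiv ℝ (fun y => fderiv ℝ h y ξ)) x v w = T v w ξ := by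
    intro v w
    have h3 : HasFDerivAt (fun y => fderiv ℝ (fderiv ℝ h) y w ξ) _ x := hap w ξ x
    have h4 : Differentiable ℝ (fderiv ℝ (fun y => fderiv ℝ h y ξ)) :=
      ((h1.clm_apply contDiff_const).fderiv_right (m := 1) (by norm_num)).differentiable (by simp)
    rw [e1] at h4 ⊢
    have h5 := ((h4 x).hasFDerivAt.clm_apply (hasFDerivAt_const w x)).unique h3
    have := congrArg (fun L : E3 →L[ℝ] ℝ => L v) h5
    simpa using this
  rw [laplacian_eq_sum, funext (laplacian_eq_sum h)]
  have h6 : HasFDerivAt (fun y => ∑ i, fderiv ℝ (fderiv ℝ h) y (basisVec i) (basisVec i))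
      (∑ i, (T.flip (basisVec i)).flip (basisVec i)) x :=
    HasFDerivAt.fun_sum fun i _ => hap (basisVec i) (basisVec i) x
  rw [h6.fderiv]
  simp only [e2, sum_apply, ContinuousLinearMap.flip_apply]
  exact Finset.sum_congr rfl fun i _ => by rw [s2, s1]

lemma contDiff_laplacian (n : ℕ) {h : E3 → ℝ} (hh : ContDiff ℝ ((n + 2 : ℕ) : WithTop ℕ∞) h) :
    ContDiff ℝ n (Laplacian.laplacian h) := by
  have h1 : ContDiff ℝ ((n + 1 : ℕ) : WithTop ℕ∞) (fderiv ℝ h) := hh.fderiv_right (by norm_cast)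
  have h2 : ContDiff ℝ n (fderiv ℝ (fderiv ℝ h)) := h1.fderiv_right (by norm_cast)
  rw [funext (laplacian_eq_sum h)]
  exact ContDiff.sum fun i _ => (h2.clm_apply contDiff_const).clm_apply contDiff_const

lemma laplacian_kirchhoffDeriv {h : E3 → ℝ} (hh : ContDiff ℝ 3 h) (x : E3) (t : ℝ) :
    Laplacian.laplacian (fun y => kirchhoffDeriv h y t) x
      = kirchhoffDeriv (Laplacian.laplacian h) x t := by
  have hh' : ContDiff ℝ 2 (fderiv ℝ h) := hh.fderiv_right (by norm_num)
  have hz : ContDiff ℝ 2 (fun q : E3 × E3 => q.1 + t • q.2) := by fun_prop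
  have hΦ : ContDiff ℝ 2 (fun q : E3 × E3 => h (q.1 + t • q.2)
      + t * fderiv ℝ h (q.1 + t • q.2) q.2) :=
    ((hh.of_le (by norm_num)).comp hz).add
      (contDiff_const.mul ((hh'.comp hz).clm_apply contDiff_snd))
  have h1 := laplacian_parametric_integral sphereMeasure _ hΦ sphereIncl x
  have h2 : ContDiff ℝ 2 (fun y : E3 => sphereIntegral fun ξ => h (y + t • ξ)
      + t * fderiv ℝ h (y + t • ξ) ξ) := contDiff_sphereIntegral 2 hΦ
  unfold kirchhoffDeriv
  rw [laplacian_const_mul _ h2.contDiffAt]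
  congr 1
  refine h1.trans (integral_congr_ae (Eventually.of_forall fun ω => ?_))
  have c1 : ContDiff ℝ 2 (fun y : E3 => h (y + t • (ω : E3))) :=
    (hh.of_le (by norm_num)).comp (by fun_prop)
  have c2 : ContDiff ℝ 2 (fun y : E3 => fderiv ℝ h (y + t • (ω : E3)) ω) :=
    (hh'.comp (by fun_prop : ContDiff ℝ 2 fun y : E3 => y + t • (ω : E3))).clm_apply
      contDiff_const
  have a1 := c1.contDiffAt.laplacian_add (x := x) (contDiff_const.mul c2 (f := fun _ => t)).contDiffAt
  refine a1.trans ?_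
  rw [laplacian_const_mul _ c2.contDiffAt, laplacian_comp_add,
    laplacian_comp_add (fun y => fderiv ℝ h y ω), laplacian_fderiv hh]

lemma freeWave_eq {f : E3 → ℝ} (hf : ContDiff ℝ 1 f) (g : E3 → ℝ) (ε : ℝ) (z : E3 × ℝ) :
    freeWave ε f g z
      = ε * (kirchhoff (fun y => f y + g y) z.1 z.2 + kirchhoffDeriv f z.1 z.2) := by
  have h := (hasDerivAt_kirchhoff hf z.1 z.2).deriv
  unfold freeWave
  rw [← h, mul_add, kirchhoff, mul_assoc]
  rfl

lemma contDiff_freeWave {f g : E3 → ℝ} (hf : ContDiff ℝ 3 f) (hg : ContDiff ℝ 2 g) (ε : ℝ) :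
    ContDiff ℝ 2 (freeWave ε f g) := by
  rw [funext (freeWave_eq (hf.of_le (by norm_num)) g ε)]
  exact contDiff_const.mul ((contDiff_kirchhoff 2 ((hf.of_le (by norm_num)).add hg)).add
    (contDiff_kirchhoffDeriv 2 (by exact_mod_cast hf)))

lemma kirchhoff_zero (h : E3 → ℝ) (x : E3) : kirchhoff h x 0 = 0 := by simp [kirchhoff]

lemma kirchhoffDeriv_zero (h : E3 → ℝ) (x : E3) : kirchhoffDeriv h x 0 = h x := by
  have := Real.pi_pos
  simp only [kirchhoffDeriv, zero_smul, add_zero, zero_mul, sphereIntegral_const]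
  field_simp

lemma hasDerivAt_freeWave {f g : E3 → ℝ} (hf : ContDiff ℝ 3 f) (hg : ContDiff ℝ 2 g) (ε : ℝ)
    (x : E3) (t : ℝ) :
    HasDerivAt (fun t => freeWave ε f g (x, t))
      (ε * (kirchhoffDeriv (fun y => f y + g y) x t
        + kirchhoff (Laplacian.laplacian f) x t)) t := by
  simp only [freeWave_eq (hf.of_le (by norm_num)) g ε]
  exact ((hasDerivAt_kirchhoff ((hf.of_le (by norm_num)).add (hg.of_le (by norm_num))) x t).add
    (hasDerivAt_kirchhoffDeriv (hf.of_le (by norm_num)) x t)).const_mul ε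

/-- Two time derivatives put the Laplacian on the data, and the Laplacian commutes with both
`kirchhoff` and `kirchhoffDeriv`. The second commutation uses three derivatives of `f`. -/
lemma hasDerivAt_freeWave_deriv {f g : E3 → ℝ} (hf : ContDiff ℝ 3 f) (hg : ContDiff ℝ 2 g)
    (ε : ℝ) (x : E3) (t : ℝ) :
    HasDerivAt (fun t => ε * (kirchhoffDeriv (fun y => f y + g y) x t
        + kirchhoff (Laplacian.laplacian f) x t))
      (spaceLaplacian (freeWave ε f g) x t) t := by
  have hl : ContDiff ℝ 1 (Laplacian.laplacian f) := contDiff_laplacian 1 hf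
  have hfg : ContDiff ℝ 2 (fun y => f y + g y) := (hf.of_le (by norm_num)).add hg
  refine (((hasDerivAt_kirchhoffDeriv hfg x t).add
    (hasDerivAt_kirchhoff hl x t)).const_mul ε).congr_deriv ?_
  have c1 : ContDiff ℝ 2 (fun y => kirchhoff (fun y => f y + g y) y t) :=
    (contDiff_kirchhoff 2 hfg).comp (by fun_prop : ContDiff ℝ 2 fun y : E3 => (y, t))
  have c2 : ContDiff ℝ 2 (fun y => kirchhoffDeriv f y t) :=
    (contDiff_kirchhoffDeriv 2 hf).comp (by fun_prop : ContDiff ℝ 2 fun y : E3 => (y, t))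
  have a1 := c1.contDiffAt.laplacian_add (x := x) c2.contDiffAt
  unfold spaceLaplacian
  simp only [freeWave_eq (hf.of_le (by norm_num)) g ε]
  rw [laplacian_const_mul _ (c1.add c2).contDiffAt]
  congr 1
  rw [← laplacian_kirchhoff hfg, ← laplacian_kirchhoffDeriv hf]
  exact a1.symm

theorem isLinearWave_freeWave {f g : E3 → ℝ} (hf : ContDiff ℝ 3 f) (hg : ContDiff ℝ 2 g) (ε : ℝ) :
    IsLinearWave (fun x => ε * f x) (fun x => ε * (f x + g x)) (freeWave ε f g) := by
  refine ⟨(contDiff_freeWave hf hg ε).contDiffOn, fun x t ht => ?_, fun x => ?_, fun x => ?_⟩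
  · rw [timeDeriv2_eq ht (fun s _ => (hasDerivAt_freeWave hf hg ε x s).hasDerivWithinAt)
      (hasDerivAt_freeWave_deriv hf hg ε x t).hasDerivWithinAt, sub_self]
  · rw [freeWave_eq (hf.of_le (by norm_num)) g ε, kirchhoff_zero, kirchhoffDeriv_zero, zero_add]
  · rw [timeDeriv_eq le_rfl (hasDerivAt_freeWave hf hg ε x 0).hasDerivWithinAt, kirchhoff_zero,
      kirchhoffDeriv_zero, add_zero]

end LinearWave

/-! ### Derivatives of Duhamel's integral. -/

section Duhamel

/-- The inclusion of the unit interval. -/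
def unitIncl : C(unitInterval, ℝ) := ⟨Subtype.val, continuous_subtype_val⟩

lemma integral_unitInterval (f : ℝ → ℝ) : ∫ σ : unitInterval, f σ = ∫ s in (0 : ℝ)..1, f s := by
  rw [intervalIntegral.integral_of_le zero_le_one, ← integral_Icc_eq_integral_Ioc]
  exact integral_subtype measurableSet_Icc f

/-- Rescaling to a fixed compact interval turns the moving endpoint into a smooth parameter. -/
lemma intervalIntegral_eq_unit (f : ℝ → ℝ) (t : ℝ) :
    ∫ s in (0 : ℝ)..t, f s = t * ∫ σ : unitInterval, f (t * σ) := by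
  rw [integral_unitInterval (fun s => f (t * s)), ← smul_eq_mul,
    intervalIntegral.smul_integral_comp_mul_left, mul_zero, mul_one]

/-- The Leibniz rule for an integral with moving endpoint. -/
lemma hasDerivAt_integral_moving {k : ℝ × ℝ → ℝ} (hk : ContDiff ℝ 1 k) {k' : ℝ → ℝ → ℝ}
    (hd : ∀ a s, HasDerivAt (fun a => k (a, s)) (k' a s) a) (t : ℝ) :
    HasDerivAt (fun t => ∫ s in (0 : ℝ)..t, k (t, s)) (k (t, t) + ∫ s in (0 : ℝ)..t, k' t s) t := by
  -- The two roles of `t`, as parameter and as endpoint, are separated; the rule is the chain rule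
  -- for `G` along the diagonal.
  let G : ℝ × ℝ → ℝ := fun q => ∫ s in (0 : ℝ)..q.2, k (q.1, s)
  have hG : ContDiff ℝ 1 G := by
    have e : G = fun q => q.2 * ∫ σ : unitInterval, k (q.1, q.2 * σ) :=
      funext fun q => intervalIntegral_eq_unit _ _
    rw [e]
    exact contDiff_snd.mul (contDiff_parametric_integral volume 1
      (fun q : (ℝ × ℝ) × ℝ => k (q.1.1, q.1.2 * q.2)) (hk.comp (by fun_prop)) unitIncl)
  have hGd := (hG.differentiable (by simp) (t, t)).hasFDerivAt
  have h1 : fderiv ℝ G (t, t) (1, 0) = ∫ s in (0 : ℝ)..t, k' t s := by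
    have a1 : HasDerivAt (fun a : ℝ => (a, t)) (1, 0) t :=
      (hasDerivAt_id t).prodMk (hasDerivAt_const t t)
    have a2 : HasDerivAt (fun a : ℝ => G (a, t)) _ t :=
      hGd.comp_hasDerivAt (f := fun a : ℝ => (a, t)) t a1
    have a3 := (hasDerivAt_parametric_integral (volume : Measure unitInterval)
      (fun q : ℝ × ℝ => k (q.1, t * q.2)) (hk.comp (by fun_prop)) unitIncl t).const_mul t
    refine a2.unique (a3.congr_deriv ?_ |>.congr_of_eventuallyEq
      (Eventually.of_forall fun a => intervalIntegral_eq_unit _ _))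
    rw [intervalIntegral_eq_unit]
    congr 1
    exact integral_congr_ae (Eventually.of_forall fun σ => (hd t (t * σ)).deriv)
  have h2 : fderiv ℝ G (t, t) (0, 1) = k (t, t) := by
    have a1 : HasDerivAt (fun b : ℝ => (t, b)) (0, 1) t :=
      (hasDerivAt_const t t).prodMk (hasDerivAt_id t)
    have a2 : HasDerivAt (fun b : ℝ => G (t, b)) _ t :=
      hGd.comp_hasDerivAt (f := fun b : ℝ => (t, b)) t a1
    have c : Continuous fun s => k (t, s) := hk.continuous.comp (by fun_prop)
    exact a2.unique (intervalIntegral.integral_hasDerivAt_right (c.intervalIntegrable _ _)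
      c.stronglyMeasurable.stronglyMeasurableAtFilter c.continuousAt)
  have h3 : HasDerivAt (fun t : ℝ => (t, t)) (1, 1) t := (hasDerivAt_id t).prodMk (hasDerivAt_id t)
  refine (hGd.comp_hasDerivAt (f := fun t : ℝ => (t, t)) t h3).congr_deriv ?_
  have e : ((1, 1) : ℝ × ℝ) = (0, 1) + (1, 0) := by simp
  rw [e, map_add, h1, h2]

/-- The Duhamel integral of a source term. -/
def duhamelIntegral (W : E3 × ℝ → ℝ) (x : E3) (t : ℝ) : ℝ :=
  1 / (4 * Real.pi) * ∫ s in (0 : ℝ)..t,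
    (t - s) * sphereIntegral (fun η => W (x + (t - s) • η, s))

lemma duhamelIntegral_eq (W : E3 × ℝ → ℝ) (x : E3) (t : ℝ) :
    duhamelIntegral W x t = ∫ s in (0 : ℝ)..t, kirchhoff (fun y => W (y, s)) x (t - s) := by
  rw [duhamelIntegral, ← intervalIntegral.integral_const_mul]
  refine intervalIntegral.integral_congr fun s _ => ?_
  simp only [kirchhoff]
  ring

/-- The boundary term of the Leibniz rule is `kirchhoff` at radius zero, which vanishes. -/
lemma hasDerivAt_duhamelIntegral {W : E3 × ℝ → ℝ} (hW : ContDiff ℝ 1 W) (x : E3) (t : ℝ) :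
    HasDerivAt (duhamelIntegral W x)
      (∫ s in (0 : ℝ)..t, kirchhoffDeriv (fun y => W (y, s)) x (t - s)) t := by
  have h := hasDerivAt_integral_moving
    (k := fun q => kirchhoff (fun y => W (y, q.2)) x (q.1 - q.2))
    (k' := fun a s => kirchhoffDeriv (fun y => W (y, s)) x (a - s))
    ((contDiff_kirchhoff_family 1 hW).comp
      (by fun_prop : ContDiff ℝ 1 fun q : ℝ × ℝ => (x, q.1 - q.2, q.2)))
    (fun a s => (hasDerivAt_kirchhoff (h := fun y => W (y, s))
      (hW.comp (by fun_prop)) x (a - s)).comp_sub_const a s) t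
  rw [funext (duhamelIntegral_eq W x)]
  refine h.congr_deriv ?_
  simp [kirchhoff_zero]

/-- At the second differentiation the boundary term is `kirchhoffDeriv` at radius zero, which is the
source itself; this is how the inhomogeneity reappears. -/
lemma hasDerivAt_duhamelIntegral_deriv {W : E3 × ℝ → ℝ} (hW : ContDiff ℝ 2 W) (x : E3) (t : ℝ) :
    HasDerivAt (fun t => ∫ s in (0 : ℝ)..t, kirchhoffDeriv (fun y => W (y, s)) x (t - s))
      (W (x, t) + ∫ s in (0 : ℝ)..t,
        kirchhoff (Laplacian.laplacian fun y => W (y, s)) x (t - s)) t := by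
  have h := hasDerivAt_integral_moving
    (k := fun q => kirchhoffDeriv (fun y => W (y, q.2)) x (q.1 - q.2))
    (k' := fun a s => kirchhoff (Laplacian.laplacian fun y => W (y, s)) x (a - s))
    ((contDiff_kirchhoffDeriv_family 1 hW).comp
      (by fun_prop : ContDiff ℝ 1 fun q : ℝ × ℝ => (x, q.1 - q.2, q.2)))
    (fun a s => (hasDerivAt_kirchhoffDeriv (h := fun y => W (y, s))
      (hW.comp (by fun_prop)) x (a - s)).comp_sub_const a s) t
  refine h.congr_deriv ?_
  simp [kirchhoffDeriv_zero]

lemma duhamelIntegral_eq_unit (W : E3 × ℝ → ℝ) (x : E3) (t : ℝ) :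
    duhamelIntegral W x t
      = t * ∫ σ : unitInterval, kirchhoff (fun y => W (y, t * σ)) x (t - t * σ) := by
  rw [duhamelIntegral_eq, intervalIntegral_eq_unit]

lemma contDiff_duhamelIntegral_unit {W : E3 × ℝ → ℝ} (hW : ContDiff ℝ 2 W) (t : ℝ) :
    ContDiff ℝ 2 (fun q : E3 × ℝ => kirchhoff (fun y => W (y, t * q.2)) q.1 (t - t * q.2)) :=
  (contDiff_kirchhoff_family 2 hW).comp
    (by fun_prop : ContDiff ℝ 2 fun q : E3 × ℝ => (q.1, t - t * q.2, t * q.2))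

lemma contDiff_duhamelIntegral_slice {W : E3 × ℝ → ℝ} (hW : ContDiff ℝ 2 W) (t : ℝ) :
    ContDiff ℝ 2 (fun y => duhamelIntegral W y t) := by
  simp only [duhamelIntegral_eq_unit]
  exact contDiff_const.mul (contDiff_parametric_integral volume 2 _
    (contDiff_duhamelIntegral_unit hW t) unitIncl)

lemma laplacian_duhamelIntegral {W : E3 × ℝ → ℝ} (hW : ContDiff ℝ 2 W) (x : E3) (t : ℝ) :
    Laplacian.laplacian (fun y => duhamelIntegral W y t) x
      = ∫ s in (0 : ℝ)..t, kirchhoff (Laplacian.laplacian fun y => W (y, s)) x (t - s) := by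
  have hΨ := contDiff_duhamelIntegral_unit hW t
  have h1 : Laplacian.laplacian
        (fun y => ∫ σ : unitInterval, kirchhoff (fun y => W (y, t * σ)) y (t - t * σ)) x
      = ∫ σ : unitInterval, Laplacian.laplacian
        (fun y => kirchhoff (fun y => W (y, t * σ)) y (t - t * σ)) x :=
    laplacian_parametric_integral (volume : Measure unitInterval) _ hΨ unitIncl x
  have h2 : ContDiff ℝ 2 (fun y : E3 =>
      ∫ σ : unitInterval, kirchhoff (fun y => W (y, t * σ)) y (t - t * σ)) :=
    contDiff_parametric_integral volume 2 _ hΨ unitIncl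
  have h3 : ∀ σ : ℝ, ContDiff ℝ 2 fun y => W (y, σ) := fun σ => hW.comp (by fun_prop)
  simp only [duhamelIntegral_eq_unit]
  rw [laplacian_const_mul _ h2.contDiffAt, intervalIntegral_eq_unit, h1]
  congr 1
  refine integral_congr_ae (Eventually.of_forall fun σ => ?_)
  exact laplacian_kirchhoff (h3 _) x _

end Duhamel

/-! ### Extension of `C²` functions across the boundary `t = 0` by reflections. -/

section Extension

/-- Gluing two Taylor series along the boundary of the half space. -/
lemma hasFTaylorSeriesUpTo_glue {n : ℕ} {u v : E3 × ℝ → ℝ}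
    {p q : E3 × ℝ → FormalMultilinearSeries ℝ (E3 × ℝ) ℝ}
    (hu : HasFTaylorSeriesUpToOn n u p {z | 0 ≤ z.2})
    (hv : HasFTaylorSeriesUpToOn n v q {z | z.2 ≤ 0})
    (hpq : ∀ m : ℕ, m ≤ n → ∀ z : E3 × ℝ, z.2 = 0 → p z m = q z m) :
    HasFTaylorSeriesUpTo n (fun z : E3 × ℝ => if 0 ≤ z.2 then u z else v z)
      (fun z => if 0 ≤ z.2 then p z else q z) := by
  have hr2 : ∀ m : ℕ, m ≤ n → ∀ z : E3 × ℝ, z.2 ≤ 0 →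
      (if 0 ≤ z.2 then p z else q z) m = q z m := fun m hm z hz => by
    split_ifs with h
    · exact hpq m hm z (le_antisymm hz h)
    · rfl
  have hr1 : ∀ m : ℕ, ∀ z : E3 × ℝ, 0 ≤ z.2 →
      (if 0 ≤ z.2 then p z else q z) m = p z m := fun m z hz => by rw [if_pos hz]
  have c1 : IsClosed {z : E3 × ℝ | 0 ≤ z.2} := isClosed_le continuous_const continuous_snd
  have c2 : IsClosed {z : E3 × ℝ | z.2 ≤ 0} := isClosed_le continuous_snd continuous_const
  have hcov : {z : E3 × ℝ | 0 ≤ z.2} ∪ {z | z.2 ≤ 0} = univ := by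
    ext z
    simpa using le_total 0 z.2
  rw [← hasFTaylorSeriesUpToOn_univ_iff]
  refine ⟨fun z _ => ?_, fun m hm z _ => ?_, fun m hm => ?_⟩
  · split_ifs with h
    · exact hu.zero_eq z h
    · exact hv.zero_eq z (not_le.1 h).le
  · have hm' : m < n := by exact_mod_cast hm
    have key : HasFDerivWithinAt (fun z : E3 × ℝ => (if 0 ≤ z.2 then p z else q z) m)
        ((if 0 ≤ z.2 then p z else q z) (m + 1)).curryLeft
        ({z : E3 × ℝ | 0 ≤ z.2} ∪ {z | z.2 ≤ 0}) z := by
      refine HasFDerivWithinAt.union ?_ ?_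
      · by_cases hz : 0 ≤ z.2
        · rw [hr1 (m + 1) z hz]
          exact (hu.fderivWithin m (by exact_mod_cast hm') z hz).congr
            (fun y hy => hr1 m y hy) (hr1 m z hz)
        · exact HasFDerivWithinAt.of_notMem_closure (by rwa [c1.closure_eq])
      · by_cases hz : z.2 ≤ 0
        · rw [hr2 (m + 1) hm' z hz]
          exact (hv.fderivWithin m (by exact_mod_cast hm') z hz).congr
            (fun y hy => hr2 m hm'.le y hy) (hr2 m hm'.le z hz)
        · exact HasFDerivWithinAt.of_notMem_closure (by rwa [c2.closure_eq])
    rwa [hcov] at key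
  · have hm' : m ≤ n := by exact_mod_cast hm
    rw [← hcov]
    refine ContinuousOn.union_of_isClosed ?_ ?_ c1 c2
    · exact (hu.cont m hm).congr fun y hy => hr1 m y hy
    · exact (hv.cont m hm).congr fun y hy => hr2 m hm' y hy

/-- The reflection `(x, t) ↦ (x, -c t)`. -/
def timeReflection (c : ℝ) : E3 × ℝ →L[ℝ] E3 × ℝ :=
  (ContinuousLinearMap.fst ℝ E3 ℝ).prod (-c • ContinuousLinearMap.snd ℝ E3 ℝ)

@[simp] lemma timeReflection_apply (c : ℝ) (z : E3 × ℝ) :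
    timeReflection c z = (z.1, -(c * z.2)) := by simp [timeReflection]

lemma uniqueDiffOn_halfSpace : UniqueDiffOn ℝ halfSpace :=
  uniqueDiffOn_univ.prod (uniqueDiffOn_Ici 0)

lemma halfSpace_eq : halfSpace = {z : E3 × ℝ | 0 ≤ z.2} := by
  ext z
  simp [halfSpace]

/-- A multilinear form of order at most two is recovered from the combination of reflections with
coefficients `6, -8, 3`. -/
lemma reflection_combination {m : ℕ} (hm : m ≤ 2) (A : (E3 × ℝ) [×m]→L[ℝ] ℝ) :
    (6 : ℝ) • A.compContinuousLinearMap (fun _ => timeReflection 1)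
      + ((-8 : ℝ) • A.compContinuousLinearMap (fun _ => timeReflection 2)
      + (3 : ℝ) • A.compContinuousLinearMap (fun _ => timeReflection 3)) = A := by
  -- The coefficients solve `6 (-1)^j - 8 (-2)^j + 3 (-3)^j = 1` for `j = 0, 1, 2`, where `j` counts
  -- the time components among the arguments.
  have hdec : ∀ c (z : E3 × ℝ), timeReflection c z = (z.1, 0) + (-c) • (0, z.2) := fun c z => by
    simp
  have hid : ∀ z : E3 × ℝ, z = (z.1, 0) + (0, z.2) := fun z => by simp
  ext v
  simp only [add_apply, smul_apply, ContinuousMultilinearMap.compContinuousLinearMap_apply,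
    smul_eq_mul]
  interval_cases m
  · have h : ∀ w : Fin 0 → E3 × ℝ, A w = A v := fun w => congrArg A (Subsingleton.elim _ _)
    rw [h (fun i => timeReflection 1 (v i)), h (fun i => timeReflection 2 (v i)),
      h (fun i => timeReflection 3 (v i))]
    ring
  · let B : (E3 × ℝ) →L[ℝ] ℝ := (continuousMultilinearCurryFin1 ℝ (E3 × ℝ) ℝ) A
    have h : ∀ w : Fin 1 → E3 × ℝ, A w = B (w 0) := fun w => by
      simp only [B, continuousMultilinearCurryFin1_apply]
      congr 1
      ext i : 1
      fin_cases i
      rfl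
    rw [h, h, h, h]
    simp only [hdec, map_add, map_smul, smul_eq_mul]
    conv_rhs => rw [hid (v 0), map_add]
    ring
  · let B : (E3 × ℝ) →L[ℝ] (E3 × ℝ) →L[ℝ] ℝ :=
      (continuousMultilinearCurryFin1 ℝ (E3 × ℝ) ℝ).toContinuousLinearEquiv.toContinuousLinearMap
        ∘L A.curryLeft
    have h : ∀ w : Fin 2 → E3 × ℝ, A w = B (w 0) (w 1) := fun w => by
      simp [B]
      congr 1
      ext i : 1
      fin_cases i <;> rfl
    rw [h, h, h, h]
    simp only [hdec, map_add, map_smul, smul_eq_mul, add_apply, smul_apply]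
    conv_rhs => rw [hid (v 0), hid (v 1)]
    simp only [map_add, add_apply]
    ring

/-- A function of class `C²` up to the boundary of the half space extends to a `C²` function. -/
theorem exists_contDiff_extension {u : E3 × ℝ → ℝ} (hu : ContDiffOn ℝ 2 u halfSpace) :
    ∃ U : E3 × ℝ → ℝ, ContDiff ℝ 2 U ∧ EqOn U u halfSpace := by
  have hp := hu.ftaylorSeriesWithin uniqueDiffOn_halfSpace
  set p := ftaylorSeriesWithin ℝ u halfSpace with hpdef
  have hr : ∀ c : ℝ, 0 ≤ c → HasFTaylorSeriesUpToOn 2 (u ∘ timeReflection c)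
      (fun z k => (p (timeReflection c z) k).compContinuousLinearMap fun _ => timeReflection c)
      {z : E3 × ℝ | z.2 ≤ 0} := fun c hc => by
    refine (hp.compContinuousLinearMap (timeReflection c)).mono fun z hz => ?_
    have hz' : z.2 ≤ 0 := hz
    simp [halfSpace]
    nlinarith
  have hsm : ∀ c a : ℝ, 0 ≤ c → HasFTaylorSeriesUpToOn 2 (fun z => a * u (timeReflection c z))
      (fun z k => a • (p (timeReflection c z) k).compContinuousLinearMap fun _ => timeReflection c)
      {z : E3 × ℝ | z.2 ≤ 0} := fun c a hc => by
    refine ((hr c hc).continuousLinearMap_comp (a • ContinuousLinearMap.id ℝ ℝ))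
  have hv := (hsm 1 6 (by norm_num)).add ((hsm 2 (-8) (by norm_num)).add (hsm 3 3 (by norm_num)))
  have hglue := hasFTaylorSeriesUpTo_glue (n := 2) (halfSpace_eq ▸ hp) hv (fun m hm z hz => ?_)
  · refine ⟨_, hglue.contDiff, fun z hz => ?_⟩
    rw [halfSpace_eq] at hz
    exact if_pos hz
  · have hz' : ∀ c, timeReflection c z = z := fun c => by
      rw [timeReflection_apply, hz]
      ext <;> simp [hz]
    refine (reflection_combination hm (p z m)).symm.trans ?_
    change _ = (6 : ℝ) • (p (timeReflection 1 z) m).compContinuousLinearMap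
        (fun _ => timeReflection 1)
      + ((-8 : ℝ) • (p (timeReflection 2 z) m).compContinuousLinearMap (fun _ => timeReflection 2)
      + (3 : ℝ) • (p (timeReflection 3 z) m).compContinuousLinearMap (fun _ => timeReflection 3))
    rw [hz', hz', hz']

end Extension

/-! ### Regularity of `|x|^p`, and the time weight extended smoothly to negative times. -/

section Nonlinearity

/-- Away from zero this is the power rule on each side. At zero `|h|^q h = o(h)` since `q > 0`. -/
lemma hasDerivAt_abs_rpow_mul_self {q : ℝ} (hq : 0 < q) (x : ℝ) :
    HasDerivAt (fun x : ℝ => |x| ^ q * x) ((q + 1) * |x| ^ q) x := by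
  rcases lt_trichotomy x 0 with hx | rfl | hx
  · have h1 : HasDerivAt (fun x : ℝ => -((-x) ^ (q + 1))) ((q + 1) * |x| ^ q) x := by
      have h2 := (((hasDerivAt_id x).neg).rpow_const (p := q + 1) (Or.inl (by simpa using hx.ne))).neg
      refine h2.congr_deriv ?_
      rw [abs_of_neg hx]
      simp
      ring
    refine h1.congr_of_eventuallyEq ?_
    filter_upwards [Iio_mem_nhds hx] with y hy
    have hy' : 0 < -y := by simpa using hy
    rw [abs_of_neg hy, Real.rpow_add_one hy'.ne']
    ring
  · rw [abs_zero, Real.zero_rpow hq.ne', mul_zero, hasDerivAt_iff_isLittleO_nhds_zero]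
    simp only [zero_add, mul_zero, sub_zero, smul_eq_mul]
    have h1 : Tendsto (fun h : ℝ => |h| ^ q) (𝓝 0) (𝓝 0) := by
      have : Continuous fun h : ℝ => |h| ^ q := continuous_abs.rpow_const fun _ => Or.inr hq.le
      simpa [Real.zero_rpow hq.ne'] using this.tendsto 0
    have := (Asymptotics.isLittleO_one_iff ℝ).2 h1 |>.mul_isBigO
      (Asymptotics.isBigO_refl (fun h : ℝ => h) (𝓝 0))
    simpa using this
  · have h1 : HasDerivAt (fun x : ℝ => x ^ (q + 1)) ((q + 1) * |x| ^ q) x := by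
      refine ((hasDerivAt_id x).rpow_const (p := q + 1) (Or.inl hx.ne')).congr_deriv ?_
      rw [abs_of_pos hx]
      simp
    refine h1.congr_of_eventuallyEq ?_
    filter_upwards [Ioi_mem_nhds hx] with y hy
    rw [abs_of_pos hy, Real.rpow_add_one (ne_of_gt hy)]

lemma contDiff_two_abs_rpow {p : ℝ} (hp : 2 ≤ p) : ContDiff ℝ 2 (fun x : ℝ => |x| ^ p) := by
  rw [show (2 : WithTop ℕ∞) = 1 + 1 by norm_num, contDiff_succ_iff_deriv]
  have hd : ∀ x, HasDerivAt (fun x : ℝ => |x| ^ p) (p * |x| ^ (p - 2) * x) x :=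
    fun x => hasDerivAt_abs_rpow x (by linarith)
  refine ⟨fun x => (hd x).differentiableAt, by simp, ?_⟩
  rw [funext fun x => (hd x).deriv]
  -- For `p = 2` the derivative is linear; this case is separate because the derivative rule for
  -- `|x|^q x` needs `q = p - 2 > 0`.
  rcases hp.eq_or_lt with rfl | hp
  · simp
    fun_prop
  · simp only [mul_assoc]
    refine contDiff_const.mul ?_
    rw [contDiff_one_iff_deriv]
    have hd' := hasDerivAt_abs_rpow_mul_self (q := p - 2) (by linarith)
    refine ⟨fun x => (hd' x).differentiableAt, ?_⟩
    rw [funext fun x => (hd' x).deriv]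
    exact (continuous_abs.rpow_const fun _ => Or.inr (by linarith)).const_mul _

lemma contDiff_abs_rpow {p : ℝ} (hp : 1 < p) :
    ContDiff ℝ (regularity p) (fun x : ℝ => |x| ^ p) := by
  unfold regularity
  split_ifs with h
  · exact_mod_cast contDiff_norm_rpow (E := ℝ) hp
  · exact_mod_cast contDiff_two_abs_rpow (not_lt.1 h)

/-- A smooth function on `ℝ`, bounded below by `1/2`, equal to `1 + s` for `s ≥ 0`. -/
def shiftedTime (s : ℝ) : ℝ := 1 + s * Real.smoothTransition (1 + 2 * s)

lemma shiftedTime_of_nonneg {s : ℝ} (hs : 0 ≤ s) : shiftedTime s = 1 + s := by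
  rw [shiftedTime, Real.smoothTransition.one_of_one_le (by linarith), mul_one]

lemma shiftedTime_pos (s : ℝ) : 0 < shiftedTime s := by
  unfold shiftedTime
  rcases le_total (1 + 2 * s) 0 with h | h
  · rw [Real.smoothTransition.zero_of_nonpos h]
    norm_num
  · nlinarith [Real.smoothTransition.nonneg (1 + 2 * s), Real.smoothTransition.le_one (1 + 2 * s)]

lemma contDiff_shiftedTime {n : ℕ} : ContDiff ℝ n shiftedTime := by
  unfold shiftedTime
  exact contDiff_const.add (contDiff_id.mul (Real.smoothTransition.contDiff.comp (by fun_prop)))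

/-- A smooth extension of the weight `(1 + s)^{-(p-1)}`. -/
def decayWeight (p s : ℝ) : ℝ := shiftedTime s ^ (-(p - 1))

lemma decayWeight_of_nonneg (p : ℝ) {s : ℝ} (hs : 0 ≤ s) :
    decayWeight p s = (1 + s) ^ (-(p - 1)) := by rw [decayWeight, shiftedTime_of_nonneg hs]

lemma contDiff_decayWeight (p : ℝ) {n : ℕ} : ContDiff ℝ n (decayWeight p) :=
  contDiff_shiftedTime.rpow_const_of_ne fun s => (shiftedTime_pos s).ne'

/-- The source term of the integral equation. -/
def source (p : ℝ) (u : E3 × ℝ → ℝ) (z : E3 × ℝ) : ℝ := decayWeight p z.2 * |u z| ^ p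

/-- Only times `0 ≤ s ≤ t` enter the integral, so neither the extension of `u` nor that of the
weight matters. -/
lemma duhamel_eq_duhamelIntegral {p : ℝ} {u U : E3 × ℝ → ℝ} (h : EqOn U u halfSpace) {x : E3}
    {t : ℝ} (ht : 0 ≤ t) :
    duhamel p (fun z => |u z| ^ p) (x, t) = duhamelIntegral (source p U) x t := by
  unfold duhamel duhamelIntegral
  congr 1
  refine intervalIntegral.integral_congr fun s hs => ?_
  rw [uIcc_of_le ht] at hs
  simp only [source, decayWeight_of_nonneg p hs.1]
  congr 2
  funext η
  rw [h (by simpa [halfSpace] using hs.1)]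

end Nonlinearity

/-! ### Equivalence of the integral equation and the damped wave equation. -/

section Equivalence

variable {u U : E3 × ℝ → ℝ}

lemma hasDerivAt_time (hU : ContDiff ℝ 1 U) (x : E3) (t : ℝ) :
    HasDerivAt (fun s => U (x, s)) (fderiv ℝ U (x, t) (0, 1)) t :=
  ((hU.differentiable (by simp)) (x, t)).hasFDerivAt.comp_hasDerivAt (f := fun s => (x, s)) t
    ((hasDerivAt_const t x).prodMk (hasDerivAt_id t))

lemma hasDerivAt_time_deriv (hU : ContDiff ℝ 2 U) (x : E3) (t : ℝ) :
    HasDerivAt (fun s => fderiv ℝ U (x, s) (0, 1)) (fderiv ℝ (fderiv ℝ U) (x, t) (0, 1) (0, 1)) t := by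
  have h1 : ContDiff ℝ 1 (fderiv ℝ U) := hU.fderiv_right (by norm_num)
  have h2 := ((h1.differentiable (by simp)) (x, t)).hasFDerivAt.comp_hasDerivAt
    (f := fun s => (x, s)) t ((hasDerivAt_const t x).prodMk (hasDerivAt_id t))
  refine (h2.clm_apply (hasDerivAt_const t ((0, 1) : E3 × ℝ))).congr_deriv ?_
  simp

lemma mem_halfSpace {x : E3} {t : ℝ} (ht : 0 ≤ t) : (x, t) ∈ halfSpace := by
  simpa [halfSpace] using ht

lemma hasDerivWithinAt_time (hU : ContDiff ℝ 1 U) (h : EqOn U u halfSpace) (x : E3) {t : ℝ}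
    (ht : 0 ≤ t) :
    HasDerivWithinAt (fun s => u (x, s)) (fderiv ℝ U (x, t) (0, 1)) (Ici 0) t :=
  (hasDerivAt_time hU x t).hasDerivWithinAt.congr (fun _ hs => (h (mem_halfSpace hs)).symm)
    (h (mem_halfSpace ht)).symm

lemma spaceLaplacian_congr (h : EqOn U u halfSpace) (x : E3) {t : ℝ} (ht : 0 ≤ t) :
    spaceLaplacian u x t = spaceLaplacian U x t := by
  have e : (fun y => u (y, t)) = fun y => U (y, t) :=
    funext fun y => (h (mem_halfSpace ht)).symm
  rw [spaceLaplacian, spaceLaplacian, e]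

/-- The damped wave equation for `u / (1 + t)` in terms of an extension of `u`. -/
lemma isDampedWave_iff {p : ℝ} (hU : ContDiff ℝ 2 U) (h : EqOn U u halfSpace) (φ ψ : E3 → ℝ) :
    IsDampedWave 2 1 p φ ψ (fun z => u z / (1 + z.2)) ↔
      (∀ x t, 0 ≤ t → waveOp U (x, t) = source p U (x, t)) ∧ (∀ x, U (x, 0) = φ x) ∧
        ∀ x, fderiv ℝ U (x, 0) (0, 1) = φ x + ψ x := by
  have hU1 : ContDiff ℝ 1 U := hU.of_le (by norm_num)
  set v : E3 × ℝ → ℝ := fun z => u z / (1 + z.2) with hv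
  have hreg : ContDiffOn ℝ 2 v halfSpace := by
    have h1 : ContDiffOn ℝ 2 u halfSpace := hU.contDiffOn.congr fun z hz => (h hz).symm
    refine h1.div (by fun_prop) fun z hz => ?_
    have : 0 ≤ z.2 := by simpa [halfSpace] using hz
    positivity
  have hd1 : ∀ x s, 0 ≤ s → HasDerivWithinAt (fun s => v (x, s))
      (fderiv ℝ U (x, s) (0, 1) / (1 + s) - U (x, s) / (1 + s) ^ 2) (Ici 0) s := fun x s hs => by
    have hne : 1 + s ≠ 0 := by positivity
    have hden : HasDerivWithinAt (fun s : ℝ => 1 + s) 1 (Ici 0) s :=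
      ((hasDerivAt_id s).const_add 1).hasDerivWithinAt
    refine ((hasDerivWithinAt_time hU1 h x hs).div hden hne).congr_deriv ?_
    rw [h (mem_halfSpace hs)]
    field_simp
  have ht1 : ∀ x t, 0 ≤ t → timeDeriv v x t
      = fderiv ℝ U (x, t) (0, 1) / (1 + t) - U (x, t) / (1 + t) ^ 2 :=
    fun x t ht => timeDeriv_eq ht (hd1 x t ht)
  have ht2 : ∀ x t, 0 ≤ t → timeDeriv2 v x t
      = fderiv ℝ (fderiv ℝ U) (x, t) (0, 1) (0, 1) / (1 + t)
        - 2 * fderiv ℝ U (x, t) (0, 1) / (1 + t) ^ 2 + 2 * U (x, t) / (1 + t) ^ 3 :=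
    fun x t ht => by
      refine timeDeriv2_eq ht (hd1 x) (HasDerivAt.hasDerivWithinAt ?_)
      have hne : 1 + t ≠ 0 := by positivity
      have hden : HasDerivAt (fun s : ℝ => 1 + s) 1 t := (hasDerivAt_id t).const_add 1
      have h1 := ((hasDerivAt_time_deriv hU x t).div hden hne).sub
        ((hasDerivAt_time hU1 x t).div (hden.pow 2) (pow_ne_zero 2 hne))
      refine h1.congr_deriv ?_
      simp
      field_simp
      ring
  have hlap : ∀ x t, 0 ≤ t → spaceLaplacian v x t
      = (∑ i, fderiv ℝ (fderiv ℝ U) (x, t) (basisVec i, 0) (basisVec i, 0)) / (1 + t) :=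
    fun x t ht => by
      have e : (fun y => v (y, t)) = fun y => (1 + t)⁻¹ * U (y, t) := by
        funext y
        simp only [hv]
        rw [h (mem_halfSpace ht)]
        ring
      unfold spaceLaplacian
      have hs : ContDiff ℝ 2 fun y : E3 => U (y, t) := hU.comp (by fun_prop)
      rw [e, laplacian_const_mul _ hs.contDiffAt, laplacian_slice hU]
      ring
  have hv0 : ∀ x, v (x, 0) = U (x, 0) := fun x => by
    simp [hv, h (mem_halfSpace (x := x) le_rfl)]
  -- The first-order term created by `u = (1 + t) v` is exactly the damping, so both sides are those
  -- of the undamped equation divided by `1 + t`: the right side is `|u|^p (1 + t)^{-p}`.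
  have heq : ∀ x t, 0 ≤ t → ((timeDeriv2 v x t - spaceLaplacian v x t
      + 2 / (1 + t) ^ (1 : ℝ) * timeDeriv v x t = |v (x, t)| ^ p) ↔
      waveOp U (x, t) = source p U (x, t)) := fun x t ht => by
    have hpos : 0 < 1 + t := by positivity
    have e1 : timeDeriv2 v x t - spaceLaplacian v x t + 2 / (1 + t) ^ (1 : ℝ) * timeDeriv v x t
        = waveOp U (x, t) / (1 + t) := by
      rw [ht1 x t ht, ht2 x t ht, hlap x t ht, waveOp, Real.rpow_one]
      field_simp
      ring
    have e2 : |v (x, t)| ^ p = source p U (x, t) / (1 + t) := by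
      simp only [hv, source]
      rw [← h (mem_halfSpace ht), abs_div, abs_of_pos hpos, Real.div_rpow (abs_nonneg _) hpos.le,
        decayWeight_of_nonneg p ht, show -(p - 1) = 1 - p by ring, Real.rpow_sub hpos,
        Real.rpow_one]
      field_simp
    rw [e1, e2, div_left_inj' hpos.ne']
  unfold IsDampedWave
  constructor
  · rintro ⟨_, h1, h2, h3⟩
    refine ⟨fun x t ht => (heq x t ht).1 (h1 x t ht), fun x => (hv0 x).symm.trans (h2 x),
      fun x => ?_⟩
    have := h3 x
    rw [ht1 x 0 le_rfl] at this
    have h4 := h2 x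
    rw [hv0] at h4
    simp only [add_zero, div_one, one_pow] at this
    linarith
  · rintro ⟨h1, h2, h3⟩
    refine ⟨hreg, fun x t ht => (heq x t ht).2 (h1 x t ht), fun x => (hv0 x).trans (h2 x),
      fun x => ?_⟩
    rw [ht1 x 0 le_rfl, h3, h2]
    simp

lemma contDiff_source {p : ℝ} (hp : 2 ≤ p) (hU : ContDiff ℝ 2 U) : ContDiff ℝ 2 (source p U) :=
  ((contDiff_decayWeight p (n := 2)).comp contDiff_snd).mul ((contDiff_two_abs_rpow hp).comp hU)

lemma kirchhoff_congr {h k : E3 → ℝ} (e : ∀ y, h y = k y) (x : E3) (t : ℝ) :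
    kirchhoff h x t = kirchhoff k x t := by rw [funext e]

/-- From left to right, the free wave plus Duhamel's integral is differentiated twice. From right to
left, Kirchhoff's representation is applied to a `C²` extension of `u`, whose data and wave operator
on `t ≥ 0` are prescribed. -/
theorem solvesIntegralEq_iff {p ε : ℝ} {f g : E3 → ℝ} (hf : ContDiff ℝ 3 f) (hg : ContDiff ℝ 2 g)
    (hp : 2 ≤ p) (hu : ContDiffOn ℝ 2 u halfSpace) :
    SolvesIntegralEq p ε f g u ↔
      IsDampedWave 2 1 p (fun x => ε * f x) (fun x => ε * g x) (fun z => u z / (1 + z.2)) := by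
  obtain ⟨U, hU, h⟩ := exists_contDiff_extension hu
  have hU1 : ContDiff ℝ 1 U := hU.of_le (by norm_num)
  have hW := contDiff_source hp hU
  rw [isDampedWave_iff hU h]
  constructor
  · intro hs
    set Z : E3 × ℝ → ℝ := fun z => freeWave ε f g z + duhamelIntegral (source p U) z.1 z.2 with hZ
    have hZU : ∀ x t, 0 ≤ t → u (x, t) = Z (x, t) := fun x t ht => by
      rw [hs x t ht, duhamel_eq_duhamelIntegral h ht]
    have hd1 : ∀ x s, 0 ≤ s → HasDerivWithinAt (fun s => u (x, s)) _ (Ici 0) s :=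
      fun x s hs => ((hasDerivAt_freeWave hf hg ε x s).add
        (hasDerivAt_duhamelIntegral (hW.of_le (by norm_num)) x s)).hasDerivWithinAt.congr
          (fun s hs => hZU x s hs) (hZU x s hs)
    have hd2 := fun x t => ((hasDerivAt_freeWave_deriv hf hg ε x t).add
        (hasDerivAt_duhamelIntegral_deriv hW x t)).hasDerivWithinAt (s := Ici 0)
    refine ⟨fun x t ht => ?_, fun x => ?_, fun x => ?_⟩
    -- The second time derivative of `u` is computed both from the integral equation and from the
    -- extension. The Laplacian parts cancel and only the source remains.
    · have e1 := timeDeriv2_eq ht (hd1 x) (hd2 x t)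
      have e2 := timeDeriv2_eq ht (fun s hs => hasDerivWithinAt_time hU1 h x hs)
        (hasDerivAt_time_deriv hU x t).hasDerivWithinAt
      have e3 : spaceLaplacian u x t = spaceLaplacian (freeWave ε f g) x t
          + ∫ s in (0 : ℝ)..t,
            kirchhoff (Laplacian.laplacian fun y => source p U (y, s)) x (t - s) := by
        have e4 : (fun y => u (y, t)) = (fun y => freeWave ε f g (y, t))
            + fun y => duhamelIntegral (source p U) y t := funext fun y => hZU y t ht
        have c1 : ContDiff ℝ 2 fun y : E3 => freeWave ε f g (y, t) :=
          (contDiff_freeWave hf hg ε).comp (by fun_prop)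
        unfold spaceLaplacian
        rw [e4, c1.contDiffAt.laplacian_add (contDiff_duhamelIntegral_slice hW t).contDiffAt,
          laplacian_duhamelIntegral hW]
      have e5 := spaceLaplacian_congr h x ht
      rw [waveOp, ← laplacian_slice hU x t, ← e2, e1]
      change _ - spaceLaplacian U x t = _
      rw [← e5, e3]
      ring
    · rw [h (mem_halfSpace le_rfl), hZU x 0 le_rfl]
      simp [hZ, duhamelIntegral, (isLinearWave_freeWave hf hg ε).2.2.1 x]
    · have e1 := timeDeriv_eq le_rfl (hd1 x 0 le_rfl)
      rw [timeDeriv_eq le_rfl (hasDerivWithinAt_time hU1 h x le_rfl)] at e1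
      rw [e1, kirchhoff_zero, kirchhoffDeriv_zero]
      simp
      ring
  · rintro ⟨h1, h2, h3⟩ x t ht
    rw [duhamel_eq_duhamelIntegral h ht, ← h (mem_halfSpace ht), kirchhoff_representation hU x t,
      freeWave_eq (hf.of_le (by norm_num)) g ε]
    have e1 : (fun y => U (y, 0)) = fun y => ε * f y := funext h2
    have e2 : kirchhoffDeriv (fun y => ε * f y) x t = ε * kirchhoffDeriv f x t := by
      have a1 := hasDerivAt_kirchhoff (h := fun y => ε * f y)
        (contDiff_const.mul (hf.of_le (by norm_num))) x t
      have a2 := (hasDerivAt_kirchhoff (hf.of_le (by norm_num)) x t).const_mul ε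
      refine a1.unique (a2.congr_of_eventuallyEq (Eventually.of_forall fun s => ?_))
      simp only [kirchhoff, sphereIntegral_const_mul]
      ring
    have e3 : kirchhoff (fun y => fderiv ℝ U (y, 0) (0, 1)) x t
        = ε * kirchhoff (fun y => f y + g y) x t := by
      rw [kirchhoff_congr (k := fun y => ε * (f y + g y)) (fun y => by rw [h3]; ring)]
      simp only [kirchhoff, sphereIntegral_const_mul]
      ring
    have e4 : (∫ s in (0 : ℝ)..t,
          (t - s) * sphereIntegral (fun η => waveOp U (x + (t - s) • η, s)))
        = ∫ s in (0 : ℝ)..t,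
          (t - s) * sphereIntegral (fun η => source p U (x + (t - s) • η, s)) := by
      refine intervalIntegral.integral_congr fun s hs => ?_
      rw [uIcc_of_le ht] at hs
      simp only [h1 _ s hs.1]
    rw [e1, e2, e3, e4, duhamelIntegral]
    ring

end Equivalence

/-! ### Duhamel's operator on a fixed backward light cone, and Volterra operators. -/

section Cone

/-- The backward light cone with apex `(0, 1)`. -/
def unitCone : Set (E3 × ℝ) := {z | 0 ≤ z.2 ∧ ‖z.1‖ ≤ 1 - z.2}

lemma isCompact_unitCone : IsCompact unitCone := by
  refine ((isCompact_closedBall (0 : E3) 1).prod (isCompact_Icc (a := (0 : ℝ)) (b := 1))).of_isClosed_subset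
    ?_ fun z hz => ?_
  · exact (isClosed_le continuous_const continuous_snd).inter
      (isClosed_le continuous_fst.norm (continuous_const.sub continuous_snd))
  · have h1 := hz.1
    have h2 := hz.2
    have h3 := norm_nonneg z.1
    exact ⟨by rw [mem_closedBall_zero_iff]; linarith, h1, by linarith⟩

instance : CompactSpace unitCone := isCompact_iff_compactSpace.1 isCompact_unitCone

/-- The inclusion of the cone in space-time. -/
def coneIncl : C(unitCone, E3 × ℝ) := ⟨Subtype.val, continuous_subtype_val⟩

@[simp] lemma coneIncl_apply (z : unitCone) : coneIncl z = z.1 := rfl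

lemma unitCone_time_nonneg (z : unitCone) : 0 ≤ z.1.2 := z.2.1

lemma unitCone_time_le_one (z : unitCone) : z.1.2 ≤ 1 := by
  have := z.2.2
  have := norm_nonneg z.1.1
  linarith

/-- The apex of the cone. -/
def coneApex : unitCone := ⟨(0, 1), by simp [unitCone]⟩

/-- The parameter space of the Duhamel integral. -/
abbrev DuhamelParam : Type := unitInterval × Metric.sphere (0 : E3) 1

/-- The measure on the parameter space. -/
abbrev duhamelMeasure : Measure DuhamelParam :=
  (volume : Measure unitInterval).prod sphereMeasure

/-- The points of the backward cone of a point of the unit cone. -/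
def conePoint : C(unitCone × DuhamelParam, unitCone) where
  -- The interval parameter is the fraction of time elapsed backwards from the vertex: at fraction
  -- `ς` the sphere has radius `t ς` and lies at time `t (1 - ς)`.
  toFun q := ⟨(q.1.1.1 + (q.1.1.2 * q.2.1) • (q.2.2 : E3), q.1.1.2 * (1 - q.2.1)), by
    have h1 := q.2.1.2.1
    have h2 := q.2.1.2.2
    have h3 := unitCone_time_nonneg q.1
    refine ⟨mul_nonneg h3 (by linarith), (norm_add_le _ _).trans ?_⟩
    rw [norm_smul, norm_eq_of_mem_sphere, Real.norm_eq_abs, abs_of_nonneg (by positivity)]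
    have := q.1.2.2
    simp only
    linarith⟩
  continuous_toFun := by fun_prop

@[simp] lemma conePoint_time (q : unitCone × DuhamelParam) :
    (conePoint q).1.2 = q.1.1.2 * (1 - q.2.1) := rfl

/-- The integrand of the Duhamel operator on the cone. -/
def coneIntegrand (W : C(unitCone, ℝ)) : C(unitCone × DuhamelParam, ℝ) where
  toFun q := q.2.1 * W (conePoint q)
  continuous_toFun := by fun_prop

lemma integral_one_sub_pow (n : ℕ) :
    ∫ q : DuhamelParam, (1 - (q.1 : ℝ)) ^ n ∂duhamelMeasure = 4 * Real.pi / (n + 1) := by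
  have h := integral_prod_mul (μ := (volume : Measure unitInterval)) (ν := sphereMeasure)
    (fun ς : unitInterval => (1 - (ς : ℝ)) ^ n) (fun _ => (1 : ℝ))
  simp only [mul_one] at h
  rw [h, integral_unitInterval (fun s => (1 - s) ^ n), integral_const, sphereMeasure_real_univ,
    intervalIntegral.integral_comp_sub_left (fun s => s ^ n), integral_pow]
  simp
  ring

/-- Integrating `(1 - ς)^n` gains the factor `1 / (n + 1)`, and the prefactor gains a power of time;
its second power of time is discarded since times on the cone are at most one. Iterated, these gains
produce the factorial. -/
lemma integral_coneIntegrand_le {W : C(unitCone, ℝ)} {M : ℝ} (hM : 0 ≤ M) {n : ℕ}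
    (hW : ∀ z : unitCone, |W z| ≤ M * z.1.2 ^ n) (z : unitCone) :
    |z.1.2 ^ 2 / (4 * Real.pi) * ∫ q, coneIntegrand W (z, q) ∂duhamelMeasure|
      ≤ M * z.1.2 ^ (n + 1) / (n + 1) := by
  have hpi := Real.pi_pos
  have h0 := unitCone_time_nonneg z
  have h1 := unitCone_time_le_one z
  have hint : Integrable (fun q : DuhamelParam => M * z.1.2 ^ n * (1 - (q.1 : ℝ)) ^ n)
      duhamelMeasure :=
    (by fun_prop : Continuous fun q : DuhamelParam => M * z.1.2 ^ n * (1 - (q.1 : ℝ)) ^ n)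
      |>.integrable_of_hasCompactSupport (HasCompactSupport.of_compactSpace _)
  have hle := norm_integral_le_of_norm_le hint (Eventually.of_forall fun q => by
    change ‖(q.1 : ℝ) * W (conePoint (z, q))‖ ≤ _
    have a1 := q.1.2.1
    have a2 := q.1.2.2
    have a3 := hW (conePoint (z, q))
    rw [conePoint_time] at a3
    rw [norm_mul, Real.norm_eq_abs, Real.norm_eq_abs, abs_of_nonneg a1]
    calc (q.1 : ℝ) * |W (conePoint (z, q))| ≤ 1 * |W (conePoint (z, q))| := by gcongr
      _ ≤ M * (z.1.2 * (1 - q.1)) ^ n := by rw [one_mul]; exact a3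
      _ = M * z.1.2 ^ n * (1 - (q.1 : ℝ)) ^ n := by rw [mul_pow]; ring)
  rw [integral_const_mul, integral_one_sub_pow, Real.norm_eq_abs] at hle
  rw [abs_mul, abs_of_nonneg (by positivity)]
  calc z.1.2 ^ 2 / (4 * Real.pi) * |∫ q, coneIntegrand W (z, q) ∂duhamelMeasure|
      ≤ z.1.2 ^ 2 / (4 * Real.pi) * (M * z.1.2 ^ n * (4 * Real.pi / (n + 1))) :=
        mul_le_mul_of_nonneg_left hle (by positivity)
    _ = (M * z.1.2 ^ (n + 1) / (n + 1)) * z.1.2 := by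
        field_simp
        ring
    _ ≤ (M * z.1.2 ^ (n + 1) / (n + 1)) * 1 := by gcongr
    _ = _ := mul_one _

/-- The Duhamel operator on the unit cone. -/
def coneDuhamel : C(unitCone, ℝ) →L[ℝ] C(unitCone, ℝ) :=
  LinearMap.mkContinuous
    { toFun := fun W =>
        { toFun := fun z => z.1.2 ^ 2 / (4 * Real.pi) *
            ∫ q, coneIntegrand W (z, q) ∂duhamelMeasure
          continuous_toFun := by
            have h : Continuous fun z : unitCone =>
                integralCLM duhamelMeasure ((coneIntegrand W).curry z) :=
              (integralCLM duhamelMeasure).continuous.comp (coneIntegrand W).curry.continuous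
            exact (by fun_prop : Continuous fun z : unitCone => z.1.2 ^ 2 / (4 * Real.pi)).mul h }
      map_add' := fun V W => by
        ext z
        have e : (coneIntegrand (V + W)).curry z
            = (coneIntegrand V).curry z + (coneIntegrand W).curry z := by
          ext q
          exact mul_add _ _ _
        have := congrArg (integralCLM duhamelMeasure) e
        rw [map_add] at this
        exact (congrArg (fun a => z.1.2 ^ 2 / (4 * Real.pi) * a) this).trans (mul_add _ _ _)
      map_smul' := fun c W => by
        ext z
        have e : (coneIntegrand (c • W)).curry z = c • (coneIntegrand W).curry z := by
          ext q
          exact mul_left_comm _ _ _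
        have := congrArg (integralCLM duhamelMeasure) e
        rw [map_smul] at this
        exact (congrArg (fun a => z.1.2 ^ 2 / (4 * Real.pi) * a) this).trans
          (mul_left_comm _ _ _) } 1
    (fun W => by
      rw [one_mul]
      refine (ContinuousMap.norm_le _ (norm_nonneg _)).2 fun z => ?_
      have h := integral_coneIntegrand_le (norm_nonneg W) (n := 0)
        (fun z => by simpa using W.norm_coe_le_norm z) z
      have h1 := unitCone_time_le_one z
      rw [zero_add, pow_one, Nat.cast_zero, zero_add, div_one] at h
      exact h.trans (mul_le_of_le_one_right (norm_nonneg _) h1))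

lemma coneDuhamel_apply (W : C(unitCone, ℝ)) (z : unitCone) :
    coneDuhamel W z
      = z.1.2 ^ 2 / (4 * Real.pi) * ∫ q, coneIntegrand W (z, q) ∂duhamelMeasure := rfl

lemma abs_coneDuhamel_le {W : C(unitCone, ℝ)} {M : ℝ} (hM : 0 ≤ M) {n : ℕ}
    (hW : ∀ z : unitCone, |W z| ≤ M * z.1.2 ^ n) (z : unitCone) :
    |coneDuhamel W z| ≤ M * z.1.2 ^ (n + 1) / (n + 1) :=
  integral_coneIntegrand_le hM hW z

/-- Duhamel's integral over the fixed parameter space. -/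
lemma duhamelIntegral_eq_param {w : E3 × ℝ → ℝ} (hw : Continuous w) (x : E3) (t : ℝ) :
    duhamelIntegral w x t = t ^ 2 / (4 * Real.pi) *
      ∫ q : DuhamelParam, (q.1 : ℝ) * w (x + (t * q.1) • (q.2 : E3), t * (1 - q.1))
        ∂duhamelMeasure := by
  have hint : Integrable (fun q : DuhamelParam =>
      (q.1 : ℝ) * w (x + (t * q.1) • (q.2 : E3), t * (1 - q.1))) duhamelMeasure :=
    (by fun_prop : Continuous fun q : DuhamelParam =>
      (q.1 : ℝ) * w (x + (t * q.1) • (q.2 : E3), t * (1 - q.1)))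
      |>.integrable_of_hasCompactSupport (HasCompactSupport.of_compactSpace _)
  rw [integral_prod _ hint, duhamelIntegral]
  have h1 : ∀ ς : unitInterval, ∫ ω : Metric.sphere (0 : E3) 1,
      (ς : ℝ) * w (x + (t * ς) • (ω : E3), t * (1 - ς)) ∂sphereMeasure
      = ς * sphereIntegral (fun η => w (x + (t * ς) • η, t * (1 - ς))) :=
    fun ς => integral_const_mul _ _
  simp only [h1]
  rw [intervalIntegral_eq_unit,
    integral_unitInterval (fun s => (t - t * s) * sphereIntegral fun η =>
      w (x + (t - t * s) • η, t * s)),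
    integral_unitInterval (fun s => s * sphereIntegral fun η => w (x + (t * s) • η, t * (1 - s)))]
  have h2 := intervalIntegral.integral_comp_sub_left (a := 0) (b := 1)
    (fun s => s * sphereIntegral fun η => w (x + (t * s) • η, t * (1 - s))) 1
  rw [sub_self, sub_zero] at h2
  rw [← h2]
  have h3 : ∀ s : ℝ, (t - t * s) * (sphereIntegral fun η => w (x + (t - t * s) • η, t * s))
      = t * ((1 - s) * sphereIntegral fun η => w (x + (t * (1 - s)) • η, t * (1 - (1 - s)))) :=
    fun s => by
      rw [show t * (1 - s) = t - t * s by ring, show t * (1 - (1 - s)) = t * s by ring]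
      ring
  simp only [h3]
  rw [intervalIntegral.integral_const_mul]
  ring

/-- The pull-back of a continuous function to the unit cone, by translation and dilation. -/
def conePullback (w : C(E3 × ℝ, ℝ)) : C(E3 × ℝ, C(unitCone, ℝ)) :=
  ContinuousMap.curry
    ⟨fun q : (E3 × ℝ) × unitCone => w (q.1.1 + q.1.2 • q.2.1.1, q.1.2 * q.2.1.2), by fun_prop⟩

@[simp] lemma conePullback_apply (w : C(E3 × ℝ, ℝ)) (π : E3 × ℝ) (z : unitCone) :
    conePullback w π z = w (π.1 + π.2 • z.1.1, π.2 * z.1.2) := rfl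

/-- Duhamel's integral commutes with translations and, up to the square of the scale, with
dilations. This brings all backward cones into the single Banach space `C(unitCone, ℝ)`, with the
apex as a parameter. -/
lemma coneDuhamel_conePullback (w : C(E3 × ℝ, ℝ)) (π : E3 × ℝ) (z : unitCone) :
    π.2 ^ 2 * coneDuhamel (conePullback w π) z
      = duhamelIntegral w (π.1 + π.2 • z.1.1) (π.2 * z.1.2) := by
  rw [duhamelIntegral_eq_param w.continuous, coneDuhamel_apply]
  have e : ∀ q, coneIntegrand (conePullback w π) (z, q) = (q.1 : ℝ) *
      w (π.1 + π.2 • z.1.1 + (π.2 * z.1.2 * q.1) • (q.2 : E3), π.2 * z.1.2 * (1 - q.1)) :=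
    fun q => by
      change (q.1 : ℝ) * w (π.1 + π.2 • (z.1.1 + (z.1.2 * q.1) • (q.2 : E3)),
        π.2 * (z.1.2 * (1 - q.1))) = _
      rw [smul_add, smul_smul, add_assoc, mul_assoc, mul_assoc]
  simp only [e]
  ring

/-- The Volterra operator with continuous coefficient `b`. -/
def volterraOp (c : ℝ) (b : C(unitCone, ℝ)) : C(unitCone, ℝ) →L[ℝ] C(unitCone, ℝ) :=
  c • coneDuhamel ∘L ContinuousLinearMap.mul ℝ C(unitCone, ℝ) b

lemma abs_volterraOp_pow_le (c : ℝ) (b V : C(unitCone, ℝ)) (n : ℕ) (z : unitCone) :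
    |(volterraOp c b ^ n) V z| ≤ (|c| * ‖b‖) ^ n / n.factorial * ‖V‖ * z.1.2 ^ n := by
  induction n generalizing z with
  | zero => simpa using V.norm_coe_le_norm z
  | succ n ih =>
    have hb : ∀ z : unitCone, |(b * (volterraOp c b ^ n) V) z|
        ≤ ‖b‖ * ((|c| * ‖b‖) ^ n / n.factorial * ‖V‖) * z.1.2 ^ n := fun z => by
      rw [ContinuousMap.mul_apply, abs_mul, mul_assoc]
      exact mul_le_mul (b.norm_coe_le_norm z) (ih z) (abs_nonneg _) (norm_nonneg _)
    have h := abs_coneDuhamel_le (by positivity) hb z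
    rw [pow_succ']
    change |c * coneDuhamel (b * (volterraOp c b ^ n) V) z| ≤ _
    rw [abs_mul]
    refine (mul_le_mul_of_nonneg_left h (abs_nonneg c)).trans (le_of_eq ?_)
    rw [Nat.factorial_succ]
    push_cast
    field_simp
    ring

/-- The factorial bound makes some power `T^n` a strict contraction, whatever the size of the
coefficient. Then `1 - T^n` is invertible, and it is the product of `1 - T` with a geometric sum
commuting with it. -/
lemma isUnit_one_sub_volterraOp (c : ℝ) (b : C(unitCone, ℝ)) : IsUnit (1 - volterraOp c b) := by
  obtain ⟨n, hn⟩ := ((FloorSemiring.tendsto_pow_div_factorial_atTop (|c| * ‖b‖)).eventually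
    (gt_mem_nhds (show (0 : ℝ) < 1 by norm_num))).exists
  set T := volterraOp c b
  have hnorm : ‖T ^ n‖ < 1 := by
    refine lt_of_le_of_lt (ContinuousLinearMap.opNorm_le_bound _ (by positivity) fun V => ?_) hn
    refine (ContinuousMap.norm_le _ (by positivity)).2 fun z => ?_
    refine (abs_volterraOp_pow_le c b V n z).trans ?_
    exact mul_le_of_le_one_right (by positivity)
      (pow_le_one₀ (unitCone_time_nonneg z) (unitCone_time_le_one z))
  have hu : IsUnit (1 - T ^ n) := 
    isUnit_one_sub_of_norm_lt_one (R := C(unitCone, ℝ) →L[ℝ] C(unitCone, ℝ)) hnorm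
  rw [← mul_neg_geom_sum] at hu
  have hcomm : Commute (1 - T) (∑ i ∈ Finset.range n, T ^ i) :=
    Commute.sum_right _ _ _ fun i _ => ((Commute.one_left T).sub_left (Commute.refl T)).pow_right i
  exact (hcomm.isUnit_mul_iff.1 hu).1

/-- Uniqueness for linear Volterra inequalities on the cone. -/
lemma eq_zero_of_abs_le_coneDuhamel {c : ℝ} (hc : 0 ≤ c) {B : ℝ} (hB : 0 ≤ B)
    {D S : C(unitCone, ℝ)} (hS : ∀ z, |S z| ≤ B * |D z|) (hD : ∀ z, D z = c * coneDuhamel S z) :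
    D = 0 := by
  have hn : ∀ (n : ℕ) (z : unitCone),
      |D z| ≤ (c * B) ^ n / n.factorial * ‖D‖ * z.1.2 ^ n := fun n => by
    induction n with
    | zero => intro z; simpa using D.norm_coe_le_norm z
    | succ n ih =>
      intro z
      have hb : ∀ z : unitCone, |S z| ≤ B * ((c * B) ^ n / n.factorial * ‖D‖) * z.1.2 ^ n :=
        fun z => by
          rw [mul_assoc]
          exact (hS z).trans (mul_le_mul_of_nonneg_left (ih z) hB)
      have h := abs_coneDuhamel_le (by positivity) hb z
      rw [hD z, abs_mul, abs_of_nonneg hc]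
      refine (mul_le_mul_of_nonneg_left h hc).trans (le_of_eq ?_)
      rw [Nat.factorial_succ]
      push_cast
      field_simp
      ring
  ext z
  have hlim : Tendsto (fun n : ℕ => (c * B) ^ n / n.factorial * ‖D‖) atTop (𝓝 0) := by
    simpa using (FloorSemiring.tendsto_pow_div_factorial_atTop (c * B)).mul_const ‖D‖
  refine abs_nonpos_iff.1 (ge_of_tendsto hlim (Eventually.of_forall fun n => ?_))
  refine (hn n z).trans (mul_le_of_le_one_right (by positivity)
    (pow_le_one₀ (unitCone_time_nonneg z) (unitCone_time_le_one z)))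

end Cone

/-! ### Regularity and uniqueness of continuous solutions. -/

section Regularity

/-- The field `z ↦ (τ, U z)` on the cone. -/
def timeValueField : (E3 × ℝ) × C(unitCone, ℝ) →L[ℝ] C(unitCone, ℝ × ℝ) :=
  inlField ∘L constEmbedding ∘L ContinuousLinearMap.snd ℝ E3 ℝ ∘L
      ContinuousLinearMap.fst ℝ (E3 × ℝ) C(unitCone, ℝ)
    + ContinuousLinearMap.compLeftContinuous ℝ unitCone (ContinuousLinearMap.inr ℝ ℝ ℝ) ∘L
      ContinuousLinearMap.snd ℝ (E3 × ℝ) C(unitCone, ℝ)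

@[simp] lemma timeValueField_apply (q : (E3 × ℝ) × C(unitCone, ℝ)) (z : unitCone) :
    timeValueField q z = (q.1.2, q.2 z) := by
  change ((q.1.2, 0) : ℝ × ℝ) + (0, q.2 z) = _
  simp

variable {n : ℕ} {G : ℝ × ℝ → ℝ}

/-- The nonlinear superposition operator on the cone. -/
def coneNonlinearity (hG : Continuous G) (q : (E3 × ℝ) × C(unitCone, ℝ)) : C(unitCone, ℝ) :=
  ⟨fun z => G (q.1.2 * z.1.2, q.2 z), by fun_prop⟩

lemma contDiff_coneNonlinearity (hG : ContDiff ℝ n G) :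
    ContDiff ℝ n (coneNonlinearity hG.continuous) := by
  have h := (contDiff_superposition n
    (fun q : (ℝ × ℝ) × (E3 × ℝ) => G (q.1.1 * q.2.2, q.1.2))
    (hG.comp (by fun_prop)) coneIncl).comp timeValueField.contDiff
  convert h using 1
  ext q z
  simp [coneNonlinearity]

/-- The derivative is multiplication by the partial derivative of `G` in its second variable,
identified by composing with evaluation at each point of the cone. This makes the linearized
equation a Volterra equation. -/
lemma hasFDerivAt_coneNonlinearity (hn : n ≠ 0) (hG : ContDiff ℝ n G) (π : E3 × ℝ)
    (U : C(unitCone, ℝ)) :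
    ∃ b : C(unitCone, ℝ), HasFDerivAt (fun V => coneNonlinearity hG.continuous (π, V))
      (ContinuousLinearMap.mul ℝ C(unitCone, ℝ) b) U := by
  have hn' : (n : WithTop ℕ∞) ≠ 0 := by exact_mod_cast hn
  have hG1 : ContDiff ℝ 1 G := hG.of_le (by exact_mod_cast Nat.one_le_iff_ne_zero.2 hn)
  have hG' : Continuous (fderiv ℝ G) := hG1.continuous_fderiv (by simp)
  refine ⟨⟨fun z => fderiv ℝ G (π.2 * z.1.2, U z) (0, 1), by fun_prop⟩, ?_⟩
  have hN : ContDiff ℝ n (fun V => coneNonlinearity hG.continuous (π, V)) :=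
    (contDiff_coneNonlinearity hG).comp (contDiff_const.prodMk contDiff_id)
  have hd := ((hN.differentiable hn') U).hasFDerivAt
  refine hd.congr_fderiv ?_
  ext V z
  have h1 := (ContinuousMap.evalCLM ℝ z).hasFDerivAt.comp U hd
  have h2 := ((hG1.differentiable (by simp)) (π.2 * z.1.2, U z)).hasFDerivAt.comp U
    ((hasFDerivAt_const (π.2 * z.1.2) U).prodMk
      (ContinuousMap.evalCLM ℝ z : C(unitCone, ℝ) →L[ℝ] ℝ).hasFDerivAt)
  have h3 := congrArg (fun A => A V) (HasFDerivAt.unique h1 h2)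
  refine h3.trans ?_
  change fderiv ℝ G (π.2 * z.1.2, U z) (0, V z) = fderiv ℝ G (π.2 * z.1.2, U z) (0, 1) * V z
  rw [show ((0, V z) : ℝ × ℝ) = V z • (0, 1) by simp, map_smul, smul_eq_mul, mul_comm]

lemma isInvertible_one_sub_volterraOp (c : ℝ) (b : C(unitCone, ℝ)) :
    (1 - volterraOp c b).IsInvertible := by
  obtain ⟨u, hu⟩ := isUnit_one_sub_volterraOp c b
  exact ⟨ContinuousLinearEquiv.unitsEquiv ℝ _ u, by rw [← hu]; rfl⟩

/-- Continuous solutions of a semilinear Volterra-Duhamel equation inherit the regularity of the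
data. -/
theorem contDiffOn_of_duhamel_eq (hn : n ≠ 0) (hG : ContDiff ℝ n G) {w₀ : E3 × ℝ → ℝ}
    (hw₀ : ContDiff ℝ n w₀) (u : C(E3 × ℝ, ℝ))
    (hu : ∀ x t, 0 ≤ t → u (x, t) = w₀ (x, t) + duhamelIntegral (fun z => G (z.2, u z)) x t) :
    ContDiffOn ℝ n u halfSpace := by
  have hn' : (n : WithTop ℕ∞) ≠ 0 := by exact_mod_cast hn
  let data : E3 × ℝ → C(unitCone, ℝ) := fun π =>
    ⟨fun z => w₀ (π.1 + π.2 • (coneIncl z).1, π.2 * (coneIncl z).2), by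
      have := hw₀.continuous
      fun_prop⟩
  have hdata : ContDiff ℝ n data := contDiff_family n
    (fun q : (E3 × ℝ) × (E3 × ℝ) => w₀ (q.1.1 + q.1.2 • q.2.1, q.1.2 * q.2.2))
    (hw₀.comp (by fun_prop)) coneIncl
  -- The equation on the cone with apex `π`, as a zero set that is `C^n` in the apex. It is defined
  -- for apexes on both sides of `t = 0`, so the implicit function lives on a full neighbourhood
  -- even at boundary points.
  let Ψ : (E3 × ℝ) × C(unitCone, ℝ) → C(unitCone, ℝ) := fun q =>
    q.2 - data q.1 - q.1.2 ^ 2 • coneDuhamel (coneNonlinearity hG.continuous q)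
  have hΨ : ContDiff ℝ n Ψ :=
    (contDiff_snd.sub (hdata.comp contDiff_fst)).sub
      ((by fun_prop : ContDiff ℝ n fun q : (E3 × ℝ) × C(unitCone, ℝ) => q.1.2 ^ 2).smul
        (coneDuhamel.contDiff.comp (contDiff_coneNonlinearity hG)))
  have hzero : ∀ π ∈ halfSpace, Ψ (π, conePullback u π) = 0 := fun π hπ => by
    rw [halfSpace_eq] at hπ
    ext z
    let Gu : C(E3 × ℝ, ℝ) := ⟨fun z => G (z.2, u z), hG.continuous.comp (by fun_prop)⟩
    have h1 := coneDuhamel_conePullback Gu π z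
    have h2 := hu (π.1 + π.2 • z.1.1) (π.2 * z.1.2) (mul_nonneg hπ (unitCone_time_nonneg z))
    change u (π.1 + π.2 • z.1.1, π.2 * z.1.2) - w₀ (π.1 + π.2 • z.1.1, π.2 * z.1.2)
      - π.2 ^ 2 * coneDuhamel (conePullback Gu π) z = 0
    rw [h1, h2]
    exact sub_eq_zero.2 (add_sub_cancel_left _ _)
  intro π hπ
  have hinv : (fderiv ℝ Ψ (π, conePullback u π) ∘L
      ContinuousLinearMap.inr ℝ (E3 × ℝ) C(unitCone, ℝ)).IsInvertible := by
    obtain ⟨b, hb⟩ := hasFDerivAt_coneNonlinearity hn hG π (conePullback u π)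
    have h1 : HasFDerivAt (fun V => Ψ (π, V)) (1 - volterraOp (π.2 ^ 2) b) (conePullback u π) :=
      ((hasFDerivAt_id _).sub_const (data π)).sub
        ((coneDuhamel.hasFDerivAt.comp _ hb).const_smul (π.2 ^ 2))
    have h2 : HasFDerivAt (fun V => Ψ (π, V)) _ (conePullback u π) :=
      ((hΨ.differentiable hn') (π, conePullback u π)).hasFDerivAt.comp (conePullback u π)
        (hasFDerivAt_prodMk_right π (conePullback u π))
    rw [h2.unique h1]
    exact isInvertible_one_sub_volterraOp _ _
  have hΨ' : ContDiffAt ℝ n Ψ (π, conePullback u π) := hΨ.contDiffAt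
  have hev := hΨ'.eventually_apply_eq_iff_implicitFunction hn' hinv
  have hreg := hΨ'.contDiffAt_implicitFunction hn' hinv
  have hcont : Tendsto (fun π' => (π', conePullback u π')) (𝓝 π) (𝓝 (π, conePullback u π)) :=
    ((continuous_id.prodMk (conePullback u).continuous).tendsto π)
  -- Continuity of `u` makes its pull-backs vary continuously in the sup norm, so they stay in the
  -- region where the implicit function is the only zero. Evaluation at the apex returns `u`.
  have heq : (fun π' => hΨ'.implicitFunction hn' hinv π' coneApex) =ᶠ[𝓝[halfSpace] π] u := by
    filter_upwards [(hcont.eventually hev).filter_mono nhdsWithin_le_nhds, self_mem_nhdsWithin]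
      with π' h1 h2
    rw [h1.1 ((hzero π' h2).trans (hzero π hπ).symm), conePullback_apply]
    simp [coneApex]
  have hapex : ContDiffAt ℝ n (fun π' => hΨ'.implicitFunction hn' hinv π' coneApex) π :=
    (ContinuousMap.evalCLM ℝ coneApex : C(unitCone, ℝ) →L[ℝ] ℝ).contDiff.contDiffAt.comp π hreg
  exact hapex.contDiffWithinAt.congr_of_eventuallyEq_of_mem heq.symm hπ

/-- Continuous solutions with a locally Lipschitz nonlinearity are unique. -/
theorem eqOn_of_duhamel_eq (hG : ContDiff ℝ 1 G) {w₀ : E3 × ℝ → ℝ} (u v : C(E3 × ℝ, ℝ))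
    (hu : ∀ x t, 0 ≤ t → u (x, t) = w₀ (x, t) + duhamelIntegral (fun z => G (z.2, u z)) x t)
    (hv : ∀ x t, 0 ≤ t → v (x, t) = w₀ (x, t) + duhamelIntegral (fun z => G (z.2, v z)) x t) :
    EqOn v u halfSpace := by
  rintro π hπ
  rw [halfSpace_eq] at hπ
  let Gu : C(E3 × ℝ, ℝ) := ⟨fun z => G (z.2, u z), hG.continuous.comp (by fun_prop)⟩
  let Gv : C(E3 × ℝ, ℝ) := ⟨fun z => G (z.2, v z), hG.continuous.comp (by fun_prop)⟩
  obtain ⟨B, hB, hlip⟩ : ∃ B, 0 ≤ B ∧ ∀ z : unitCone,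
      |conePullback Gv π z - conePullback Gu π z| ≤ B * |conePullback v π z - conePullback u π z| := by
    -- On the cone below `π` both solutions are bounded, so a Lipschitz constant of `G` on a compact
    -- rectangle suffices and no global bound enters.
    let M := max ‖conePullback u π‖ ‖conePullback v π‖
    obtain ⟨B, hB⟩ := (isCompact_Icc (a := (0 : ℝ)) (b := π.2)).prod
      (isCompact_Icc (a := -M) (b := M)) |>.exists_bound_of_continuousOn
      (hG.continuous_fderiv (by simp)).continuousOn
    have hM : ∀ {w : C(unitCone, ℝ)} (z : unitCone), ‖w‖ ≤ M → w z ∈ Icc (-M) M := fun {w} z h =>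
      abs_le.1 ((w.norm_coe_le_norm z).trans h)
    refine ⟨max B 0, le_max_right _ _, fun z => ?_⟩
    have ht : π.2 * z.1.2 ∈ Icc 0 π.2 :=
      ⟨mul_nonneg hπ (unitCone_time_nonneg z),
        mul_le_of_le_one_right hπ (unitCone_time_le_one z)⟩
    have h := ((convex_Icc (0 : ℝ) π.2).prod (convex_Icc (-M) M)).norm_image_sub_le_of_norm_fderiv_le
      (fun q _ => (hG.differentiable (by simp)) q) (C := max B 0)
      (fun q hq => (hB q hq).trans (le_max_left _ _))
      (mk_mem_prod ht (hM (w := conePullback u π) z (le_max_left _ _)))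
      (mk_mem_prod ht (hM (w := conePullback v π) z (le_max_right _ _)))
    rw [Prod.mk_sub_mk, sub_self, Prod.norm_mk, norm_zero, max_eq_right (norm_nonneg _)] at h
    exact h
  have h0 := eq_zero_of_abs_le_coneDuhamel (sq_nonneg π.2) hB
    (D := conePullback v π - conePullback u π) (S := conePullback Gv π - conePullback Gu π) hlip
    fun z => by
      have ht := mul_nonneg hπ (unitCone_time_nonneg z)
      rw [map_sub, ContinuousMap.sub_apply, ContinuousMap.sub_apply, mul_sub,
        coneDuhamel_conePullback, coneDuhamel_conePullback, conePullback_apply, conePullback_apply,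
        hu _ _ ht, hv _ _ ht, add_sub_add_left_eq_sub]
      rfl
  have h1 := congrArg (fun W : C(unitCone, ℝ) => W coneApex) h0
  simp only [ContinuousMap.sub_apply, conePullback_apply, ContinuousMap.zero_apply] at h1
  simp only [coneApex, smul_zero, add_zero, mul_one] at h1
  exact sub_eq_zero.1 h1

end Regularity

/-! ### Radial majorants and integration in characteristic coordinates. -/

section WeightedEstimate

/-- The decay profile `(1 + t + r)⁻¹ (1 + |t - r|)^{-a}`. -/
def decayProfile (a r t : ℝ) : ℝ := (1 + t + r)⁻¹ * (1 + |t - r|) ^ (-a)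

lemma decayProfile_nonneg {a r t : ℝ} (hr : 0 ≤ r) (ht : 0 ≤ t) : 0 ≤ decayProfile a r t := by
  unfold decayProfile
  positivity

lemma decayProfile_le_one {a r t : ℝ} (ha : 0 ≤ a) (hr : 0 ≤ r) (ht : 0 ≤ t) :
    decayProfile a r t ≤ 1 := by
  refine mul_le_one₀ (inv_le_one_of_one_le₀ (by linarith)) (Real.rpow_nonneg (by positivity) _) ?_
  exact Real.rpow_le_one_of_one_le_of_nonpos (by linarith [abs_nonneg (t - r)]) (by linarith)

lemma integral_one_add_rpow_le {a L R : ℝ} (ha : 0 < a) (hL : 0 ≤ L) (hLR : L ≤ R) :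
    ∫ α in L..R, (1 + α) ^ (-(a + 1)) ≤ (1 + L) ^ (-a) / a := by
  rw [intervalIntegral.integral_comp_add_left (fun α => α ^ (-(a + 1))), integral_rpow]
  · rw [show -(a + 1) + 1 = -a by ring, div_neg, ← neg_div, neg_sub]
    gcongr
    have : 0 ≤ (1 + R) ^ (-a) := Real.rpow_nonneg (by linarith) _
    linarith
  · refine Or.inr ⟨by linarith, fun h => ?_⟩
    rw [uIcc_of_le (by linarith)] at h
    linarith [h.1]

/-- If `1 + t + r ≤ 2 (1 + |t - r|)`, the integrand is bounded by its value at the left end and the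
interval has length at most `2r`, cancelling `1 / r`. Otherwise `1 + t + r ≤ 4r`, so `1 / r` itself
supplies the decay in `1 + t + r`, and the integral is computed. -/
lemma integral_strip_le {a r t : ℝ} (ha : 0 < a) (hr : 0 < r) (ht : 0 ≤ t) :
    1 / r * ∫ α in |t - r|..(t + r), (1 + α) ^ (-(a + 1)) ≤ (4 + 4 / a) * decayProfile a r t := by
  have hA := abs_nonneg (t - r)
  have hLR : |t - r| ≤ t + r := abs_le.2 ⟨by linarith, by linarith⟩
  have hd : t + r - |t - r| ≤ 2 * r := by linarith [le_abs_self (t - r)]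
  have hP : 0 ≤ (1 + |t - r|) ^ (-a) := by positivity
  have hB : 0 < 1 + t + r := by linarith
  unfold decayProfile
  rcases le_total (1 + t + r) (2 * (1 + |t - r|)) with h | h
  · have h1 : ∫ α in |t - r|..(t + r), (1 + α) ^ (-(a + 1))
        ≤ ∫ _ in |t - r|..(t + r), (1 + |t - r|) ^ (-(a + 1)) := by
      refine intervalIntegral.integral_mono_on hLR ?_ intervalIntegrable_const fun α hα => ?_
      · refine ContinuousOn.intervalIntegrable fun α hα => ?_
        rw [uIcc_of_le hLR] at hα
        exact (ContinuousAt.rpow_const (by fun_prop)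
          (Or.inl (by linarith [hα.1]))).continuousWithinAt
      · exact Real.rpow_le_rpow_of_nonpos (by linarith) (by linarith [hα.1]) (by linarith)
    rw [intervalIntegral.integral_const, smul_eq_mul,
      show (1 + |t - r|) ^ (-(a + 1)) = (1 + |t - r|) ^ (-a) * (1 + |t - r|)⁻¹ by
        rw [neg_add, Real.rpow_add (by linarith), Real.rpow_neg_one]] at h1
    have h2 : (1 + |t - r|)⁻¹ ≤ 2 * (1 + t + r)⁻¹ := by
      rw [inv_eq_one_div, ← div_eq_mul_inv, div_le_div_iff₀ (by linarith) hB]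
      linarith
    have h3 : (t + r - |t - r|) * ((1 + |t - r|) ^ (-a) * (1 + |t - r|)⁻¹)
        ≤ 2 * r * ((1 + |t - r|) ^ (-a) * (2 * (1 + t + r)⁻¹)) := by gcongr
    calc 1 / r * ∫ α in |t - r|..(t + r), (1 + α) ^ (-(a + 1))
        ≤ 1 / r * (2 * r * ((1 + |t - r|) ^ (-a) * (2 * (1 + t + r)⁻¹))) := by
          gcongr
          exact h1.trans h3
      _ = 4 * ((1 + t + r)⁻¹ * (1 + |t - r|) ^ (-a)) := by field_simp; ring
      _ ≤ _ := by
          gcongr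
          have : 0 ≤ 4 / a := by positivity
          linarith
  · have h1 := integral_one_add_rpow_le ha hA hLR
    have h2 : 1 / r ≤ 4 * (1 + t + r)⁻¹ := by
      rw [← div_eq_mul_inv, div_le_div_iff₀ hr hB]
      linarith
    calc 1 / r * ∫ α in |t - r|..(t + r), (1 + α) ^ (-(a + 1))
        ≤ 1 / r * ((1 + |t - r|) ^ (-a) / a) := by gcongr
      _ ≤ 4 * (1 + t + r)⁻¹ * ((1 + |t - r|) ^ (-a) / a) := by gcongr
      _ = 4 / a * ((1 + t + r)⁻¹ * (1 + |t - r|) ^ (-a)) := by ring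
      _ ≤ _ := by
          gcongr
          linarith

lemma lintegral_strip_le {a r t : ℝ} (ha : 0 < a) (hr : 0 < r) (ht : 0 ≤ t) :
    ENNReal.ofReal (1 / r) * ∫⁻ α in Icc |t - r| (t + r), ENNReal.ofReal ((1 + α) ^ (-(a + 1)))
      ≤ ENNReal.ofReal ((4 + 4 / a) * decayProfile a r t) := by
  have hLR : |t - r| ≤ t + r := abs_le.2 ⟨by linarith, by linarith⟩
  have hc : ContinuousOn (fun α : ℝ => (1 + α) ^ (-(a + 1))) (Icc |t - r| (t + r)) := fun α hα =>
    (ContinuousAt.rpow_const (by fun_prop)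
      (Or.inl (by linarith [hα.1, abs_nonneg (t - r)]))).continuousWithinAt
  rw [← ofReal_integral_eq_lintegral_ofReal (hc.integrableOn_Icc)
    ((ae_restrict_iff' measurableSet_Icc).2 (Eventually.of_forall fun α hα => by
      have := hα.1.trans' (abs_nonneg (t - r))
      change 0 ≤ (1 + α) ^ (-(a + 1))
      positivity)),
    ← ENNReal.ofReal_mul (by positivity), integral_Icc_eq_integral_Ioc,
    ← intervalIntegral.integral_of_le hLR]
  exact ENNReal.ofReal_le_ofReal (integral_strip_le ha hr ht)

/-- The factor `(1 + |s - l|)^{-b}` in the characteristic coordinates `(s, α) = (s, s + l)`. -/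
def characteristicWeight (b s α : ℝ) : ENNReal := ENNReal.ofReal ((1 + |2 * s - α|) ^ (-b))

lemma measurable_characteristicWeight (b : ℝ) :
    Measurable (Function.uncurry (characteristicWeight b)) := by
  unfold characteristicWeight Function.uncurry
  fun_prop

lemma lintegral_characteristicWeight_le {b : ℝ} (hb : 0 ≤ b) (α : ℝ) :
    ∫⁻ s, characteristicWeight b s α ≤ ∫⁻ s : ℝ, ENNReal.ofReal ((1 + ‖s‖) ^ (-b)) := by
  rw [← lintegral_sub_right_eq_self (fun s : ℝ => ENNReal.ofReal ((1 + ‖s‖) ^ (-b))) (α / 2)]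
  refine lintegral_mono fun s => ENNReal.ofReal_le_ofReal ?_
  refine Real.rpow_le_rpow_of_nonpos (by positivity) ?_ (by linarith)
  rw [Real.norm_eq_abs, show 2 * s - α = 2 * (s - α / 2) by ring, abs_mul, abs_two]
  linarith [abs_nonneg (s - α / 2)]

/-- Substitute `α = s + l` at fixed `s`. For `s ≥ 0` the domain of dependence is sent into `|t - r|
≤ α ≤ t + r`, and `s - l = 2s - α`. -/
lemma lintegral_le_characteristic {b q r t s : ℝ} (hs : 0 ≤ s) :
    ∫⁻ l in Icc |r - (t - s)| (r + (t - s)),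
      ENNReal.ofReal ((1 + s + l) ^ (-q) * (1 + |s - l|) ^ (-b))
      ≤ ∫⁻ α, (Icc |t - r| (t + r)).indicator (fun α => ENNReal.ofReal ((1 + α) ^ (-q))) α
          * characteristicWeight b s α := by
  rw [← lintegral_indicator measurableSet_Icc, ← lintegral_add_left_eq_self (fun α =>
    (Icc |t - r| (t + r)).indicator (fun α => ENNReal.ofReal ((1 + α) ^ (-q))) α
      * characteristicWeight b s α) s]
  refine lintegral_mono fun l => ?_
  rw [indicator_apply]
  split_ifs with hl
  swap
  · exact zero_le
  have hl0 : 0 ≤ l := (abs_nonneg _).trans hl.1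
  have hmem : s + l ∈ Icc |t - r| (t + r) := by
    have := abs_le.1 hl.1
    exact ⟨abs_le.2 ⟨by linarith, by linarith⟩, by linarith [hl.2]⟩
  rw [indicator_of_mem hmem, characteristicWeight,
    ← ENNReal.ofReal_mul (Real.rpow_nonneg (by linarith) _),
    show 2 * s - (s + l) = s - l by ring, add_assoc]

/-- By Tonelli the `s`-integral is taken first at fixed `α`; translation by `α / 2` bounds it
independently of `α`. -/
lemma lintegral_mul_characteristicWeight_le {b : ℝ} (hb : 0 ≤ b) {F : ℝ → ENNReal}
    (hF : Measurable F) (S : Set ℝ) :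
    ∫⁻ s in S, ∫⁻ α, F α * characteristicWeight b s α
      ≤ (∫⁻ s : ℝ, ENNReal.ofReal ((1 + ‖s‖) ^ (-b))) * ∫⁻ α, F α := by
  have hHm := measurable_characteristicWeight b
  have hm : Measurable (Function.uncurry fun s α => F α * characteristicWeight b s α) :=
    (hF.comp measurable_snd).mul hHm
  have hs : ∀ α, Measurable fun s => characteristicWeight b s α := fun α => by
    unfold characteristicWeight
    fun_prop
  refine (setLIntegral_le_lintegral _ _).trans ?_
  rw [lintegral_lintegral_swap hm.aemeasurable, ← lintegral_const_mul _ hF]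
  refine lintegral_mono fun α => ?_
  rw [lintegral_const_mul _ (hs α), mul_comm]
  exact mul_le_mul_left (lintegral_characteristicWeight_le hb α) _

/-- Integration over characteristic coordinates. -/
lemma exists_lintegral_characteristic_le {b : ℝ} (hb : 1 < b) :
    ∃ K : ℝ, 0 ≤ K ∧ ∀ q r t : ℝ,
      ∫⁻ s in Ioo 0 t, ∫⁻ l in Icc |r - (t - s)| (r + (t - s)),
          ENNReal.ofReal ((1 + s + l) ^ (-q) * (1 + |s - l|) ^ (-b))
        ≤ ENNReal.ofReal K * ∫⁻ α in Icc |t - r| (t + r), ENNReal.ofReal ((1 + α) ^ (-q)) := by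
  have hfin := finite_integral_one_add_norm (E := ℝ) (μ := volume) (r := b) (by simpa using hb)
  refine ⟨(∫⁻ s : ℝ, ENNReal.ofReal ((1 + ‖s‖) ^ (-b))).toReal, ENNReal.toReal_nonneg,
    fun q r t => ?_⟩
  rw [ENNReal.ofReal_toReal hfin.ne, ← lintegral_indicator measurableSet_Icc]
  exact (setLIntegral_mono' measurableSet_Ioo fun s hs =>
    lintegral_le_characteristic hs.1.le).trans
    (lintegral_mul_characteristicWeight_le (by linarith)
      (Measurable.indicator (by fun_prop) measurableSet_Icc) _)

lemma duhamelIntegral_eq_coneDuhamel {W : E3 × ℝ → ℝ} (hW : Continuous W) (x : E3) (t : ℝ) :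
    duhamelIntegral W x t = t ^ 2 * coneDuhamel (conePullback ⟨W, hW⟩ (x, t)) coneApex := by
  have h := coneDuhamel_conePullback ⟨W, hW⟩ (x, t) coneApex
  simpa [coneApex] using h.symm

lemma continuous_duhamelIntegral {W : E3 × ℝ → ℝ} (hW : Continuous W) :
    Continuous fun z : E3 × ℝ => duhamelIntegral W z.1 z.2 := by
  simp only [duhamelIntegral_eq_coneDuhamel hW]
  exact (by fun_prop : Continuous fun z : E3 × ℝ => z.2 ^ 2).mul
    ((ContinuousMap.evalCLM ℝ coneApex : C(unitCone, ℝ) →L[ℝ] ℝ).continuous.comp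
      (coneDuhamel.continuous.comp (conePullback ⟨W, hW⟩).continuous))

/-- A radial majorant of the source controls the Duhamel integral. -/
lemma ofReal_abs_duhamelIntegral_le {W : E3 × ℝ → ℝ} {N : ℝ → ℝ → ℝ}
    (hN : ∀ s, Measurable fun l => N l s) {x : E3} (hx : x ≠ 0) {t : ℝ} (ht : 0 ≤ t)
    (h : ∀ y s, 0 ≤ s → |W (y, s)| ≤ N ‖y‖ s) :
    ENNReal.ofReal |duhamelIntegral W x t| ≤ ENNReal.ofReal (1 / (2 * ‖x‖)) *
      ∫⁻ s in Ioo 0 t, ∫⁻ l in Icc |‖x‖ - (t - s)| (‖x‖ + (t - s)),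
        ENNReal.ofReal l * ENNReal.ofReal (N l s) := by
  have hpi := Real.pi_pos
  have hx' : 0 < ‖x‖ := norm_pos_iff.2 hx
  rw [duhamelIntegral, abs_mul, ENNReal.ofReal_mul (abs_nonneg _),
    abs_of_pos (by positivity), intervalIntegral.integral_of_le ht,
    integral_Ioc_eq_integral_Ioo]
  -- The kernel factor `t - s` cancels the radius in the denominator of John's identity, leaving
  -- only `1 / ‖x‖`.
  have h1 : ∀ s ∈ Ioo 0 t,
      ‖(t - s) * sphereIntegral (fun η => W (x + (t - s) • η, s))‖ₑ
        ≤ ENNReal.ofReal (2 * Real.pi / ‖x‖) *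
          ∫⁻ l in Icc |‖x‖ - (t - s)| (‖x‖ + (t - s)),
            ENNReal.ofReal l * ENNReal.ofReal (N l s) := fun s hs => by
    have hρ : 0 < t - s := by linarith [hs.2]
    rw [enorm_mul, Real.enorm_of_nonneg hρ.le]
    have h2 : ‖sphereIntegral (fun η => W (x + (t - s) • η, s))‖ₑ
        ≤ ∫⁻ ω : Metric.sphere (0 : E3) 1, ENNReal.ofReal (N ‖x + (t - s) • (ω : E3)‖ s)
          ∂sphereMeasure := by
      refine (enorm_integral_le_lintegral_enorm _).trans (lintegral_mono fun ω => ?_)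
      rw [Real.enorm_eq_ofReal_abs]
      exact ENNReal.ofReal_le_ofReal (h _ _ hs.1.le)
    rw [lintegral_sphere_radial hx hρ (b := fun l => ENNReal.ofReal (N l s)) (hN s).ennreal_ofReal]
      at h2
    calc _ ≤ ENNReal.ofReal (t - s) * _ := mul_le_mul_right h2 _
      _ = _ := by
        rw [← mul_assoc, ← ENNReal.ofReal_mul hρ.le]
        congr 2
        field_simp
  have h3 : ENNReal.ofReal |∫ s in Ioo 0 t,
      (t - s) * sphereIntegral (fun η => W (x + (t - s) • η, s))|
      ≤ ENNReal.ofReal (2 * Real.pi / ‖x‖) * ∫⁻ s in Ioo 0 t,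
          ∫⁻ l in Icc |‖x‖ - (t - s)| (‖x‖ + (t - s)),
            ENNReal.ofReal l * ENNReal.ofReal (N l s) := by
    rw [← Real.enorm_eq_ofReal_abs, ← lintegral_const_mul' _ _ ENNReal.ofReal_ne_top]
    exact (enorm_integral_le_lintegral_enorm _).trans (setLIntegral_mono' measurableSet_Ioo h1)
  calc _ ≤ ENNReal.ofReal (1 / (4 * Real.pi)) * _ := mul_le_mul_right h3 _
    _ = _ := by
      rw [← mul_assoc, ← ENNReal.ofReal_mul (by positivity)]
      congr 2
      field_simp
      ring

end WeightedEstimate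

/-! ### The weighted a priori estimate for Duhamel's integral. -/

section DuhamelBound

/-- The decay weight, supported in the cone `|x| ≤ t + k`. -/
def supportedWeight (a k : ℝ) (z : E3 × ℝ) : ℝ :=
  if ‖z.1‖ ≤ max z.2 0 + k then decayProfile a ‖z.1‖ (max z.2 0) else 0

/-- The radial majorant of sources dominated by a power of the weight. -/
def sourceMajorant (p a k l s : ℝ) : ℝ :=
  if l ≤ s + k then (1 + s) ^ (-(p - 1)) * decayProfile a l s ^ p else 0

lemma measurable_sourceMajorant (p a k s : ℝ) : Measurable fun l => sourceMajorant p a k l s := by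
  unfold sourceMajorant decayProfile
  exact Measurable.ite measurableSet_Iic (by fun_prop) measurable_const

/-- This is where the support condition is used: `l ≤ s + k` gives `1 + s + l ≤ (2 + k)(1 + s)`, so
the time weight decays in `1 + s + l` as well. The exponents then add up to `1 - (p - 1) - p = -(2p
- 2)`. -/
lemma mul_sourceMajorant_le {p a k : ℝ} (hp : 1 < p) (hk : 0 ≤ k) {l s : ℝ} (hl : 0 ≤ l)
    (hs : 0 ≤ s) :
    l * sourceMajorant p a k l s
      ≤ (2 + k) ^ (p - 1) * ((1 + s + l) ^ (-(2 * p - 2)) * (1 + |s - l|) ^ (-(a * p))) := by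
  have h0 : 0 < 1 + s + l := by linarith
  have h1 : 0 < 1 + |s - l| := by positivity
  unfold sourceMajorant
  split_ifs with h
  · have h2 : (1 + s) ^ (-(p - 1)) ≤ (2 + k) ^ (p - 1) * (1 + s + l) ^ (-(p - 1)) := by
      have h3 : (1 + s + l) ^ (p - 1) ≤ ((2 + k) * (1 + s)) ^ (p - 1) :=
        Real.rpow_le_rpow h0.le (by nlinarith) (by linarith)
      rw [Real.mul_rpow (by linarith) (by linarith)] at h3
      rw [Real.rpow_neg (by linarith), Real.rpow_neg h0.le, ← div_eq_mul_inv, inv_eq_one_div,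
        div_le_div_iff₀ (Real.rpow_pos_of_pos (by linarith) _) (Real.rpow_pos_of_pos h0 _), one_mul]
      exact h3
    have h3 : decayProfile a l s ^ p = (1 + s + l) ^ (-p) * (1 + |s - l|) ^ (-(a * p)) := by
      rw [decayProfile, Real.mul_rpow (by positivity) (by positivity), ← Real.rpow_neg_one,
        ← Real.rpow_mul h0.le, ← Real.rpow_mul h1.le]
      ring_nf
    have h4 : (1 + s + l) ^ (-(2 * p - 2))
        = (1 + s + l) * ((1 + s + l) ^ (-(p - 1)) * (1 + s + l) ^ (-p)) := by
      rw [← Real.rpow_add h0, ← Real.rpow_one_add' h0.le (by linarith)]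
      ring_nf
    rw [h3, h4]
    calc l * ((1 + s) ^ (-(p - 1)) * ((1 + s + l) ^ (-p) * (1 + |s - l|) ^ (-(a * p))))
        ≤ (1 + s + l) * ((2 + k) ^ (p - 1) * (1 + s + l) ^ (-(p - 1)) *
          ((1 + s + l) ^ (-p) * (1 + |s - l|) ^ (-(a * p)))) := by
          gcongr
          linarith
      _ = _ := by ring
  · rw [mul_zero]
    positivity

/-- The basic weighted a priori estimate, away from the support condition. -/
lemma exists_abs_duhamelIntegral_le_decayProfile {p a k : ℝ} (hp : 1 < p) (ha : 0 < a)
    (hap : a = 2 * p - 3) (hdec : 1 < a * p) (hk : 0 ≤ k) :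
    ∃ C : ℝ, 0 ≤ C ∧ ∀ (A : ℝ) (W : E3 × ℝ → ℝ), 0 ≤ A → Continuous W →
      (∀ y s, 0 ≤ s → |W (y, s)| ≤ A * sourceMajorant p a k ‖y‖ s) →
      ∀ x t, 0 ≤ t → |duhamelIntegral W x t| ≤ C * A * decayProfile a ‖x‖ t := by
  obtain ⟨K, hK, hchar⟩ := exists_lintegral_characteristic_le hdec
  refine ⟨(2 + k) ^ (p - 1) * K * (4 + 4 / a) / 2, by positivity, fun A W hA hW h x t ht => ?_⟩
  have hne : ∀ x ∈ ({0}ᶜ : Set E3), |duhamelIntegral W x t|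
      ≤ (2 + k) ^ (p - 1) * K * (4 + 4 / a) / 2 * A * decayProfile a ‖x‖ t := fun x hx => by
    have hx' : 0 < ‖x‖ := norm_pos_iff.2 hx
    have hd := decayProfile_nonneg (a := a) hx'.le ht
    rw [← ENNReal.ofReal_le_ofReal_iff (by positivity)]
    refine (ofReal_abs_duhamelIntegral_le (N := fun l s => A * sourceMajorant p a k l s)
      (fun s => (measurable_sourceMajorant p a k s).const_mul A) hx ht h).trans ?_
    have h1 : ∀ s ∈ Ioo 0 t, ∫⁻ l in Icc |‖x‖ - (t - s)| (‖x‖ + (t - s)),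
        ENNReal.ofReal l * ENNReal.ofReal (A * sourceMajorant p a k l s)
        ≤ ENNReal.ofReal (A * (2 + k) ^ (p - 1)) *
          ∫⁻ l in Icc |‖x‖ - (t - s)| (‖x‖ + (t - s)),
            ENNReal.ofReal ((1 + s + l) ^ (-(2 * p - 2)) * (1 + |s - l|) ^ (-(a * p))) :=
      fun s hs => by
        rw [← lintegral_const_mul' _ _ ENNReal.ofReal_ne_top]
        refine setLIntegral_mono' measurableSet_Icc fun l hl => ?_
        have hl0 : 0 ≤ l := (abs_nonneg _).trans hl.1
        rw [← ENNReal.ofReal_mul hl0, ← ENNReal.ofReal_mul (by positivity)]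
        refine ENNReal.ofReal_le_ofReal ?_
        have := mul_le_mul_of_nonneg_left (mul_sourceMajorant_le (a := a) hp hk hl0 hs.1.le) hA
        linarith
    have h2 := setLIntegral_mono' (μ := volume) measurableSet_Ioo h1
    rw [lintegral_const_mul' _ _ ENNReal.ofReal_ne_top] at h2
    have h3 := hchar (2 * p - 2) ‖x‖ t
    have h4 := lintegral_strip_le ha hx' ht
    -- The choice `a = 2p - 3` closes the estimate: the strip integral with this exponent returns
    -- the original weight.
    rw [show a + 1 = 2 * p - 2 by rw [hap]; ring] at h4
    set J := ∫⁻ α in Icc |t - ‖x‖| (t + ‖x‖), ENNReal.ofReal ((1 + α) ^ (-(2 * p - 2)))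
    calc ENNReal.ofReal (1 / (2 * ‖x‖)) * _
        ≤ ENNReal.ofReal (1 / (2 * ‖x‖)) *
          (ENNReal.ofReal (A * (2 + k) ^ (p - 1)) * (ENNReal.ofReal K * J)) :=
          mul_le_mul_right (h2.trans (mul_le_mul_right h3 _)) _
      _ = ENNReal.ofReal (A * (2 + k) ^ (p - 1) * K / 2) * (ENNReal.ofReal (1 / ‖x‖) * J) := by
          rw [← mul_assoc, ← mul_assoc, ← mul_assoc, ← ENNReal.ofReal_mul (by positivity),
            ← ENNReal.ofReal_mul (by positivity), ← ENNReal.ofReal_mul (by positivity)]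
          congr 2
          field_simp
      _ ≤ ENNReal.ofReal (A * (2 + k) ^ (p - 1) * K / 2) *
          ENNReal.ofReal ((4 + 4 / a) * decayProfile a ‖x‖ t) := mul_le_mul_right h4 _
      _ = _ := by
          rw [← ENNReal.ofReal_mul (by positivity)]
          congr 1
          ring
  -- John's identity requires `x ≠ 0`; the origin follows by continuity and density.
  have hclosed : IsClosed {x : E3 | |duhamelIntegral W x t|
      ≤ (2 + k) ^ (p - 1) * K * (4 + 4 / a) / 2 * A * decayProfile a ‖x‖ t} := by
    refine isClosed_le
      ((continuous_duhamelIntegral hW).comp (by fun_prop : Continuous fun x : E3 => (x, t))).abs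
      (continuous_const.mul ?_)
    refine Continuous.mul (Continuous.inv₀ (by fun_prop) fun x => ?_)
      (Continuous.rpow_const (by fun_prop) fun x => Or.inl ?_)
    · have := norm_nonneg x
      positivity
    · positivity
  exact hclosed.closure_subset_iff.2 hne ((dense_compl_singleton (0 : E3)).closure_eq ▸ mem_univ x)

/-- Finite propagation speed: if `‖x‖ > t + k`, every point of the sphere of radius `t - s` about
`x` has norm greater than `s + k`. -/
lemma duhamelIntegral_eq_zero {W : E3 × ℝ → ℝ} {k : ℝ}
    (h : ∀ y s, 0 ≤ s → s + k < ‖y‖ → W (y, s) = 0) {x : E3} {t : ℝ} (ht : 0 ≤ t)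
    (hx : t + k < ‖x‖) : duhamelIntegral W x t = 0 := by
  have h1 : ∀ s ∈ uIcc 0 t, (t - s) * sphereIntegral (fun η => W (x + (t - s) • η, s)) = 0 :=
    fun s hs => by
      rw [uIcc_of_le ht] at hs
      have h2 : sphereIntegral (fun η => W (x + (t - s) • η, s)) = 0 := by
        refine integral_eq_zero_of_ae (Eventually.of_forall fun ω => h _ _ hs.1 ?_)
        have h3 := norm_sub_le (x + (t - s) • (ω : E3)) ((t - s) • (ω : E3))
        rw [add_sub_cancel_right, norm_smul, norm_eq_of_mem_sphere, Real.norm_eq_abs,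
          abs_of_nonneg (by linarith [hs.2])] at h3
        linarith
      rw [h2, mul_zero]
  rw [duhamelIntegral, intervalIntegral.integral_congr h1]
  simp

/-- The basic weighted a priori estimate. -/
theorem exists_abs_duhamelIntegral_le {p a k : ℝ} (hp : 1 < p) (ha : 0 < a)
    (hap : a = 2 * p - 3) (hdec : 1 < a * p) (hk : 0 ≤ k) :
    ∃ C : ℝ, 0 ≤ C ∧ ∀ (A : ℝ) (W : E3 × ℝ → ℝ), 0 ≤ A → Continuous W →
      (∀ z : E3 × ℝ, 0 ≤ z.2 → |W z| ≤ A * (decayWeight p z.2 * supportedWeight a k z ^ p)) →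
      ∀ x t, 0 ≤ t → |duhamelIntegral W x t| ≤ C * A * supportedWeight a k (x, t) := by
  obtain ⟨C, hC, hbound⟩ := exists_abs_duhamelIntegral_le_decayProfile hp ha hap hdec hk
  have hp0 : p ≠ 0 := by linarith
  have hmaj : ∀ (y : E3) (s : ℝ), 0 ≤ s →
      decayWeight p s * supportedWeight a k (y, s) ^ p = sourceMajorant p a k ‖y‖ s :=
    fun y s hs => by
      rw [supportedWeight, sourceMajorant, max_eq_left hs, decayWeight_of_nonneg p hs]
      split_ifs
      · rfl
      · rw [Real.zero_rpow hp0, mul_zero]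
  refine ⟨C, hC, fun A W hA hW h x t ht => ?_⟩
  have h' : ∀ y s, 0 ≤ s → |W (y, s)| ≤ A * sourceMajorant p a k ‖y‖ s := fun y s hs => by
    rw [← hmaj y s hs]
    exact h (y, s) hs
  rw [supportedWeight, max_eq_left ht]
  split_ifs with hx
  · exact hbound A W hA hW h' x t ht
  · rw [mul_zero, duhamelIntegral_eq_zero (k := k) (fun y s hs hy => ?_) ht (not_le.1 hx), abs_zero]
    have := h' y s hs
    rw [sourceMajorant, if_neg (not_le.2 hy), mul_zero] at this
    exact abs_nonpos_iff.1 this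

end DuhamelBound

/-! ### Decay of the free wave with compactly supported data. -/

section FreeDecay

/-- The indicator function of the ball of radius `k`, as a function of the radius. -/
def ballProfile (k l : ℝ) : ℝ := if l ≤ k then 1 else 0

lemma ballProfile_le_one (k l : ℝ) : ballProfile k l ≤ 1 := by
  unfold ballProfile
  split_ifs <;> norm_num

/-- John's identity bounds the mean by `2π / (‖x‖ t)` times an integral of `l` over part of `[0,
k]`. The prefactor is the dispersive decay. -/
lemma abs_sphereIntegral_le_of_ball {h : E3 → ℝ} {M k : ℝ} (hM : 0 ≤ M) (hk : 0 ≤ k) {x : E3}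
    (hx : x ≠ 0) {t : ℝ} (ht : 0 < t)
    (hh : ∀ ω : Metric.sphere (0 : E3) 1, |h ω| ≤ M * ballProfile k ‖x + t • (ω : E3)‖) :
    |sphereIntegral h| ≤ M * (2 * Real.pi * k ^ 2 / (‖x‖ * t)) := by
  have hpi := Real.pi_pos
  have hx' : 0 < ‖x‖ := norm_pos_iff.2 hx
  rw [← ENNReal.ofReal_le_ofReal_iff (by positivity), ← Real.enorm_eq_ofReal_abs]
  have hm : Measurable fun l => ENNReal.ofReal (M * ballProfile k l) := by
    unfold ballProfile
    exact ((Measurable.ite measurableSet_Iic measurable_const measurable_const).const_mul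
      M).ennreal_ofReal
  have h1 : ‖sphereIntegral h‖ₑ ≤ ∫⁻ ω : Metric.sphere (0 : E3) 1,
      ENNReal.ofReal (M * ballProfile k ‖x + t • (ω : E3)‖) ∂sphereMeasure := by
    refine (enorm_integral_le_lintegral_enorm _).trans (lintegral_mono fun ω => ?_)
    rw [Real.enorm_eq_ofReal_abs]
    exact ENNReal.ofReal_le_ofReal (hh ω)
  rw [lintegral_sphere_radial hx ht (b := fun l => ENNReal.ofReal (M * ballProfile k l)) hm] at h1
  have h2 : ∫⁻ l in Icc |‖x‖ - t| (‖x‖ + t),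
      ENNReal.ofReal l * ENNReal.ofReal (M * ballProfile k l) ≤ ENNReal.ofReal (M * k ^ 2) := by
    calc _ ≤ ∫⁻ l in Icc |‖x‖ - t| (‖x‖ + t), (Icc 0 k).indicator
          (fun _ => ENNReal.ofReal (M * k)) l := by
          refine setLIntegral_mono' measurableSet_Icc fun l hl => ?_
          have hl0 : 0 ≤ l := (abs_nonneg _).trans hl.1
          rw [← ENNReal.ofReal_mul hl0, ballProfile]
          split_ifs with hlk
          · rw [indicator_of_mem (mem_Icc.2 ⟨hl0, hlk⟩)]
            refine ENNReal.ofReal_le_ofReal ?_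
            rw [mul_one, mul_comm]
            gcongr
          · simp
      _ ≤ ∫⁻ l, (Icc 0 k).indicator (fun _ => ENNReal.ofReal (M * k)) l :=
          setLIntegral_le_lintegral _ _
      _ = ENNReal.ofReal (M * k ^ 2) := by
          rw [lintegral_indicator measurableSet_Icc, setLIntegral_const, Real.volume_Icc,
            ← ENNReal.ofReal_mul (by positivity)]
          congr 1
          ring
  refine h1.trans ((mul_le_mul_right h2 _).trans ?_)
  rw [← ENNReal.ofReal_mul (by positivity)]
  exact ENNReal.ofReal_le_ofReal (le_of_eq (by ring))

lemma abs_sphereIntegral_le_const {h : E3 → ℝ} {M : ℝ}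
    (hh : ∀ ω : Metric.sphere (0 : E3) 1, |h ω| ≤ M) : |sphereIntegral h| ≤ M * (4 * Real.pi) := by
  have := norm_integral_le_of_norm_le_const (μ := sphereMeasure)
    (f := fun ω : Metric.sphere (0 : E3) 1 => h ω) (C := M) (Eventually.of_forall hh)
  rw [sphereMeasure_real_univ] at this
  exact this

/-- Decay of spherical means of compactly supported functions. -/
lemma abs_sphereIntegral_le_supportedWeight {a k : ℝ} (ha : 0 < a) (hk : 0 < k) {h : E3 → ℝ}
    {M : ℝ} (hM : 0 ≤ M) {x : E3} {t : ℝ} (ht : 0 ≤ t)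
    (hh : ∀ ω : Metric.sphere (0 : E3) 1, |h ω| ≤ M * ballProfile k ‖x + t • (ω : E3)‖) :
    (1 + t) * |sphereIntegral h|
      ≤ 40 * Real.pi * (2 + 3 * k) ^ 2 * (1 + k) ^ a * M * supportedWeight a k (x, t) := by
  have hpi := Real.pi_pos
  have hxn := norm_nonneg x
  have hzero : (∀ ω : Metric.sphere (0 : E3) 1, k < ‖x + t • (ω : E3)‖) → sphereIntegral h = 0 :=
    fun hω => integral_eq_zero_of_ae (Eventually.of_forall fun ω => by
      have := hh ω
      rw [ballProfile, if_neg (not_le.2 (hω ω)), mul_zero] at this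
      exact abs_nonpos_iff.1 this)
  have htri : ∀ ω : Metric.sphere (0 : E3) 1, |‖x‖ - t| ≤ ‖x + t • (ω : E3)‖ := fun ω => by
    have h1 := abs_norm_sub_norm_le x (-(t • (ω : E3)))
    rwa [norm_neg, norm_smul, norm_eq_of_mem_sphere, mul_one, Real.norm_eq_abs, abs_of_nonneg ht,
      sub_neg_eq_add] at h1
  rw [supportedWeight, max_eq_left ht]
  -- Strong Huygens principle: the mean vanishes unless the sphere meets the support, which forces
  -- `|‖x‖ - t| ≤ k`. In that strip `(1 + |t - ‖x‖|)^{-a}` is at least `(1 + k)^{-a}`, so only decay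
  -- in `1 + t + ‖x‖` has to be shown.
  rcases lt_or_ge k |‖x‖ - t| with hs | hs
  · rw [hzero fun ω => hs.trans_le (htri ω), abs_zero, mul_zero]
    split_ifs
    · have := decayProfile_nonneg (a := a) hxn ht
      positivity
    · simp
  have hs' := abs_le.1 hs
  rw [if_pos (by linarith [hs'.2] : ‖x‖ ≤ t + k), decayProfile]
  have hB : 0 < 1 + t + ‖x‖ := by linarith
  have hstrip : 1 ≤ (1 + k) ^ a * (1 + |t - ‖x‖|) ^ (-a) := by
    rw [abs_sub_comm, Real.rpow_neg (by positivity), ← div_eq_mul_inv,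
      one_le_div (by positivity)]
    gcongr
  suffices hmain : (1 + t) * |sphereIntegral h| * (1 + t + ‖x‖)
      ≤ 40 * Real.pi * (2 + 3 * k) ^ 2 * M by
    rw [← le_div_iff₀ hB] at hmain
    calc _ ≤ _ := hmain
      _ = 40 * Real.pi * (2 + 3 * k) ^ 2 * M * (1 + t + ‖x‖)⁻¹ * 1 := by ring
      _ ≤ 40 * Real.pi * (2 + 3 * k) ^ 2 * M * (1 + t + ‖x‖)⁻¹ *
          ((1 + k) ^ a * (1 + |t - ‖x‖|) ^ (-a)) := by gcongr
      _ = _ := by ring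
  -- For bounded times everything is bounded. Later, `‖x‖ ≥ t - k ≥ k + 1` makes `1 + t + ‖x‖` at
  -- most `5 ‖x‖` and the dispersive bound applies.
  rcases le_total t (2 * k + 1) with h1 | h1
  · have h2 := abs_sphereIntegral_le_const fun ω =>
      (hh ω).trans (mul_le_of_le_one_right hM (ballProfile_le_one _ _))
    calc (1 + t) * |sphereIntegral h| * (1 + t + ‖x‖)
        ≤ (2 + 3 * k) * (M * (4 * Real.pi)) * (5 * (2 + 3 * k)) :=
          mul_le_mul (mul_le_mul (by linarith) h2 (abs_nonneg _) (by linarith))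
            (by linarith [hs'.2]) hB.le (by positivity)
      _ ≤ 40 * Real.pi * (2 + 3 * k) ^ 2 * M := by
          have : 0 ≤ Real.pi * (2 + 3 * k) ^ 2 * M := by positivity
          linarith
  · have hx0 : 0 < ‖x‖ := by linarith [hs'.1]
    have ht0 : 0 < t := by linarith
    have h2 := abs_sphereIntegral_le_of_ball hM hk.le (norm_pos_iff.1 hx0) ht0 hh
    calc (1 + t) * |sphereIntegral h| * (1 + t + ‖x‖)
        ≤ (2 * t) * (M * (2 * Real.pi * k ^ 2 / (‖x‖ * t))) * (5 * ‖x‖) := by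
          gcongr <;> linarith [hs'.1]
      _ = 20 * Real.pi * k ^ 2 * M := by
          field_simp
          ring
      _ ≤ 40 * Real.pi * (2 + 3 * k) ^ 2 * M := by
          gcongr <;> linarith

/-- Decay of the free wave generated by compactly supported data. -/
theorem exists_abs_freeWave_le {a k : ℝ} (ha : 0 < a) (hk : 0 < k) {f g : E3 → ℝ}
    (hf : ContDiff ℝ 1 f) (hg : Continuous g) (hfs : HasCompactSupport f)
    (hgs : HasCompactSupport g) (hfk : tsupport f ⊆ Metric.closedBall 0 k)
    (hgk : tsupport g ⊆ Metric.closedBall 0 k) :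
    ∃ C : ℝ, 0 ≤ C ∧ ∀ ε, 0 ≤ ε → ∀ x t, 0 ≤ t →
      |freeWave ε f g (x, t)| ≤ C * ε * supportedWeight a k (x, t) := by
  have hpi := Real.pi_pos
  obtain ⟨M₁, hM₁⟩ := hf.continuous.bounded_above_of_compact_support hfs
  obtain ⟨M₂, hM₂⟩ := hg.bounded_above_of_compact_support hgs
  obtain ⟨M₃, hM₃⟩ := (hf.continuous_fderiv (by simp)).bounded_above_of_compact_support
    (hfs.fderiv (𝕜 := ℝ))
  have hM₁0 := (norm_nonneg _).trans (hM₁ 0)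
  have hM₂0 := (norm_nonneg _).trans (hM₂ 0)
  have hM₃0 := (norm_nonneg _).trans (hM₃ 0)
  have hball : ∀ {φ : ℝ} {M : ℝ} {y : E3}, |φ| ≤ M → (k < ‖y‖ → φ = 0) →
      |φ| ≤ M * ballProfile k ‖y‖ := fun {φ M y} h1 h2 => by
    rw [ballProfile]
    split_ifs with h
    · rwa [mul_one]
    · rw [h2 (not_le.1 h), abs_zero, mul_zero]
  have hout : ∀ {F : Type} [NormedAddCommGroup F] {φ : E3 → F} {y : E3},
      tsupport φ ⊆ Metric.closedBall 0 k → k < ‖y‖ → φ y = 0 := fun {F} _ {φ y} hs hy =>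
    image_eq_zero_of_notMem_tsupport fun h => absurd (mem_closedBall_zero_iff.1 (hs h)) (not_le.2 hy)
  have hdk : tsupport (fderiv ℝ f) ⊆ Metric.closedBall 0 k := (tsupport_fderiv_subset ℝ).trans hfk
  obtain ⟨Q, hQ⟩ : ∃ Q, Q = 40 * Real.pi * (2 + 3 * k) ^ 2 * (1 + k) ^ a := ⟨_, rfl⟩
  have hQ0 : 0 ≤ Q := by rw [hQ]; positivity
  set M := M₁ + M₂ + M₃ with hM
  have hM0 : 0 ≤ M := by positivity
  refine ⟨1 / (4 * Real.pi) * (Q * (2 * M)), by positivity, fun ε hε x t ht => ?_⟩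
  rw [freeWave_eq hf, abs_mul, abs_of_nonneg hε]
  have hw : ∀ {h : E3 → ℝ} {N : ℝ}, 0 ≤ N →
      (∀ ω : Metric.sphere (0 : E3) 1, |h ω| ≤ N * ballProfile k ‖x + t • (ω : E3)‖) →
      (1 + t) * |sphereIntegral h| ≤ Q * N * supportedWeight a k (x, t) := fun hN hh =>
    hQ ▸ abs_sphereIntegral_le_supportedWeight ha hk hN ht hh
  have h1 := hw (h := fun ξ => f (x + t • ξ) + g (x + t • ξ)) hM0 fun ω => hball (by
      have e1 := hM₁ (x + t • (ω : E3))
      have e2 := hM₂ (x + t • (ω : E3))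
      rw [Real.norm_eq_abs] at e1 e2
      refine (abs_add_le _ _).trans ?_
      rw [hM]
      linarith)
    fun hy => by rw [hout hfk hy, hout hgk hy, add_zero]
  -- The growing factor `t` in front of the gradient is absorbed by the factor `1 + t` on the left
  -- of the decay estimate.
  have h2 := hw (h := fun ξ => f (x + t • ξ) + t * fderiv ℝ f (x + t • ξ) ξ) (N := (1 + t) * M)
    (by positivity) fun ω => hball (by
      have e1 := hM₁ (x + t • (ω : E3))
      have e2 := ((fderiv ℝ f (x + t • (ω : E3))).le_opNorm ω).trans
        (mul_le_mul_of_nonneg_right (hM₃ (x + t • (ω : E3))) (norm_nonneg _))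
      rw [norm_eq_of_mem_sphere, mul_one] at e2
      rw [Real.norm_eq_abs] at e1 e2
      refine (abs_add_le _ _).trans ?_
      rw [abs_mul, abs_of_nonneg ht]
      have e3 := mul_le_mul_of_nonneg_left e2 ht
      have e4 := mul_nonneg ht hM₁0
      have e5 := mul_nonneg ht hM₂0
      rw [hM]
      linarith)
    fun hy => by rw [hout hfk hy, hout hdk hy]; simp
  have h3 : |sphereIntegral fun ξ => f (x + t • ξ) + t * fderiv ℝ f (x + t • ξ) ξ|
      ≤ Q * M * supportedWeight a k (x, t) :=
    le_of_mul_le_mul_left (h2.trans (le_of_eq (by ring))) (by linarith : 0 < 1 + t)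
  have h4 : t * |sphereIntegral fun ξ => f (x + t • ξ) + g (x + t • ξ)|
      ≤ Q * M * supportedWeight a k (x, t) :=
    (mul_le_mul_of_nonneg_right (by linarith) (abs_nonneg _)).trans h1
  have h5 : |kirchhoff (fun y => f y + g y) x t + kirchhoffDeriv f x t|
      ≤ 1 / (4 * Real.pi) * (Q * M * supportedWeight a k (x, t)
        + Q * M * supportedWeight a k (x, t)) := by
    refine (abs_add_le _ _).trans ?_
    rw [mul_add]
    refine add_le_add ?_ ?_
    · rw [kirchhoff, abs_mul, abs_of_nonneg (by positivity), div_eq_mul_one_div, mul_comm t,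
        mul_assoc]
      gcongr
    · rw [kirchhoffDeriv, abs_mul, abs_of_nonneg (by positivity)]
      gcongr
  refine (mul_le_mul_of_nonneg_left h5 hε).trans (le_of_eq (by ring))

end FreeDecay

/-! ### Picard iteration in the weighted space. -/

section Existence

lemma supportedWeight_nonneg (a k : ℝ) (z : E3 × ℝ) : 0 ≤ supportedWeight a k z := by
  unfold supportedWeight
  split_ifs
  · exact decayProfile_nonneg (norm_nonneg _) (le_max_right _ _)
  · exact le_rfl

lemma supportedWeight_le_one {a : ℝ} (ha : 0 ≤ a) (k : ℝ) (z : E3 × ℝ) :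
    supportedWeight a k z ≤ 1 := by
  unfold supportedWeight
  split_ifs
  · exact decayProfile_le_one ha (norm_nonneg _) (le_max_right _ _)
  · exact zero_le_one

lemma supportedWeight_clamp (a k : ℝ) (z : E3 × ℝ) :
    supportedWeight a k (z.1, max z.2 0) = supportedWeight a k z := by
  simp [supportedWeight]

lemma duhamelIntegral_sub {V W : E3 × ℝ → ℝ} (hV : Continuous V) (hW : Continuous W) (x : E3)
    (t : ℝ) : duhamelIntegral (fun z => V z - W z) x t
      = duhamelIntegral V x t - duhamelIntegral W x t := by
  rw [duhamelIntegral_eq_coneDuhamel hV, duhamelIntegral_eq_coneDuhamel hW,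
    duhamelIntegral_eq_coneDuhamel (by fun_prop : Continuous fun z => V z - W z), ← mul_sub, ← ContinuousMap.sub_apply, ← map_sub]
  rfl

lemma abs_abs_rpow_sub_le {p R a b : ℝ} (hp : 1 ≤ p) (ha : |a| ≤ R) (hb : |b| ≤ R) :
    |(|a| ^ p - |b| ^ p)| ≤ p * R ^ (p - 1) * |a - b| := by
  have h := (convex_Icc (0 : ℝ) R).norm_image_sub_le_of_norm_hasDerivWithin_le
    (f := fun x => x ^ p) (C := p * R ^ (p - 1))
    (fun x _ => (Real.hasDerivAt_rpow_const (Or.inr hp)).hasDerivWithinAt)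
    (fun x hx => by
      have hx0 := hx.1
      rw [Real.norm_eq_abs, abs_of_nonneg (by positivity)]
      exact mul_le_mul_of_nonneg_left (Real.rpow_le_rpow hx.1 hx.2 (by linarith)) (by linarith))
    (mem_Icc.2 ⟨abs_nonneg b, hb⟩) (mem_Icc.2 ⟨abs_nonneg a, ha⟩)
  have hR : 0 ≤ R := (abs_nonneg a).trans ha
  exact h.trans (mul_le_mul_of_nonneg_left (abs_abs_sub_abs_le a b) (by positivity))

lemma continuous_source {p : ℝ} (hp : 0 ≤ p) {u : E3 × ℝ → ℝ} (hu : Continuous u) :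
    Continuous (source p u) :=
  ((contDiff_decayWeight p (n := 0)).continuous.comp continuous_snd).mul
    (hu.abs.rpow_const fun _ => Or.inr hp)

lemma decayWeight_nonneg (p s : ℝ) : 0 ≤ decayWeight p s := Real.rpow_nonneg (shiftedTime_pos s).le _

/-- One step of the Picard iteration. -/
def picardStep (p : ℝ) (w₀ u : E3 × ℝ → ℝ) (z : E3 × ℝ) : ℝ :=
  w₀ (z.1, max z.2 0) + duhamelIntegral (source p u) z.1 (max z.2 0)

lemma continuous_picardStep {p : ℝ} (hp : 0 ≤ p) {w₀ u : E3 × ℝ → ℝ} (hw₀ : Continuous w₀)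
    (hu : Continuous u) : Continuous (picardStep p w₀ u) := by
  have hc : Continuous fun z : E3 × ℝ => (z.1, max z.2 0) := by fun_prop
  exact (hw₀.comp hc).add ((continuous_duhamelIntegral (continuous_source hp hu)).comp hc)

variable {p a k C m : ℝ} {w₀ u v : E3 × ℝ → ℝ}

/-- In the weighted ball of radius `2m`, the free wave takes one half of the radius and the Duhamel
term, by `C (2m)^p ≤ m`, at most the other. -/
lemma abs_picardStep_le (hp : 1 < p) (hm : 0 ≤ m)
    (hC : ∀ (A : ℝ) (W : E3 × ℝ → ℝ), 0 ≤ A → Continuous W →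
      (∀ z : E3 × ℝ, 0 ≤ z.2 → |W z| ≤ A * (decayWeight p z.2 * supportedWeight a k z ^ p)) →
      ∀ x t, 0 ≤ t → |duhamelIntegral W x t| ≤ C * A * supportedWeight a k (x, t))
    (hCm : C * (2 * m) ^ p ≤ m)
    (hw : ∀ x t, 0 ≤ t → |w₀ (x, t)| ≤ m * supportedWeight a k (x, t))
    (hu : Continuous u) (hub : ∀ z, |u z| ≤ 2 * m * supportedWeight a k z) (z : E3 × ℝ) :
    |picardStep p w₀ u z| ≤ 2 * m * supportedWeight a k z := by
  have h1 := hw z.1 _ (le_max_right z.2 0)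
  have h2 := hC ((2 * m) ^ p) (source p u) (by positivity) (continuous_source (by linarith) hu)
    (fun z _ => by
      rw [source, abs_mul, abs_of_nonneg (decayWeight_nonneg _ _),
        abs_of_nonneg (by positivity : 0 ≤ |u z| ^ p), mul_left_comm,
        ← Real.mul_rpow (by positivity) (supportedWeight_nonneg _ _ _)]
      exact mul_le_mul_of_nonneg_left (Real.rpow_le_rpow (abs_nonneg _) (hub z) (by linarith))
        (decayWeight_nonneg _ _)) z.1 _ (le_max_right z.2 0)
  rw [supportedWeight_clamp] at h1 h2
  have h3 := mul_le_mul_of_nonneg_right hCm (supportedWeight_nonneg a k z)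
  refine (abs_add_le _ _).trans ?_
  linarith

/-- The mean value bound for `|·|^p` gives a difference of sources at most `p (2m w)^{p-1} d w`,
again a multiple of `w^p`, so the same a priori estimate applies with constant linear in `d`. -/
lemma abs_picardStep_sub_le (hp : 1 < p) (hm : 0 ≤ m)
    (hC : ∀ (A : ℝ) (W : E3 × ℝ → ℝ), 0 ≤ A → Continuous W →
      (∀ z : E3 × ℝ, 0 ≤ z.2 → |W z| ≤ A * (decayWeight p z.2 * supportedWeight a k z ^ p)) →
      ∀ x t, 0 ≤ t → |duhamelIntegral W x t| ≤ C * A * supportedWeight a k (x, t))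
    (hCm : C * (p * (2 * m) ^ (p - 1)) ≤ 1 / 2)
    (hu : Continuous u) (hub : ∀ z, |u z| ≤ 2 * m * supportedWeight a k z)
    (hv : Continuous v) (hvb : ∀ z, |v z| ≤ 2 * m * supportedWeight a k z)
    {d : ℝ} (hd : 0 ≤ d) (huv : ∀ z, |u z - v z| ≤ d * supportedWeight a k z) (z : E3 × ℝ) :
    |picardStep p w₀ u z - picardStep p w₀ v z| ≤ d / 2 * supportedWeight a k z := by
  have hp0 : 0 ≤ p := by linarith
  have h2 := hC (p * (2 * m) ^ (p - 1) * d) (fun z => source p u z - source p v z) (by positivity)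
    ((continuous_source hp0 hu).sub (continuous_source hp0 hv))
    (fun z _ => by
      have hw := supportedWeight_nonneg a k z
      rw [source, source, ← mul_sub, abs_mul, abs_of_nonneg (decayWeight_nonneg _ _),
        mul_left_comm]
      refine mul_le_mul_of_nonneg_left ((abs_abs_rpow_sub_le hp.le (hub z) (hvb z)).trans ?_)
        (decayWeight_nonneg _ _)
      refine (mul_le_mul_of_nonneg_left (huv z) (by positivity)).trans (le_of_eq ?_)
      have e : supportedWeight a k z ^ p = supportedWeight a k z ^ (p - 1) * supportedWeight a k z := by
        rw [← Real.rpow_add_one' hw (by linarith), sub_add_cancel]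
      rw [Real.mul_rpow (by positivity) hw, e]
      ring) z.1 _ (le_max_right z.2 0)
  rw [supportedWeight_clamp, duhamelIntegral_sub (continuous_source hp0 hu)
    (continuous_source hp0 hv)] at h2
  rw [picardStep, picardStep, add_sub_add_left_eq_sub]
  refine h2.trans ?_
  have h3 := mul_le_mul_of_nonneg_right hCm (mul_nonneg hd (supportedWeight_nonneg a k z))
  linarith

/-- Picard iteration in the weighted space. -/
theorem exists_picardStep_fixedPoint (hp : 1 < p) (ha : 0 ≤ a) (hm : 0 ≤ m)
    (hC : ∀ (A : ℝ) (W : E3 × ℝ → ℝ), 0 ≤ A → Continuous W →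
      (∀ z : E3 × ℝ, 0 ≤ z.2 → |W z| ≤ A * (decayWeight p z.2 * supportedWeight a k z ^ p)) →
      ∀ x t, 0 ≤ t → |duhamelIntegral W x t| ≤ C * A * supportedWeight a k (x, t))
    (hCm : C * (2 * m) ^ p ≤ m) (hCm' : C * (p * (2 * m) ^ (p - 1)) ≤ 1 / 2)
    (hw₀ : Continuous w₀) (hw : ∀ x t, 0 ≤ t → |w₀ (x, t)| ≤ m * supportedWeight a k (x, t)) :
    ∃ u : E3 × ℝ → ℝ, Continuous u ∧ ∀ z, picardStep p w₀ u z = u z := by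
  have hp0 : 0 ≤ p := by linarith
  let U : ℕ → E3 × ℝ → ℝ := fun n => (picardStep p w₀)^[n] 0
  have hsucc : ∀ n, U (n + 1) = picardStep p w₀ (U n) := fun n =>
    Function.iterate_succ_apply' _ _ _
  have hU : ∀ n, Continuous (U n) ∧ ∀ z, |U n z| ≤ 2 * m * supportedWeight a k z := fun n => by
    induction n with
    | zero =>
      refine ⟨continuous_const, fun z => ?_⟩
      have := supportedWeight_nonneg a k z
      change |(0 : ℝ)| ≤ _
      rw [abs_zero]
      positivity
    | succ n ih =>
      rw [hsucc]
      exact ⟨continuous_picardStep hp0 hw₀ ih.1, abs_picardStep_le hp hm hC hCm hw ih.1 ih.2⟩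
  have hstep : ∀ n z, |U (n + 1) z - U n z| ≤ 2 * m / 2 ^ n * supportedWeight a k z := fun n => by
    induction n with
    | zero =>
      intro z
      have h := (hU 1).2 z
      change |U 1 z - 0| ≤ _
      rwa [sub_zero, pow_zero, div_one]
    | succ n ih =>
      intro z
      have h := abs_picardStep_sub_le (w₀ := w₀) hp hm hC hCm' (hU (n + 1)).1 (hU (n + 1)).2
        (hU n).1 (hU n).2 (by positivity) ih z
      rw [← hsucc, ← hsucc, div_div, ← pow_succ] at h
      exact h
  have hdist : ∀ z n, dist (U n z) (U (n + 1) z) ≤ 4 * m * supportedWeight a k z / 2 / 2 ^ n :=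
    fun z n => by
      rw [dist_comm, Real.dist_eq]
      exact (hstep n z).trans (le_of_eq (by ring))
  choose u hu using fun z =>
    cauchySeq_tendsto_of_complete (cauchySeq_of_le_geometric_two (hdist z))
  have hlim : ∀ n z, |U n z - u z| ≤ 4 * m / 2 ^ n * supportedWeight a k z := fun n z => by
    have h := dist_le_of_le_geometric_two_of_tendsto (hdist z) (hu z) n
    rw [Real.dist_eq] at h
    exact h.trans (le_of_eq (by ring))
  have hgeom : ∀ c : ℝ, Tendsto (fun n : ℕ => c / 2 ^ n) atTop (𝓝 0) := fun c =>
    tendsto_const_nhds.div_atTop (tendsto_pow_atTop_atTop_of_one_lt one_lt_two)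
  -- The weight is at most one, so weighted convergence is uniform and continuity passes to the
  -- limit.
  have huc : Continuous u := by
    have hunif : TendstoUniformly U u atTop := by
      rw [Metric.tendstoUniformly_iff]
      intro ε hε
      filter_upwards [(hgeom (4 * m)).eventually (gt_mem_nhds hε)] with n hn z
      rw [dist_comm, Real.dist_eq]
      exact ((hlim n z).trans (mul_le_of_le_one_right (by positivity)
        (supportedWeight_le_one ha k z))).trans_lt hn
    exact hunif.continuous (Frequently.of_forall fun n => (hU n).1)
  have hub : ∀ z, |u z| ≤ 2 * m * supportedWeight a k z := fun z =>
    le_of_tendsto (hu z).abs (Eventually.of_forall fun n => (hU n).2 z)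
  refine ⟨u, huc, fun z => sub_eq_zero.1 (abs_nonpos_iff.1 ?_)⟩
  have hz := (hgeom (4 * m)).mul_const (supportedWeight a k z)
  rw [zero_mul] at hz
  -- Both the image of `u` and `u` itself are compared with the iterate of index `n + 1`; each
  -- comparison costs half of the bound at `n`.
  refine ge_of_tendsto hz (Eventually.of_forall fun n => ?_)
  have h1 := abs_picardStep_sub_le (w₀ := w₀) hp hm hC hCm' huc hub (hU n).1 (hU n).2
    (by positivity) (fun z => (abs_sub_comm _ _).trans_le (hlim n z)) z
  have h2 := hlim (n + 1) z
  rw [hsucc] at h2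
  have h3 := abs_sub_le (picardStep p w₀ u z) (picardStep p w₀ (U n) z) (u z)
  have h4 : 4 * m / 2 ^ (n + 1) = 4 * m / 2 ^ n / 2 := by rw [pow_succ, div_div]
  rw [h4] at h2
  linarith

end Existence

/-! ### Choice of constants and assembly. -/

section Main

lemma exists_smallness {p : ℝ} (hp : 1 < p) {C : ℝ} (hC : 0 ≤ C) :
    ∃ m₀ : ℝ, 0 < m₀ ∧ ∀ m, 0 ≤ m → m ≤ m₀ →
      C * (2 * m) ^ p ≤ m ∧ C * (p * (2 * m) ^ (p - 1)) ≤ 1 / 2 := by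
  have hB : 0 < 2 * (C * p * 2 + 1) := by positivity
  -- Chosen so that `C p (2m)^{p-1} ≤ 1 / 4`. Since `p > 1`, also `C (2m)^{p-1} ≤ 1 / 4`, and
  -- multiplying by `2m` gives the first inequality.
  refine ⟨(1 / (2 * (C * p * 2 + 1))) ^ (p - 1)⁻¹ / 2, by positivity, fun m hm hm₀ => ?_⟩
  have h1 : (2 * m) ^ (p - 1) ≤ 1 / (2 * (C * p * 2 + 1)) := by
    refine (Real.rpow_le_rpow (by linarith) (by linarith) (by linarith)).trans (le_of_eq
      (Real.rpow_inv_rpow (by positivity) (by linarith : p - 1 ≠ 0)))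
  have h2 : C * (p * (2 * m) ^ (p - 1)) ≤ 1 / 4 := by
    refine (mul_le_mul_of_nonneg_left (mul_le_mul_of_nonneg_left h1 (by linarith)) hC).trans ?_
    rw [mul_one_div, mul_div_assoc', div_le_div_iff₀ hB (by norm_num)]
    linarith
  have h3 : 0 ≤ C * (2 * m) ^ (p - 1) := by positivity
  refine ⟨?_, h2.trans (by norm_num)⟩
  have h4 : C * (2 * m) ^ (p - 1) ≤ 1 / 4 := by nlinarith
  have h5 : (2 * m) ^ p = (2 * m) ^ (p - 1) * (2 * m) := by
    rw [← Real.rpow_add_one' (by linarith) (by linarith), sub_add_cancel]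
  rw [h5]
  nlinarith

/-- The critical exponent is the positive root of `2p² - 3p - 1`, equivalently of `(2p - 3) p = 1`.
-/
lemma one_lt_mul_of_strauss {p : ℝ} (hp : (3 + Real.sqrt 17) / 4 < p) :
    0 < 2 * p - 3 ∧ 1 < (2 * p - 3) * p := by
  have h1 : (4 : ℝ) < Real.sqrt 17 := Real.lt_sqrt_of_sq_lt (by norm_num)
  have h2 : Real.sqrt 17 ^ 2 = 17 := Real.sq_sqrt (by norm_num)
  constructor
  · linarith
  · nlinarith

lemma regularity_eq (p : ℝ) : regularity p = 1 ∨ regularity p = 2 := by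
  unfold regularity
  split_ifs
  · exact Or.inl rfl
  · exact Or.inr rfl

/-- The extension of a function on the half space by its initial values. -/
lemma exists_continuous_extension {v : E3 × ℝ → ℝ} (hv : ContinuousOn v halfSpace) :
    ∃ V : C(E3 × ℝ, ℝ), EqOn V v halfSpace := by
  refine ⟨⟨fun z => v (z.1, max z.2 0), hv.comp_continuous (by fun_prop) fun z =>
    mem_halfSpace (le_max_right _ _)⟩, fun z hz => ?_⟩
  rw [halfSpace_eq] at hz
  change v (z.1, max z.2 0) = v z
  rw [max_eq_left hz]

/-- Small data global existence and uniqueness. -/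
theorem exists_unique_global_solution {p : ℝ} (hp : (3 + Real.sqrt 17) / 4 < p) {f g : E3 → ℝ}
    (hf : ContDiff ℝ 3 f) (hf_supp : HasCompactSupport f) (hg : ContDiff ℝ 2 g)
    (hg_supp : HasCompactSupport g) :
    ∃ ε₀ : ℝ, 0 < ε₀ ∧ ∀ ε : ℝ, 0 < ε → ε ≤ ε₀ →
      ∃ u : E3 × ℝ → ℝ,
        (ContDiffOn ℝ (regularity p : WithTop ℕ∞) u halfSpace ∧ SolvesIntegralEq p ε f g u) ∧
        ∀ v : E3 × ℝ → ℝ,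
          ContDiffOn ℝ (regularity p : WithTop ℕ∞) v halfSpace → SolvesIntegralEq p ε f g v →
            Set.EqOn v u halfSpace := by
  obtain ⟨ha, hdec⟩ := one_lt_mul_of_strauss hp
  have hp1 : 1 < p := by linarith
  obtain ⟨k₁, hk₁⟩ := hf_supp.isCompact.isBounded.subset_closedBall 0
  obtain ⟨k₂, hk₂⟩ := hg_supp.isCompact.isBounded.subset_closedBall 0
  obtain ⟨k, hk, hk₁', hk₂'⟩ : ∃ k, 0 < k ∧ k₁ ≤ k ∧ k₂ ≤ k :=
    ⟨max 1 (max k₁ k₂), by positivity, by simp, by simp⟩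
  obtain ⟨C, hC, hbound⟩ := exists_abs_duhamelIntegral_le hp1 ha rfl hdec hk.le
  obtain ⟨C₀, hC₀, hfree⟩ := exists_abs_freeWave_le ha hk (hf.of_le (by norm_num)) hg.continuous
    hf_supp hg_supp (hk₁.trans (Metric.closedBall_subset_closedBall hk₁'))
    (hk₂.trans (Metric.closedBall_subset_closedBall hk₂'))
  obtain ⟨m₀, hm₀, hsmall⟩ := exists_smallness hp1 hC
  have hn : regularity p ≠ 0 := by rcases regularity_eq p with h | h <;> rw [h] <;> norm_num
  have hn2 : (regularity p : WithTop ℕ∞) ≤ 2 := by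
    rcases regularity_eq p with h | h <;> rw [h] <;> norm_num
  have hn1 : (1 : WithTop ℕ∞) ≤ regularity p := by exact_mod_cast Nat.one_le_iff_ne_zero.2 hn
  have hG : ContDiff ℝ (regularity p) fun q : ℝ × ℝ => decayWeight p q.1 * |q.2| ^ p :=
    ((contDiff_decayWeight p).comp contDiff_fst).mul ((contDiff_abs_rpow hp1).comp contDiff_snd)
  -- The iteration runs with `m = (C₀ + 1) ε`, which dominates the free wave; the added one keeps
  -- the denominator positive when `C₀ = 0`.
  refine ⟨m₀ / (C₀ + 1), by positivity, fun ε hε hε₀ => ?_⟩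
  have hm : (C₀ + 1) * ε ≤ m₀ := by rwa [le_div_iff₀' (by positivity)] at hε₀
  obtain ⟨hs1, hs2⟩ := hsmall _ (by positivity) hm
  have hw₀ := contDiff_freeWave hf hg ε
  obtain ⟨u, huc, hfix⟩ := exists_picardStep_fixedPoint hp1 ha.le (by positivity) hbound hs1 hs2
    hw₀.continuous fun x t ht => (hfree ε hε.le x t ht).trans
      (mul_le_mul_of_nonneg_right (by nlinarith) (supportedWeight_nonneg _ _ _))
  have hueq : ∀ x t, 0 ≤ t →
      u (x, t) = freeWave ε f g (x, t) + duhamelIntegral (source p u) x t := fun x t ht => by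
    have := (hfix (x, t)).symm
    rwa [picardStep, max_eq_left ht] at this
  refine ⟨u, ⟨contDiffOn_of_duhamel_eq hn hG (hw₀.of_le hn2) ⟨u, huc⟩ hueq, fun x t ht => ?_⟩,
    fun v hv hveq => ?_⟩
  · rw [duhamel_eq_duhamelIntegral (eqOn_refl u _) ht]
    exact hueq x t ht
  -- The competitor need not satisfy the weighted bound or have any support property: uniqueness is
  -- local on backward cones and uses only continuity.
  · obtain ⟨V, hV⟩ := exists_continuous_extension hv.continuousOn
    have h := eqOn_of_duhamel_eq (hG.of_le hn1) ⟨u, huc⟩ V hueq fun x t ht => by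
      rw [hV (mem_halfSpace ht), hveq x t ht, duhamel_eq_duhamelIntegral hV ht]
      rfl
    exact fun z hz => (hV hz).symm.trans (h hz)

end Main

end

end Development

theorem theorem1 (p : ℝ) (hp : (3 + Real.sqrt 17) / 4 < p) (f g : E3 → ℝ)
    (hf : ContDiff ℝ ((2 + regularity p : ℕ) : WithTop ℕ∞) f) (hf_supp : HasCompactSupport f)
    (hg : ContDiff ℝ ((1 + regularity p : ℕ) : WithTop ℕ∞) g) (hg_supp : HasCompactSupport g) :
    (∀ ε : ℝ, 0 < ε →
      IsLinearWave (fun x => ε * f x) (fun x => ε * (f x + g x)) (freeWave ε f g) ∧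
      (2 ≤ p → ∀ u : E3 × ℝ → ℝ, ContDiffOn ℝ 2 u halfSpace →
        (SolvesIntegralEq p ε f g u ↔
          IsDampedWave 2 1 p (fun x => ε * f x) (fun x => ε * g x)
            (fun z => u z / (1 + z.2))))) ∧
    ∃ ε₀ : ℝ, 0 < ε₀ ∧ ∀ ε : ℝ, 0 < ε → ε ≤ ε₀ →
      ∃ u : E3 × ℝ → ℝ,
        (ContDiffOn ℝ (regularity p : WithTop ℕ∞) u halfSpace ∧ SolvesIntegralEq p ε f g u) ∧
        ∀ v : E3 × ℝ → ℝ,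
          ContDiffOn ℝ (regularity p : WithTop ℕ∞) v halfSpace → SolvesIntegralEq p ε f g v →
            Set.EqOn v u halfSpace := by
  have hf3 : ContDiff ℝ 3 f := hf.of_le (by
    rcases regularity_eq p with h | h <;> rw [h] <;> norm_num)
  have hg2 : ContDiff ℝ 2 g := hg.of_le (by
    rcases regularity_eq p with h | h <;> rw [h] <;> norm_num)
  exact ⟨fun ε _ => ⟨isLinearWave_freeWave hf3 hg2 ε,
    fun hp2 _ hu => solvesIntegralEq_iff hf3 hg2 hp2 hu⟩,
    exists_unique_global_solution hp hf3 hf_supp hg2 hg_supp⟩
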